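/- Let $n\in\mathbb N$ and let $q_0\in\mathbb C^\times$ be not a root of unity. **The space.** Let $\bar Q$ be the doubled tadpole quiver: vertices $0,\infty$, arrows $x:0\to0$, $v:0\to\infty$ and their opposites $y=x^*:0\to 0$, $w=v^*:\infty\to0$, with $\epsilon(x)=\epsilon(v)=1$, $\epsilon(y)=\epsilon(w)=-1$ and the ordering $x<y<v<w$; paths are composed from left to right. Let $\mathrm{Rep}$ be the affine space of quadruples $(X,Y,V,W)\in \mathrm{Mat}_{n\times n}^2\times\mathrm{Mat}_{n\times1}\times\mathrm{Mat}_{1\times n}$ (representations of $\mathbb C\bar Q$ of dimension $(\alpha_\infty,\alpha_0)=(1,n)$). Van den Bergh's bivector $$P=\tfrac12\sum_{a\in\bar Q}\epsilon(a)(1+a^*a)\frac{\partial}{\partial a}\frac{\partial}{\partial a^*}-\tfrac12\sum_{a<b}\Big(\frac{\partial}{\partial a^*}a^*-a\frac{\partial}{\partial a}\Big)\Big(\frac{\partial}{\partial b^*}b^*-b\frac{\partial}{\partial b}\Big)$$ defines a double quasi-Poisson bracket $\{\!\{-,-\}\!\}$ on $\mathbb C\bar Q$, and hence the antisymmetric biderivation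 on functions on $\mathrm{Rep}$ with $\{a_{ij},b_{uv}\}=\{\!\{a,b\}\!\}'_{uj}\{\!\{a,b\}\!\}''_{iv}$ for arrows $a,b$. Let $M\subset \mathrm{Rep}$ be the set of quadruples for which $X$, $1+XY$, $1+YX$, $1+VW$, $1+WV$ are invertible and $$(1+XY)(1+YX)^{-1}(1+VW)=q_0\,\mathrm{Id}_n,\qquad (1+WV)^{-1}=q_0^{-n},$$ and let $\mathcal C^0_{n,q_0}=M/\mathrm{GL}_n$ for the action $g.(X,Y,V,W)=(gXg^{-1},gYg^{-1},gV,Wg^{-1})$. The Poisson bracket $\{f,g\}$ of functions $f,g$ on $\mathcal C^0_{n,q_0}$ that are holomorphic near a point $[p]$ is computed at $[p]$ as $\{F,G\}(p)$, for any holomorphic functions $F,G$ on a neighbourhood of $p\in M$ in $\mathrm{Rep}$ that coincide on $M$ near $p$ with $f,g$ (pulled back to $M$). **The parametrization.** Let $\mathfrak h_{\rm reg}=\{x\in\mathbb C^n: x_i\ne0 \text{ for all } i;\ x_i\neq x_j,\ x_i\ne q_0x_j \text{ for all } i\neq j\}$ and $\mathfrak h^\times=(\mathbb C^\times)^n$.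 For $(x,\nu)\in\mathfrak h_{\rm reg}\times\mathfrak h^\times$ there is exactly one point $\xi(x,\nu)\in\mathcal C^0_{n,q_0}$ that is represented by a quadruple for which $$X=\mathrm{diag}(x_1,\dots,x_n),\qquad Z:=Y+X^{-1},\quad Z_{ij}=\frac{(q_0-1)\nu_j}{q_0-x_i/x_j}.$$ A point $[(X,Y,V,W)]$ equals $\xi(x,\nu)$ if and only if the pair $(X,Y+X^{-1})$ is simultaneously conjugate to this pair. **Claim.** 1. $\xi(x,\nu)=\xi(x',\nu')$ if and only if $(x',\nu')$ arises from $(x,\nu)$ by one simultaneous permutation of the indices, and $\xi:\mathfrak h_{\rm reg}\times\mathfrak h^\times\to\mathcal C^0_{n,q_0}$ is a local biholomorphism. 2. The formulas $$\{x_i,x_j\}'=0,\qquad \{x_i,\nu_j\}'=\delta_{ij}x_i\nu_j,\qquad \{\nu_i,\nu_j\}'=\frac{(1-q_0)^2(x_i+x_j)x_ix_j\nu_i\nu_j}{(x_i-x_j)(x_i-q_0x_j)(x_j-q_0x_i)}\ (i\ne j),\qquad \{\nu_i,\nu_i\}'=0$$ define an $S_n$-invariant Poisson bracket $\{-,-\}'$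 on the holomorphic functions on $\mathfrak h_{\rm reg}\times\mathfrak h^\times$. 3. $\xi$ is a Poisson map: for all $(x,\nu)$ and all functions $f,g$ on $\mathcal C^0_{n,q_0}$ that are holomorphic near $\xi(x,\nu)$ (in particular for all regular functions) $\{f,g\}(\xi(x,\nu))=\{f\circ\xi,g\circ\xi\}'(x,\nu)$, whichever representative $p$ and extensions $F,G$ are used to compute the left-hand side. 4. Put $\sigma_i=\nu_i\prod_{j\ne i}\dfrac{1-x_ix_j^{-1}}{1-q_0x_ix_j^{-1}}$. Then $(x,\nu)\mapsto(x,\sigma)$ is a biholomorphism of $\mathfrak h_{\rm reg}\times\mathfrak h^\times$ onto itself, and $(x,\sigma)$ are log-canonical coordinates: $$\{x_i,x_j\}'=0,\qquad\{x_i,\sigma_j\}'=\delta_{ij}x_i\sigma_j,\qquad\{\sigma_i,\sigma_j\}'=0.$$ -/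

import Mathlib

open scoped TensorProduct Topology

noncomputable section

namespace Tadpole

/-! ## The doubled tadpole quiver and its path algebra -/

/-- The vertices `0` and `∞` of the tadpole quiver. -/
inductive Vertex
  | zero
  | inf
  deriving DecidableEq

instance : Fintype Vertex := ⟨{.zero, .inf}, by intro i; cases i <;> simp⟩

/-- The arrows of the doubled tadpole quiver: `x : 0 → 0`, `v : 0 → ∞` and their opposites
`y = x*`, `w = v*`. -/
inductive Arrow
  | x
  | y
  | v
  | w
  deriving DecidableEq

instance : Fintype Arrow := ⟨{.x, .y, .v, .w}, by intro a; cases a <;> simp⟩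

/-- The tail of an arrow. -/
def tail : Arrow → Vertex
  | .x => .zero
  | .y => .zero
  | .v => .zero
  | .w => .inf

/-- The head of an arrow. -/
def head : Arrow → Vertex
  | .x => .zero
  | .y => .zero
  | .v => .inf
  | .w => .zero

/-- The involution `a ↦ a*` on the arrows. -/
def star : Arrow → Arrow
  | .x => .y
  | .y => .x
  | .v => .w
  | .w => .v

/-- The sign `ε(a)`: `1` on the original arrows and `-1` on the added opposites. -/
def eps : Arrow → ℂ
  | .x => 1
  | .y => -1
  | .v => 1
  | .w => -1

/-- The position of an arrow in the chosen ordering `x < y < v < w`. -/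
def rank : Arrow → ℕ
  | .x => 0
  | .y => 1
  | .v => 2
  | .w => 3

/-- The defining relations of the path algebra (paths are composed from left to right). -/
inductive PathRel : FreeAlgebra ℂ (Vertex ⊕ Arrow) → FreeAlgebra ℂ (Vertex ⊕ Arrow) → Prop
  | idem (i j : Vertex) :
      PathRel (FreeAlgebra.ι ℂ (Sum.inl i) * FreeAlgebra.ι ℂ (Sum.inl j))
        (if i = j then FreeAlgebra.ι ℂ (Sum.inl i) else 0)
  | one : PathRel (∑ i : Vertex, FreeAlgebra.ι ℂ (Sum.inl i)) 1
  | tail (a : Arrow) :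
      PathRel (FreeAlgebra.ι ℂ (Sum.inl (tail a)) * FreeAlgebra.ι ℂ (Sum.inr a))
        (FreeAlgebra.ι ℂ (Sum.inr a))
  | head (a : Arrow) :
      PathRel (FreeAlgebra.ι ℂ (Sum.inr a) * FreeAlgebra.ι ℂ (Sum.inl (head a)))
        (FreeAlgebra.ι ℂ (Sum.inr a))

/-- The path algebra of the doubled tadpole quiver. -/
def PathAlg : Type := RingQuot PathRel

instance : Ring PathAlg := inferInstanceAs (Ring (RingQuot PathRel))

instance : Algebra ℂ PathAlg := inferInstanceAs (Algebra ℂ (RingQuot PathRel))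

/-- The quotient map from the free algebra to the path algebra. -/
def toPathAlg : FreeAlgebra ℂ (Vertex ⊕ Arrow) →ₐ[ℂ] PathAlg := RingQuot.mkAlgHom ℂ PathRel

/-- The idempotent `e_i` of the path algebra. -/
def idemElt (i : Vertex) : PathAlg :=
  toPathAlg (FreeAlgebra.ι ℂ (Sum.inl i))

/-- The element of the path algebra given by an arrow. -/
def arrowElt (a : Arrow) : PathAlg :=
  toPathAlg (FreeAlgebra.ι ℂ (Sum.inr a))

/-! ## Double derivations and the double bracket of the bivector -/

/-- A double derivation of the path algebra, linear over the span of the idempotents. It is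
determined by its values on the arrows, and only these values are recorded here. -/
abbrev DoubleDer : Type := Arrow → PathAlg ⊗[ℂ] PathAlg

/-- The double derivation `∂/∂a`. -/
def partialDer (a : Arrow) : DoubleDer :=
  fun b => if a = b then idemElt (tail a) ⊗ₜ[ℂ] idemElt (head a) else 0

/-- Left multiplication for the inner bimodule structure: `(b δ)(a) = δ(a)' ⊗ b δ(a)''`. -/
def innerLeft (b : PathAlg) (δ : DoubleDer) : DoubleDer :=
  fun a => TensorProduct.map LinearMap.id (LinearMap.mulLeft ℂ b) (δ a)

/-- Right multiplication for the inner bimodule structure: `(δ c)(a) = δ(a)' c ⊗ δ(a)''`. -/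
def innerRight (δ : DoubleDer) (c : PathAlg) : DoubleDer :=
  fun a => TensorProduct.map (LinearMap.mulRight ℂ c) LinearMap.id (δ a)

/-- The bilinear operation `(p' ⊗ p'', r' ⊗ r'') ↦ p' r'' ⊗ r' p''`. -/
def twistMul (p r : PathAlg ⊗[ℂ] PathAlg) : PathAlg ⊗[ℂ] PathAlg :=
  TensorProduct.map₂ (LinearMap.mul ℂ PathAlg) (LinearMap.mul ℂ PathAlg).flip p
    (TensorProduct.comm ℂ PathAlg PathAlg r)

/-- The double bracket of the product `δ₁ δ₂` of two double derivations, on two arrows: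
`δ₂(b)' δ₁(a)'' ⊗ δ₁(a)' δ₂(b)'' - δ₁(b)' δ₂(a)'' ⊗ δ₂(a)' δ₁(b)''`. -/
def bracketOfProduct (δ₁ δ₂ : DoubleDer) (a b : Arrow) : PathAlg ⊗[ℂ] PathAlg :=
  twistMul (δ₂ b) (δ₁ a) - twistMul (δ₁ b) (δ₂ a)

/-- The double derivation `F_a = (∂/∂a*) a* - a (∂/∂a)`. -/
def gaugeDer (a : Arrow) : DoubleDer :=
  innerRight (partialDer (star a)) (arrowElt (star a)) - innerLeft (arrowElt a) (partialDer a)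

/-- The double quasi-Poisson bracket `{{a, b}}` of two arrows which is associated with
`P = (1/2) ∑_a ε(a) (1 + a* a) (∂/∂a) (∂/∂a*) - (1/2) ∑_{a < b} F_a F_b`.
By the Leibniz rule and linearity over the idempotents, a double bracket on the path algebra is
determined by these values. -/
def doubleBracket (a b : Arrow) : PathAlg ⊗[ℂ] PathAlg :=
  (1 / 2 : ℂ) • ∑ c : Arrow, eps c •
      bracketOfProduct (innerLeft (1 + arrowElt (star c) * arrowElt c) (partialDer c))
        (partialDer (star c)) a b
    - (1 / 2 : ℂ) • ∑ c : Arrow, ∑ d : Arrow,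
        if rank c < rank d then bracketOfProduct (gaugeDer c) (gaugeDer d) a b else 0

/-! ## Representations of dimension `(1, n)` -/

/-- The dimension vector `α = (α_∞, α_0) = (1, n)`. -/
def dim (n : ℕ) : Vertex → ℕ
  | .zero => n
  | .inf => 1

/-- The matrix coordinates on the space of representations: the coordinate `⟨a, (i, j)⟩` is the
`(i, j)` entry of the `α_{t(a)} × α_{h(a)}` matrix that represents the arrow `a`. -/
abbrev Coord (n : ℕ) : Type := Σ a : Arrow, Fin (dim n (tail a)) × Fin (dim n (head a))

/-- The affine space of all representations of the path algebra of dimension `(1, n)`. -/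
abbrev RepSpace (n : ℕ) : Type := Coord n → ℂ

/-- The matrix that represents the arrow `x`. -/
def matX {n : ℕ} (p : RepSpace n) : Matrix (Fin n) (Fin n) ℂ := fun i j => p ⟨.x, (i, j)⟩

/-- The matrix that represents the arrow `y`. -/
def matY {n : ℕ} (p : RepSpace n) : Matrix (Fin n) (Fin n) ℂ := fun i j => p ⟨.y, (i, j)⟩

/-- The matrix that represents the arrow `v`. -/
def matV {n : ℕ} (p : RepSpace n) : Matrix (Fin n) (Fin 1) ℂ := fun i j => p ⟨.v, (i, j)⟩

/-- The matrix that represents the arrow `w`. -/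
def matW {n : ℕ} (p : RepSpace n) : Matrix (Fin 1) (Fin n) ℂ := fun i j => p ⟨.w, (i, j)⟩

/-- The representation with given matrices. -/
def mkRep {n : ℕ} (X Y : Matrix (Fin n) (Fin n) ℂ) (V : Matrix (Fin n) (Fin 1) ℂ)
    (W : Matrix (Fin 1) (Fin n) ℂ) : RepSpace n
  | ⟨.x, (i, j)⟩ => X i j
  | ⟨.y, (i, j)⟩ => Y i j
  | ⟨.v, (i, j)⟩ => V i j
  | ⟨.w, (i, j)⟩ => W i j

/-- The index set of the `(n + 1) × (n + 1)` matrices, split into blocks by the vertices. -/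
abbrev Block (n : ℕ) : Type := Σ i : Vertex, Fin (dim n i)

/-- The block matrix that represents `e_i`. -/
def idemMat (n : ℕ) (i : Vertex) : Matrix (Block n) (Block n) ℂ :=
  Matrix.diagonal fun r => if r.1 = i then 1 else 0

/-- The block matrix that represents an arrow `a`: its only block is in position
`(t(a), h(a))`. -/
def arrowMat {n : ℕ} (p : RepSpace n) (a : Arrow) : Matrix (Block n) (Block n) ℂ :=
  ∑ i : Fin (dim n (tail a)), ∑ j : Fin (dim n (head a)),
    Matrix.single ⟨tail a, i⟩ ⟨head a, j⟩ (p ⟨a, (i, j)⟩)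

theorem arrowMat_apply_tail {n : ℕ} (p : RepSpace n) (a : Arrow) (r c : Block n)
    (h : r.1 ≠ tail a) : arrowMat p a r c = 0 := by
  simp only [arrowMat, Matrix.sum_apply]
  refine Finset.sum_eq_zero fun i _ => Finset.sum_eq_zero fun j _ => ?_
  rw [Matrix.single_apply, if_neg]
  rintro ⟨rfl, -⟩
  exact h rfl

theorem arrowMat_apply_head {n : ℕ} (p : RepSpace n) (a : Arrow) (r c : Block n)
    (h : c.1 ≠ head a) : arrowMat p a r c = 0 := by
  simp only [arrowMat, Matrix.sum_apply]
  refine Finset.sum_eq_zero fun i _ => Finset.sum_eq_zero fun j _ => ?_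
  rw [Matrix.single_apply, if_neg]
  rintro ⟨-, rfl⟩
  exact h rfl

theorem lift_rel {n : ℕ} (p : RepSpace n) ⦃s t : FreeAlgebra ℂ (Vertex ⊕ Arrow)⦄
    (h : PathRel s t) :
    FreeAlgebra.lift ℂ (Sum.elim (idemMat n) (arrowMat p)) s =
      FreeAlgebra.lift ℂ (Sum.elim (idemMat n) (arrowMat p)) t := by
  cases h with
  | idem i j =>
    split_ifs with hij
    · subst hij
      simp [idemMat, Matrix.diagonal_mul_diagonal]
    · simp only [map_mul, FreeAlgebra.lift_ι_apply, Sum.elim_inl, idemMat,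
        Matrix.diagonal_mul_diagonal, map_zero]
      rw [← Matrix.diagonal_zero]
      congr 1
      funext r
      by_cases h1 : r.1 = i
      · simp [h1, hij]
      · simp [h1]
  | one =>
    simp only [map_sum, FreeAlgebra.lift_ι_apply, Sum.elim_inl, map_one, idemMat]
    ext r c
    simp only [Matrix.sum_apply, Matrix.diagonal_apply, Matrix.one_apply]
    by_cases hrc : r = c <;> simp [hrc]
  | tail a =>
    simp only [map_mul, FreeAlgebra.lift_ι_apply, Sum.elim_inl, Sum.elim_inr, idemMat]
    ext r c
    rw [Matrix.diagonal_mul]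
    by_cases h1 : r.1 = Tadpole.tail a
    · simp [h1]
    · rw [arrowMat_apply_tail p a r c h1, mul_zero]
  | head a =>
    simp only [map_mul, FreeAlgebra.lift_ι_apply, Sum.elim_inl, Sum.elim_inr, idemMat]
    ext r c
    rw [Matrix.mul_diagonal]
    by_cases h1 : c.1 = Tadpole.head a
    · simp [h1]
    · rw [arrowMat_apply_head p a r c h1, zero_mul]

/-- The algebra homomorphism from the path algebra to block matrices given by `p`. -/
def repHom {n : ℕ} (p : RepSpace n) : PathAlg →ₐ[ℂ] Matrix (Block n) (Block n) ℂ :=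
  RingQuot.liftAlgHom ℂ
    ⟨FreeAlgebra.lift ℂ (Sum.elim (idemMat n) (arrowMat p)), fun _ _ h => lift_rel p h⟩

/-- The linear map `a' ⊗ a'' ↦ a'_{rc} a''_{r'c'}`, evaluated at `p`. -/
def tensorEntry {n : ℕ} (p : RepSpace n) (r c r' c' : Block n) : PathAlg ⊗[ℂ] PathAlg →ₗ[ℂ] ℂ :=
  LinearMap.mul' ℂ ℂ ∘ₗ TensorProduct.map
    (Matrix.entryLinearMap ℂ ℂ r c ∘ₗ (repHom p).toLinearMap)
    (Matrix.entryLinearMap ℂ ℂ r' c' ∘ₗ (repHom p).toLinearMap)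

/-- The bracket of two matrix coordinates: `{a_{ij}, b_{uv}} = {{a, b}}'_{uj} {{a, b}}''_{iv}`. -/
def coordBracket {n : ℕ} (p : RepSpace n) : Coord n → Coord n → ℂ
  | ⟨a, (i, j)⟩, ⟨b, (u, v)⟩ =>
      tensorEntry p ⟨tail b, u⟩ ⟨head a, j⟩ ⟨tail a, i⟩ ⟨head b, v⟩ (doubleBracket a b)

/-- The antisymmetric biderivation (bivector) on the representation space induced by the double
bracket, applied to two functions that are holomorphic near `p`. -/
def quasiBracket {n : ℕ} (F G : RepSpace n → ℂ) (p : RepSpace n) : ℂ :=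
  ∑ c : Coord n, ∑ d : Coord n,
    fderiv ℂ F p (Pi.single c 1) * fderiv ℂ G p (Pi.single d 1) * coordBracket p c d

/-! ## The Calogero--Moser space -/

/-- The representations of the multiplicative preprojective algebra of dimension `(1, n)`, with
parameter `(q_∞, q_0) = (q^{-n}, q)`, on which `X` is invertible. -/
def momentLevel (n : ℕ) (q : ℂ) : Set (RepSpace n) :=
  {p | IsUnit (matX p) ∧ IsUnit (1 + matX p * matY p) ∧ IsUnit (1 + matY p * matX p) ∧
    IsUnit (1 + matV p * matW p) ∧ IsUnit (1 + matW p * matV p) ∧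
    (1 + matX p * matY p) * (1 + matY p * matX p)⁻¹ * (1 + matV p * matW p) = q • 1 ∧
    (1 + matW p * matV p)⁻¹ = (q ^ n)⁻¹ • 1}

/-- The action of `GL_n` on representations:
`g.(X, Y, V, W) = (g X g⁻¹, g Y g⁻¹, g V, W g⁻¹)`. -/
def gact {n : ℕ} (g : GL (Fin n) ℂ) (p : RepSpace n) : RepSpace n :=
  mkRep (g.val * matX p * g⁻¹.val) (g.val * matY p * g⁻¹.val) (g.val * matV p) (matW p * g⁻¹.val)

@[simp] theorem matX_mkRep {n : ℕ} (X Y : Matrix (Fin n) (Fin n) ℂ) (V : Matrix (Fin n) (Fin 1) ℂ)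
    (W : Matrix (Fin 1) (Fin n) ℂ) : matX (mkRep X Y V W) = X := rfl

@[simp] theorem matY_mkRep {n : ℕ} (X Y : Matrix (Fin n) (Fin n) ℂ) (V : Matrix (Fin n) (Fin 1) ℂ)
    (W : Matrix (Fin 1) (Fin n) ℂ) : matY (mkRep X Y V W) = Y := rfl

@[simp] theorem matV_mkRep {n : ℕ} (X Y : Matrix (Fin n) (Fin n) ℂ) (V : Matrix (Fin n) (Fin 1) ℂ)
    (W : Matrix (Fin 1) (Fin n) ℂ) : matV (mkRep X Y V W) = V := rfl

@[simp] theorem matW_mkRep {n : ℕ} (X Y : Matrix (Fin n) (Fin n) ℂ) (V : Matrix (Fin n) (Fin 1) ℂ)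
    (W : Matrix (Fin 1) (Fin n) ℂ) : matW (mkRep X Y V W) = W := rfl

theorem mkRep_mat {n : ℕ} (p : RepSpace n) : mkRep (matX p) (matY p) (matV p) (matW p) = p := by
  funext c
  obtain ⟨a, i, j⟩ := c
  cases a <;> rfl

theorem gact_one {n : ℕ} (p : RepSpace n) : gact 1 p = p := by
  simp [gact, mkRep_mat]

theorem gact_gact {n : ℕ} (g h : GL (Fin n) ℂ) (p : RepSpace n) :
    gact g (gact h p) = gact (g * h) p := by
  simp only [gact, matX_mkRep, matY_mkRep, matV_mkRep, matW_mkRep, mul_inv_rev, Units.val_mul,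
    Matrix.mul_assoc]

/-- Two representations are equivalent if they lie in the same `GL_n`-orbit. -/
def orbitSetoid (n : ℕ) (q : ℂ) : Setoid (momentLevel n q) where
  r p p' := ∃ g : GL (Fin n) ℂ, gact g p.1 = p'.1
  iseqv :=
    { refl := fun p => ⟨1, gact_one p.1⟩
      symm := by
        rintro p p' ⟨g, hg⟩
        exact ⟨g⁻¹, by rw [← hg, gact_gact, inv_mul_cancel, gact_one]⟩
      trans := by
        rintro p p' p'' ⟨g, hg⟩ ⟨h, hh⟩
        exact ⟨h * g, by rw [← gact_gact, hg, hh]⟩ }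

/-- The Calogero--Moser space `C⁰_{n,q}`, as the space of `GL_n`-orbits. (For `q` not a root of
unity the action is free and all orbits are closed.) -/
def CMSpace (n : ℕ) (q : ℂ) : Type := Quotient (orbitSetoid n q)

/-- The point of the Calogero--Moser space given by a representation. -/
def toCM {n : ℕ} {q : ℂ} (p : momentLevel n q) : CMSpace n q := Quotient.mk (orbitSetoid n q) p

/-- `F` is holomorphic near `p` in the space of all representations and represents the function
`f` on the Calogero--Moser space near `p`. -/
def IsLiftAt {n : ℕ} {q : ℂ} (f : CMSpace n q → ℂ) (p : momentLevel n q)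
    (F : RepSpace n → ℂ) : Prop :=
  AnalyticAt ℂ F p.1 ∧ ∀ᶠ m in 𝓝 p, F m.1 = f (toCM m)

/-! ## The local parametrization -/

/-- The ambient space of the coordinates `(x, ν)`. -/
abbrev Phase (n : ℕ) : Type := (Fin n → ℂ) × (Fin n → ℂ)

/-- The domain `h_reg × h^×`. -/
def phaseDom (n : ℕ) (q : ℂ) : Set (Phase n) :=
  {u | (∀ i, u.1 i ≠ 0) ∧ (∀ i j, i ≠ j → u.1 i ≠ u.1 j ∧ u.1 i ≠ q * u.1 j) ∧ ∀ i, u.2 i ≠ 0}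

/-- The matrix `Z_{ij} = (q - 1) ν_j / (q - x_i / x_j)`. -/
def zMat {n : ℕ} (q : ℂ) (u : Phase n) : Matrix (Fin n) (Fin n) ℂ :=
  Matrix.of fun i j => (q - 1) * u.2 j / (q - u.1 i / u.1 j)

/-- A representation with `X = diag(x)` and `Y + X⁻¹ = Z`. The moment map equations determine `V`
and `W` up to rescaling; here `V` is the column of ones. -/
def xiRep {n : ℕ} (q : ℂ) (u : Phase n) : RepSpace n :=
  mkRep (Matrix.diagonal u.1) (zMat q u - (Matrix.diagonal u.1)⁻¹) (Matrix.of fun _ _ => 1)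
    ((Matrix.of fun _ j => (q - 1) * u.2 j * u.1 j) * (Matrix.diagonal u.1 * zMat q u)⁻¹)

theorem q_sub_div_ne {n : ℕ} {q : ℂ} (hq1 : q ≠ 1) {u : Phase n} (hu : u ∈ phaseDom n q)
    (i j : Fin n) : q - u.1 i / u.1 j ≠ 0 := by
  intro h
  have hj := hu.1 j
  have h1 : u.1 i = q * u.1 j := by
    field_simp at h
    linear_combination -h
  by_cases hij : i = j
  · subst hij
    exact hq1 (mul_right_cancel₀ hj (by rw [← h1, one_mul]))
  · exact (hu.2.1 i j hij).2 h1

theorem isUnit_zMat {n : ℕ} {q : ℂ} (hq0 : q ≠ 0) (hq1 : q ≠ 1) {u : Phase n}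
    (hu : u ∈ phaseDom n q) : IsUnit (zMat q u) := by
  classical
  rw [← Matrix.mulVec_injective_iff_isUnit]
  refine (injective_iff_map_eq_zero (Matrix.mulVecLin (zMat q u))).2 fun c hc => ?_
  have hx := hu.1
  have hinj : Function.Injective u.1 := fun i j h => by
    by_contra hij
    exact (hu.2.1 i j hij).1 h
  have hd : ∀ i j, q * u.1 j - u.1 i ≠ 0 := fun i j h => by
    refine q_sub_div_ne hq1 hu i j ?_
    have := hx j
    field_simp
    linear_combination h
  set b : Fin n → ℂ := fun j => (q - 1) * u.2 j * u.1 j * c j with hb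
  have hsum : ∀ i, ∑ j, b j / (q * u.1 j - u.1 i) = 0 := fun i => by
    have h := congrFun hc i
    simp only [Matrix.mulVecLin_apply, Matrix.mulVec, dotProduct, Pi.zero_apply] at h
    rw [← h]
    refine Finset.sum_congr rfl fun j _ => ?_
    have h1 := hd i j
    have h2 := hx j
    have h3 := q_sub_div_ne hq1 hu i j
    simp only [hb, zMat, Matrix.of_apply]
    rw [div_mul_eq_mul_div, div_eq_div_iff h1 h3]
    field_simp
  set P : Polynomial ℂ := ∑ j, Polynomial.C (b j) *
    ∏ k ∈ Finset.univ.erase j, (Polynomial.C (q * u.1 k) - Polynomial.X) with hP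
  have heval : ∀ t, P.eval t = ∑ j, b j * ∏ k ∈ Finset.univ.erase j, (q * u.1 k - t) := fun t => by
    simp [hP, Polynomial.eval_finsetSum, Polynomial.eval_prod]
  have hP0 : P = 0 := by
    refine Polynomial.eq_zero_of_degree_lt_of_eval_index_eq_zero (s := Finset.univ)
      (v := u.1) hinj.injOn ?_ ?_
    · refine (Polynomial.degree_sum_le _ _).trans_lt ?_
      rw [Finset.sup_lt_iff (by exact WithBot.bot_lt_coe _)]
      intro j _
      refine (Polynomial.degree_mul_le _ _).trans_lt
        ((add_le_of_nonpos_left Polynomial.degree_C_le).trans_lt ?_)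
      rw [Polynomial.degree_prod]
      refine (Finset.sum_le_card_nsmul _ _ 1 fun k _ => ?_).trans_lt ?_
      · refine (Polynomial.degree_sub_le _ _).trans (max_le ?_ Polynomial.degree_X_le)
        exact Polynomial.degree_C_le.trans (by norm_num)
      · rw [Finset.card_erase_of_mem (Finset.mem_univ j), nsmul_eq_mul, mul_one]
        have : 0 < (Finset.univ : Finset (Fin n)).card := Finset.card_pos.2 ⟨j, Finset.mem_univ j⟩
        exact_mod_cast Nat.sub_lt this one_pos
    · intro i _
      have h := congrArg (fun t => (∏ k, (q * u.1 k - u.1 i)) * t) (hsum i)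
      simp only [mul_zero, Finset.mul_sum] at h
      rw [heval, ← h]
      refine Finset.sum_congr rfl fun j _ => ?_
      rw [← Finset.mul_prod_erase _ _ (Finset.mem_univ j)]
      have h1 := hd i j
      field_simp
  funext j
  have h := heval (q * u.1 j)
  rw [hP0, Polynomial.eval_zero, Finset.sum_eq_single j] at h
  · rcases mul_eq_zero.1 h.symm with h1 | h1
    · simp only [hb, mul_eq_zero, hx j, hu.2.2 j, sub_eq_zero, hq1, false_or] at h1
      exact h1
    · obtain ⟨k, hk, h2⟩ := Finset.prod_eq_zero_iff.1 h1
      exact absurd (hinj (mul_left_cancel₀ hq0 (sub_eq_zero.1 h2))) (Finset.ne_of_mem_erase hk)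
  · intro k _ hk
    rw [Finset.prod_eq_zero (i := j) (Finset.mem_erase.2 ⟨hk.symm, Finset.mem_univ j⟩)
      (sub_self _), mul_zero]
  · intro hj
    exact absurd (Finset.mem_univ j) hj

theorem xiRep_mem {n : ℕ} {q : ℂ} (hq0 : q ≠ 0) (hq : ∀ k : ℕ, 0 < k → q ^ k ≠ 1) {u : Phase n}
    (hu : u ∈ phaseDom n q) : xiRep q u ∈ momentLevel n q := by
  have hq1 : q ≠ 1 := by simpa using hq 1 one_pos
  have hx := hu.1
  have hZ := isUnit_zMat hq0 hq1 hu
  set X : Matrix (Fin n) (Fin n) ℂ := Matrix.diagonal u.1 with hXdef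
  set Z := zMat q u with hZdef
  have hX : IsUnit X := by
    rw [Matrix.isUnit_iff_isUnit_det, hXdef, Matrix.det_diagonal, isUnit_iff_ne_zero]
    exact Finset.prod_ne_zero_iff.2 fun i _ => hx i
  have hXd := (Matrix.isUnit_iff_isUnit_det _).1 hX
  have hXY : 1 + X * (Z - X⁻¹) = X * Z := by
    rw [mul_sub, Matrix.mul_nonsing_inv _ hXd]; abel
  have hYX : 1 + (Z - X⁻¹) * X = Z * X := by
    rw [sub_mul, Matrix.nonsing_inv_mul _ hXd]; abel
  have hXZ : IsUnit (X * Z) := hX.mul hZ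
  have hZX : IsUnit (Z * X) := hZ.mul hX
  have hXZd := (Matrix.isUnit_iff_isUnit_det _).1 hXZ
  have hZXd := (Matrix.isUnit_iff_isUnit_det _).1 hZX
  set V : Matrix (Fin n) (Fin 1) ℂ := Matrix.of fun _ _ => 1 with hV
  set W0 : Matrix (Fin 1) (Fin n) ℂ := Matrix.of fun _ j => (q - 1) * u.2 j * u.1 j with hW0
  have hVW0 : V * W0 = q • (Z * X) - X * Z := by
    ext i j
    have h1 := q_sub_div_ne hq1 hu i j
    have h2 := hx j
    rw [Matrix.sub_apply, Matrix.smul_apply, hXdef, Matrix.mul_diagonal, Matrix.diagonal_mul,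
      Matrix.mul_apply, Fin.sum_univ_one]
    simp only [hV, hW0, hZdef, zMat, Matrix.of_apply, smul_eq_mul]
    have h3 : q * u.1 j - u.1 i ≠ 0 := fun h => h1 (by
      field_simp
      linear_combination h)
    field_simp
  have hVW : 1 + V * (W0 * (X * Z)⁻¹) = q • (Z * X * (X * Z)⁻¹) := by
    rw [← Matrix.mul_assoc, hVW0, sub_mul, Matrix.mul_nonsing_inv _ hXZd, Matrix.smul_mul]
    abel
  have hdet : (1 + V * (W0 * (X * Z)⁻¹)).det = q ^ n := by
    rw [hVW, Matrix.det_smul, Fintype.card_fin, Matrix.det_mul, Matrix.det_mul,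
      Matrix.det_nonsing_inv, Matrix.det_mul, mul_comm Z.det,
      Ring.mul_inverse_cancel _ (by rw [← Matrix.det_mul]; exact hXZd), mul_one]
  have hWV : 1 + W0 * (X * Z)⁻¹ * V = q ^ n • 1 := by
    rw [Matrix.det_one_add_mul_comm] at hdet
    ext i j
    rw [Subsingleton.elim i 0, Subsingleton.elim j 0]
    rw [Matrix.det_fin_one] at hdet
    rw [hdet]
    simp
  have hqn : q ^ n ≠ 0 := pow_ne_zero _ hq0
  have hone : IsUnit ((q ^ n) • (1 : Matrix (Fin 1) (Fin 1) ℂ)) := by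
    rw [Matrix.isUnit_iff_isUnit_det, Matrix.det_smul]
    simp [hq0]
  refine ⟨hX, ?_, ?_, ?_, ?_, ?_, ?_⟩
  · change IsUnit (1 + X * (Z - X⁻¹))
    rwa [hXY]
  · change IsUnit (1 + (Z - X⁻¹) * X)
    rwa [hYX]
  · change IsUnit (1 + V * (W0 * (X * Z)⁻¹))
    rw [Matrix.isUnit_iff_isUnit_det, hdet, isUnit_iff_ne_zero]
    exact hqn
  · change IsUnit (1 + W0 * (X * Z)⁻¹ * V)
    rwa [hWV]
  · change (1 + X * (Z - X⁻¹)) * (1 + (Z - X⁻¹) * X)⁻¹ * (1 + V * (W0 * (X * Z)⁻¹)) = q • 1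
    rw [hXY, hYX, hVW, Matrix.mul_smul, Matrix.mul_assoc, ← Matrix.mul_assoc _ _ (X * Z)⁻¹,
      Matrix.nonsing_inv_mul _ hZXd, Matrix.one_mul, Matrix.mul_nonsing_inv _ hXZd]
  · change (1 + W0 * (X * Z)⁻¹ * V)⁻¹ = (q ^ n)⁻¹ • 1
    rw [hWV]
    refine Matrix.inv_eq_right_inv ?_
    rw [Matrix.smul_mul, Matrix.one_mul, smul_smul, mul_inv_cancel₀ hqn, one_smul]

/-- The map `ξ : h_reg × h^× → C⁰_{n,q}`. -/
def xi {n : ℕ} {q : ℂ} (hq0 : q ≠ 0) (hq : ∀ k : ℕ, 0 < k → q ^ k ≠ 1) (u : phaseDom n q) :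
    CMSpace n q :=
  toCM ⟨xiRep q u.1, xiRep_mem hq0 hq u.2⟩

/-- The simultaneous permutation of the `x_i` and the `ν_i`. -/
def permute {n : ℕ} (s : Equiv.Perm (Fin n)) (u : Phase n) : Phase n := (u.1 ∘ s, u.2 ∘ s)

open Classical in
/-- The pull-back `ξ^* f` of a function on the Calogero--Moser space to `h_reg × h^×` (with value
zero outside of this open set). -/
def xiPull {n : ℕ} {q : ℂ} (hq0 : q ≠ 0) (hq : ∀ k : ℕ, 0 < k → q ^ k ≠ 1)
    (f : CMSpace n q → ℂ) : Phase n → ℂ :=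
  fun u => if h : u ∈ phaseDom n q then f (xi hq0 hq ⟨u, h⟩) else 0

/-- `ξ` is a local biholomorphism for the complex structure of the orbit space: near each `u`, and
for each representation `p` of the class `ξ(u)`, it has a holomorphic lift `s` with `s(u) = p`, and
there is a holomorphic map `η` near `p` which computes the local inverse of `ξ`. -/
def IsLocalBiholomorphism {n : ℕ} {q : ℂ} (ξ : phaseDom n q → CMSpace n q) : Prop :=
  ∀ (u : phaseDom n q) (p : momentLevel n q), toCM p = ξ u →
    (∃ s : Phase n → RepSpace n, AnalyticAt ℂ s u.1 ∧ s u.1 = p.1 ∧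
      ∀ᶠ u' in 𝓝 u, ∃ h : s u'.1 ∈ momentLevel n q, toCM ⟨s u'.1, h⟩ = ξ u') ∧
    (∃ η : RepSpace n → Phase n, AnalyticAt ℂ η p.1 ∧
      ∀ᶠ t : phaseDom n q × momentLevel n q in 𝓝 (u, p), toCM t.2 = ξ t.1 ↔ η t.2.1 = t.1.1)

/-! ## The bracket in the coordinates `(x, ν)` -/

/-- The partial derivatives of a function of `(x, ν)`. -/
def phaseDeriv {n : ℕ} (f : Phase n → ℂ) (u : Phase n) : Fin n ⊕ Fin n → ℂ
  | .inl i => fderiv ℂ f u (Pi.single i 1, 0)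
  | .inr i => fderiv ℂ f u (0, Pi.single i 1)

/-- The brackets `{x_i, x_j}'`, `{x_i, ν_j}'`, `{ν_i, x_j}'` and `{ν_i, ν_j}'`. -/
def phaseTensor {n : ℕ} (q : ℂ) (u : Phase n) : Fin n ⊕ Fin n → Fin n ⊕ Fin n → ℂ
  | .inl _, .inl _ => 0
  | .inl i, .inr j => if i = j then u.1 i * u.2 j else 0
  | .inr i, .inl j => if i = j then -(u.1 j * u.2 i) else 0
  | .inr i, .inr j =>
      if i = j then 0 else
        (1 - q) ^ 2 * (u.1 i + u.1 j) * u.1 i * u.1 j * u.2 i * u.2 j /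
          ((u.1 i - u.1 j) * (u.1 i - q * u.1 j) * (u.1 j - q * u.1 i))

/-- The bracket `{f, g}'` of two functions of `(x, ν)`. -/
def phaseBracket {n : ℕ} (q : ℂ) (f g : Phase n → ℂ) : Phase n → ℂ :=
  fun u => ∑ a, ∑ b, phaseDeriv f u a * phaseDeriv g u b * phaseTensor q u a b

/-- `br` is a Poisson bracket on the holomorphic functions on the open set `D`. -/
structure IsPoissonBracketOn {n : ℕ} (D : Set (Phase n))
    (br : (Phase n → ℂ) → (Phase n → ℂ) → Phase n → ℂ) : Prop where
  holomorphic : ∀ f g, AnalyticOnNhd ℂ f D → AnalyticOnNhd ℂ g D → AnalyticOnNhd ℂ (br f g) D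
  linear : ∀ (a b : ℂ) (f g h : Phase n → ℂ), AnalyticOnNhd ℂ f D → AnalyticOnNhd ℂ g D →
    AnalyticOnNhd ℂ h D →
      Set.EqOn (br (a • f + b • g) h) (a • br f h + b • br g h) D
  antisymm : ∀ f g, AnalyticOnNhd ℂ f D → AnalyticOnNhd ℂ g D →
    Set.EqOn (br f g) (-br g f) D
  leibniz : ∀ f g h, AnalyticOnNhd ℂ f D → AnalyticOnNhd ℂ g D → AnalyticOnNhd ℂ h D →
    Set.EqOn (br f (g * h)) (br f g * h + g * br f h) D
  jacobi : ∀ f g h, AnalyticOnNhd ℂ f D → AnalyticOnNhd ℂ g D → AnalyticOnNhd ℂ h D →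
    Set.EqOn (br f (br g h) + br g (br h f) + br h (br f g)) 0 D

/-- The coordinate function `x_i`. -/
def xFun {n : ℕ} (i : Fin n) : Phase n → ℂ := fun u => u.1 i

/-- The coordinate function `ν_i`. -/
def nuFun {n : ℕ} (i : Fin n) : Phase n → ℂ := fun u => u.2 i

/-- The function `σ_i = ν_i ∏_{j ≠ i} (1 - x_i x_j⁻¹) / (1 - q x_i x_j⁻¹)`. -/
def sigmaFun {n : ℕ} (q : ℂ) (i : Fin n) : Phase n → ℂ :=
  fun u => u.2 i * ∏ j ∈ Finset.univ.erase i,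
    (1 - u.1 i * (u.1 j)⁻¹) / (1 - q * u.1 i * (u.1 j)⁻¹)

/-- The change of variables `(x, ν) ↦ (x, σ)`. -/
def sigmaMap {n : ℕ} (q : ℂ) (u : Phase n) : Phase n := (u.1, fun i => sigmaFun q i u)

end Tadpole

end

open scoped TensorProduct Topology
noncomputable section
namespace Tadpole

/-! ## The bivector on the representation space as a trace form -/

/-! Everything is reduced to linear algebra at the points with X = diag(x). A double derivation δ
pairs with a covector α to a block matrix `pairDer p α δ`, and a product δ₁δ₂ then acts on two
covectors by the trace of the product of their matrices, antisymmetrized (`sum_bracketOfProduct`).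
So P becomes an explicit trace form (`bivector_eq_trace_blocks`), from which the Hamiltonian field
`hamField` of a covector is read off.

Two facts make the reduction work. If β vanishes along the GL_n-orbit, its Hamiltonian field is
tangent to the moment level (`momentDeriv_hamField`); this is the infinitesimal form of the
multiplicative moment map property. And at ξ(x, ν) a solution of the linearized moment equation that
is killed by all dx_i and dν_i is tangent to the orbit (`exists_orbitField`). Since the vectors
∂ξ/∂x_i, ∂ξ/∂ν_i are dual to these covectors (`coordCovector_fderiv_xiRep`), the Hamiltonian field
of β is, modulo the orbit, a combination of them. Hence on covectors vanishing along the orbit the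
bivector is determined by its values on the 2n coordinate covectors (`bivector_xiRep`), which are
computed in `bivector_coordCovector`. If F extends a function f on the quotient, dF kills the orbit
directions (`IsLiftAt.gradient_orbitField`) and takes the partial derivatives of f ∘ ξ as its values
on the ∂ξ; nothing else about F enters. Equivariance (`bivector_gact`) takes care of the other
representatives.

For the map ξ itself, the matrix VW has rank one, so (1 + VW)XZ = qZX with X = diag(x) reads (q x_j
- x_i) Z_ij = V_i (WXZ)_j. Rescaling V to a column of ones brings Z into the form `zMat`: the class
depends only on x and the diagonal ν of Z. A matrix intertwining two regular diagonal matrices is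
monomial, so the fibres of ξ are permutation orbits. The local inverse takes for x_i a simple root
of the characteristic polynomial of X, analytic by the implicit function theorem, and for ν_i the
quotient tr(adj(x_i - X) Z) / tr(adj(x_i - X)).

The Jacobi identity is checked directly in the commuting frame x_i ∂/∂x_i, ν_i ∂/∂ν_i. There all
coefficients are constant except those of the pairs (ν_i, ν_j), which are antisymmetric and depend
on x_i and x_j alone; this already suffices (`jacobi_logTensor`). In the same frame the bracket of
σ_i and σ_j is a difference of logarithmic derivatives plus that coefficient, and a partial fraction
identity makes it vanish (`sigma_bracket_identity`). -/

theorem tensorEntry_tmul {n : ℕ} (p : RepSpace n) (r c r' c' : Block n) (a b : PathAlg) :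
    tensorEntry p r c r' c' (a ⊗ₜ[ℂ] b) = repHom p a r c * repHom p b r' c' := by
  simp [tensorEntry]

/-- Both sides are bilinear, so pure tensors suffice, and there the two matrix products introduce
the summation indices k and l. The resulting cyclic index pattern is what later closes up to a
trace. -/
theorem tensorEntry_twistMul {n : ℕ} (p : RepSpace n) (r c r' c' : Block n)
    (s t : PathAlg ⊗[ℂ] PathAlg) :
    tensorEntry p r c r' c' (twistMul s t) =
      ∑ k, ∑ l, tensorEntry p r' l k c t * tensorEntry p r k l c' s := by
  induction s using TensorProduct.induction_on with
  | zero => simp [twistMul]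
  | add s₁ s₂ h₁ h₂ =>
    have h : twistMul (s₁ + s₂) t = twistMul s₁ t + twistMul s₂ t := by simp [twistMul]
    simp only [h, map_add, h₁, h₂, mul_add, Finset.sum_add_distrib]
  | tmul s' s'' =>
    induction t using TensorProduct.induction_on with
    | zero => simp [twistMul]
    | add t₁ t₂ h₁ h₂ =>
      have h : twistMul (s' ⊗ₜ s'') (t₁ + t₂) =
          twistMul (s' ⊗ₜ s'') t₁ + twistMul (s' ⊗ₜ s'') t₂ := by simp [twistMul]
      simp only [h, map_add, h₁, h₂, add_mul, Finset.sum_add_distrib]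
    | tmul t' t'' =>
      have h : twistMul (s' ⊗ₜ s'') (t' ⊗ₜ t'') = (s' * t'') ⊗ₜ[ℂ] (t' * s'') := by
        simp [twistMul]
      simp only [h, tensorEntry_tmul, map_mul, Matrix.mul_apply, Finset.sum_mul_sum]
      refine Finset.sum_congr rfl fun k _ => Finset.sum_congr rfl fun l _ => ?_
      ring

/-- The vector fields `c ↦ δ(c)'_{il} δ(c)''_{kj}` on the representation space that are induced by
a double derivation. -/
def fieldEntry {n : ℕ} (p : RepSpace n) (δ : DoubleDer) (k l : Block n) (c : Coord n) : ℂ :=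
  tensorEntry p ⟨tail c.1, c.2.1⟩ l k ⟨head c.1, c.2.2⟩ (δ c.1)

/-- The matrix obtained by pairing a covector with the vector fields of a double derivation. -/
def pairDer {n : ℕ} (p α : RepSpace n) (δ : DoubleDer) : Matrix (Block n) (Block n) ℂ :=
  Matrix.of fun k l => ∑ c, α c * fieldEntry p δ k l c

theorem pairDer_sub {n : ℕ} (p α : RepSpace n) (δ δ' : DoubleDer) :
    pairDer p α (δ - δ') = pairDer p α δ - pairDer p α δ' := by
  ext k l
  simp [pairDer, fieldEntry, mul_sub]

theorem tensorEntry_map_mulLeft {n : ℕ} (p : RepSpace n) (r c r' c' : Block n) (b : PathAlg)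
    (t : PathAlg ⊗[ℂ] PathAlg) :
    tensorEntry p r c r' c' (TensorProduct.map LinearMap.id (LinearMap.mulLeft ℂ b) t) =
      ∑ k, repHom p b r' k * tensorEntry p r c k c' t := by
  induction t using TensorProduct.induction_on with
  | zero => simp
  | add s t hs ht => simp only [map_add, hs, ht, mul_add, Finset.sum_add_distrib]
  | tmul s t =>
    simp only [TensorProduct.map_tmul, LinearMap.id_coe, id_eq, LinearMap.mulLeft_apply,
      tensorEntry_tmul, map_mul, Matrix.mul_apply, Finset.mul_sum]
    exact Finset.sum_congr rfl fun k _ => by ring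

theorem tensorEntry_map_mulRight {n : ℕ} (p : RepSpace n) (r c r' c' : Block n) (b : PathAlg)
    (t : PathAlg ⊗[ℂ] PathAlg) :
    tensorEntry p r c r' c' (TensorProduct.map (LinearMap.mulRight ℂ b) LinearMap.id t) =
      ∑ k, tensorEntry p r k r' c' t * repHom p b k c := by
  induction t using TensorProduct.induction_on with
  | zero => simp
  | add s t hs ht => simp only [map_add, hs, ht, add_mul, Finset.sum_add_distrib]
  | tmul s t =>
    simp only [TensorProduct.map_tmul, LinearMap.id_coe, id_eq, LinearMap.mulRight_apply,
      tensorEntry_tmul, map_mul, Matrix.mul_apply, Finset.sum_mul]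
    exact Finset.sum_congr rfl fun k _ => by ring

/-- The indices k, l of `fieldEntry` sit at the inner ends of the two tensor factors, so the inner
bimodule structure turns into matrix multiplication, on the left here and on the right below. -/
theorem pairDer_innerLeft {n : ℕ} (p α : RepSpace n) (b : PathAlg) (δ : DoubleDer) :
    pairDer p α (innerLeft b δ) = repHom p b * pairDer p α δ := by
  ext k l
  simp only [pairDer, fieldEntry, innerLeft, tensorEntry_map_mulLeft, Matrix.of_apply,
    Matrix.mul_apply, Finset.mul_sum]
  rw [Finset.sum_comm]
  exact Finset.sum_congr rfl fun k _ => Finset.sum_congr rfl fun l _ => by ring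

theorem pairDer_innerRight {n : ℕ} (p α : RepSpace n) (b : PathAlg) (δ : DoubleDer) :
    pairDer p α (innerRight δ b) = pairDer p α δ * repHom p b := by
  ext k l
  simp only [pairDer, fieldEntry, innerRight, tensorEntry_map_mulRight, Matrix.of_apply,
    Matrix.mul_apply, Finset.mul_sum, Finset.sum_mul]
  rw [Finset.sum_comm]
  exact Finset.sum_congr rfl fun k _ => Finset.sum_congr rfl fun l _ => by ring

/-- Each of the two twisted products, contracted with α and β, is a sum over a cycle of four
indices, that is, the trace of a product of two `pairDer` matrices. This is the passage from a
noncommutative bivector to a trace form. -/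
theorem sum_bracketOfProduct {n : ℕ} (p α β : RepSpace n) (δ₁ δ₂ : DoubleDer) :
    (∑ c : Coord n, ∑ d : Coord n, α c * β d *
      tensorEntry p ⟨tail d.1, d.2.1⟩ ⟨head c.1, c.2.2⟩ ⟨tail c.1, c.2.1⟩ ⟨head d.1, d.2.2⟩
        (bracketOfProduct δ₁ δ₂ c.1 d.1)) =
      (pairDer p α δ₁ * pairDer p β δ₂).trace - (pairDer p β δ₁ * pairDer p α δ₂).trace := by
  have key : ∀ (α β : RepSpace n) (δ₁ δ₂ : DoubleDer),
      (pairDer p α δ₁ * pairDer p β δ₂).trace = ∑ c, ∑ d, ∑ k, ∑ l,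
        α c * β d * (fieldEntry p δ₁ k l c * fieldEntry p δ₂ l k d) := fun α β δ₁ δ₂ => by
    simp only [Matrix.trace, Matrix.diag_apply, Matrix.mul_apply, pairDer, Matrix.of_apply,
      Finset.sum_mul_sum]
    calc _ = ∑ k, ∑ c, ∑ l, ∑ d,
          α c * β d * (fieldEntry p δ₁ k l c * fieldEntry p δ₂ l k d) := by
          refine Finset.sum_congr rfl fun k _ => ?_
          rw [Finset.sum_comm]
          exact Finset.sum_congr rfl fun c _ => Finset.sum_congr rfl fun l _ =>
            Finset.sum_congr rfl fun d _ => by ring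
      _ = ∑ c, ∑ k, ∑ d, ∑ l,
          α c * β d * (fieldEntry p δ₁ k l c * fieldEntry p δ₂ l k d) := by
          rw [Finset.sum_comm]
          exact Finset.sum_congr rfl fun c _ => Finset.sum_congr rfl fun k _ =>
            Finset.sum_comm
      _ = _ := Finset.sum_congr rfl fun c _ => Finset.sum_comm
  -- In the second twisted term δ₂ acts on the first argument, so its trace must start with the
  -- matrix of α.
  rw [Matrix.trace_mul_comm (pairDer p β δ₁), key, key]
  simp only [← Finset.sum_sub_distrib, bracketOfProduct, map_sub, tensorEntry_twistMul]
  refine Finset.sum_congr rfl fun c _ => Finset.sum_congr rfl fun d _ => ?_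
  simp only [Finset.mul_sum, mul_sub, fieldEntry]

theorem repHom_arrowElt {n : ℕ} (p : RepSpace n) (a : Arrow) :
    repHom p (arrowElt a) = arrowMat p a := by
  exact (RingQuot.liftAlgHom_mkAlgHom_apply ..).trans (FreeAlgebra.lift_ι_apply ..)

theorem repHom_idemElt {n : ℕ} (p : RepSpace n) (i : Vertex) :
    repHom p (idemElt i) = idemMat n i := by
  exact (RingQuot.liftAlgHom_mkAlgHom_apply ..).trans (FreeAlgebra.lift_ι_apply ..)

/-- The transposed gradient of a covector with respect to an arrow: its only block is in position
`(h(a), t(a))`. -/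
def gradMat {n : ℕ} (α : RepSpace n) (a : Arrow) : Matrix (Block n) (Block n) ℂ :=
  ∑ i : Fin (dim n (tail a)), ∑ j : Fin (dim n (head a)),
    Matrix.single ⟨head a, j⟩ ⟨tail a, i⟩ (α ⟨a, (i, j)⟩)

theorem pairDer_partialDer {n : ℕ} (p α : RepSpace n) (a : Arrow) :
    pairDer p α (partialDer a) = gradMat α a := by
  ext k l
  simp only [pairDer, Matrix.of_apply, gradMat, Matrix.sum_apply, fieldEntry, partialDer]
  rw [Fintype.sum_sigma, Finset.sum_eq_single a, Fintype.sum_prod_type]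
  · refine Finset.sum_congr rfl fun i _ => Finset.sum_congr rfl fun j _ => ?_
    simp only [if_true, tensorEntry_tmul, repHom_idemElt, idemMat, Matrix.diagonal_apply,
      Matrix.single_apply]
    by_cases h1 : (⟨head a, j⟩ : Block n) = k
    · by_cases h2 : (⟨tail a, i⟩ : Block n) = l
      · simp [← h1, ← h2]
      · simp [h2]
    · simp [h1, Ne.symm h1]
  · intro b _ hb
    simp [Ne.symm hb]
  · simp

/-- The matrix obtained by pairing a covector with the double derivation `F_a`. -/
def gaugeMat {n : ℕ} (p α : RepSpace n) (a : Arrow) : Matrix (Block n) (Block n) ℂ :=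
  gradMat α (star a) * arrowMat p (star a) - arrowMat p a * gradMat α a

theorem pairDer_gaugeDer {n : ℕ} (p α : RepSpace n) (a : Arrow) :
    pairDer p α (gaugeDer a) = gaugeMat p α a := by
  rw [gaugeDer, pairDer_sub, pairDer_innerLeft, pairDer_innerRight, repHom_arrowElt,
    repHom_arrowElt, pairDer_partialDer, pairDer_partialDer, gaugeMat]

/-- The bivector on the representation space, as a bilinear form on covectors. -/
def bivector {n : ℕ} (p α β : RepSpace n) : ℂ :=
  ∑ c : Coord n, ∑ d : Coord n, α c * β d * coordBracket p c d

/-- `sum_bracketOfProduct` is applied to every summand of P; the rest is exchanging the sums over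
arrows with those over coordinates. -/
theorem bivector_eq_trace {n : ℕ} (p α β : RepSpace n) :
    bivector p α β =
      (1 / 2) * ∑ a : Arrow, eps a *
        (((1 + arrowMat p (star a) * arrowMat p a) * gradMat α a * gradMat β (star a)).trace -
         ((1 + arrowMat p (star a) * arrowMat p a) * gradMat β a * gradMat α (star a)).trace) -
      (1 / 2) * ∑ a : Arrow, ∑ b : Arrow, if rank a < rank b then
        (gaugeMat p α a * gaugeMat p β b).trace - (gaugeMat p β a * gaugeMat p α b).trace
        else 0 := by
  have h1 := fun a => sum_bracketOfProduct p α β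
    (innerLeft (1 + arrowElt (star a) * arrowElt a) (partialDer a)) (partialDer (star a))
  have h2 := fun a b => sum_bracketOfProduct p α β (gaugeDer a) (gaugeDer b)
  simp only [pairDer_innerLeft, pairDer_partialDer, map_add, map_one, map_mul, repHom_arrowElt,
    pairDer_gaugeDer] at h1 h2
  simp only [← h1, ← h2]
  have h3 : ∀ c d : Coord n, coordBracket p c d = tensorEntry p ⟨tail d.1, d.2.1⟩
      ⟨head c.1, c.2.2⟩ ⟨tail c.1, c.2.1⟩ ⟨head d.1, d.2.2⟩ (doubleBracket c.1 d.1) :=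
    fun c d => rfl
  have h4 : ∀ (P : Prop) [Decidable P] (f : Coord n → Coord n → ℂ),
      (if P then ∑ c, ∑ d, f c d else 0) = ∑ c, ∑ d, if P then f c d else 0 := by
    intro P _ f
    split_ifs <;> simp
  have h5 : ∀ f : Arrow → Coord n → Coord n → ℂ,
      ∑ a, ∑ c, ∑ d, f a c d = ∑ c, ∑ d, ∑ a, f a c d := fun f => by
    rw [Finset.sum_comm]
    exact Finset.sum_congr rfl fun c _ => Finset.sum_comm
  simp only [bivector, h3, doubleBracket, map_sub, map_smul, map_sum, Finset.mul_sum, h4, h5,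
    ← Finset.sum_sub_distrib]
  refine Finset.sum_congr rfl fun c _ => Finset.sum_congr rfl fun d _ => ?_
  rw [mul_sub, smul_eq_mul, smul_eq_mul]
  simp only [Finset.mul_sum, smul_eq_mul]
  rw [← Finset.sum_sub_distrib]
  refine Finset.sum_congr rfl fun a _ => ?_
  congr 1
  · ring
  · refine Finset.sum_congr rfl fun b _ => ?_
    split_ifs
    · ring
    · simp

theorem bivector_antisymm {n : ℕ} (p α β : RepSpace n) :
    bivector p α β = -bivector p β α := by
  rw [bivector_eq_trace, bivector_eq_trace]
  have h : ∀ a b : Arrow, (if rank a < rank b then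
        (gaugeMat p α a * gaugeMat p β b).trace - (gaugeMat p β a * gaugeMat p α b).trace
        else 0) = -(if rank a < rank b then
        (gaugeMat p β a * gaugeMat p α b).trace - (gaugeMat p α a * gaugeMat p β b).trace
        else 0) := fun a b => by split_ifs <;> simp
  have h' : ∀ a : Arrow, eps a *
        (((1 + arrowMat p (star a) * arrowMat p a) * gradMat α a * gradMat β (star a)).trace -
         ((1 + arrowMat p (star a) * arrowMat p a) * gradMat β a * gradMat α (star a)).trace) =
        -(eps a *
        (((1 + arrowMat p (star a) * arrowMat p a) * gradMat β a * gradMat α (star a)).trace -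
         ((1 + arrowMat p (star a) * arrowMat p a) * gradMat α a * gradMat β (star a)).trace)) :=
    fun a => by ring
  simp only [h, h', Finset.sum_neg_distrib]
  ring

/-! ## Block matrices -/

/-- The matrix with the given blocks. -/
def blocks {n : ℕ} (A : Matrix (Fin n) (Fin n) ℂ) (B : Matrix (Fin n) (Fin 1) ℂ)
    (C : Matrix (Fin 1) (Fin n) ℂ) (D : Matrix (Fin 1) (Fin 1) ℂ) :
    Matrix (Block n) (Block n) ℂ :=
  Matrix.of fun r c => match r, c with
    | ⟨.zero, i⟩, ⟨.zero, j⟩ => A i j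
    | ⟨.zero, i⟩, ⟨.inf, j⟩ => B i j
    | ⟨.inf, i⟩, ⟨.zero, j⟩ => C i j
    | ⟨.inf, i⟩, ⟨.inf, j⟩ => D i j

theorem sum_block {n : ℕ} (f : Block n → ℂ) :
    ∑ r, f r = ∑ i : Fin n, f ⟨.zero, i⟩ + ∑ i : Fin 1, f ⟨.inf, i⟩ := by
  rw [Fintype.sum_sigma]
  exact Finset.sum_pair (by decide)

theorem sum_arrow {M : Type*} [AddCommMonoid M] (f : Arrow → M) :
    ∑ a, f a = f .x + (f .y + (f .v + f .w)) := by
  change ∑ a ∈ {Arrow.x, Arrow.y, Arrow.v, Arrow.w}, f a = _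
  rw [Finset.sum_insert (by decide), Finset.sum_insert (by decide), Finset.sum_insert (by decide),
    Finset.sum_singleton]

theorem blocks_mul {n : ℕ} (A A' : Matrix (Fin n) (Fin n) ℂ) (B B' : Matrix (Fin n) (Fin 1) ℂ)
    (C C' : Matrix (Fin 1) (Fin n) ℂ) (D D' : Matrix (Fin 1) (Fin 1) ℂ) :
    blocks A B C D * blocks A' B' C' D' =
      blocks (A * A' + B * C') (A * B' + B * D') (C * A' + D * C') (C * B' + D * D') := by
  ext ⟨r, i⟩ ⟨c, j⟩
  rw [Matrix.mul_apply, sum_block]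
  cases r <;> cases c <;> rfl

theorem blocks_add {n : ℕ} (A A' : Matrix (Fin n) (Fin n) ℂ) (B B' : Matrix (Fin n) (Fin 1) ℂ)
    (C C' : Matrix (Fin 1) (Fin n) ℂ) (D D' : Matrix (Fin 1) (Fin 1) ℂ) :
    blocks A B C D + blocks A' B' C' D' = blocks (A + A') (B + B') (C + C') (D + D') := by
  ext ⟨r, i⟩ ⟨c, j⟩
  cases r <;> cases c <;> rfl

theorem blocks_sub {n : ℕ} (A A' : Matrix (Fin n) (Fin n) ℂ) (B B' : Matrix (Fin n) (Fin 1) ℂ)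
    (C C' : Matrix (Fin 1) (Fin n) ℂ) (D D' : Matrix (Fin 1) (Fin 1) ℂ) :
    blocks A B C D - blocks A' B' C' D' = blocks (A - A') (B - B') (C - C') (D - D') := by
  ext ⟨r, i⟩ ⟨c, j⟩
  cases r <;> cases c <;> rfl

theorem one_eq_blocks (n : ℕ) :
    (1 : Matrix (Block n) (Block n) ℂ) = blocks 1 0 0 1 := by
  ext ⟨r, i⟩ ⟨c, j⟩
  cases r <;> cases c
  · simp only [Matrix.one_apply, Sigma.mk.injEq, heq_eq_eq, true_and]
    exact (Matrix.one_apply (α := ℂ) (i := i) (j := j)).symm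
  · exact Matrix.one_apply_ne (by simp)
  · exact Matrix.one_apply_ne (by simp)
  · simp only [Matrix.one_apply, Sigma.mk.injEq, heq_eq_eq, true_and]
    exact (Matrix.one_apply (α := ℂ) (i := i) (j := j)).symm

theorem trace_blocks {n : ℕ} (A : Matrix (Fin n) (Fin n) ℂ) (B : Matrix (Fin n) (Fin 1) ℂ)
    (C : Matrix (Fin 1) (Fin n) ℂ) (D : Matrix (Fin 1) (Fin 1) ℂ) :
    (blocks A B C D).trace = A.trace + D.trace := by
  rw [Matrix.trace, sum_block]
  rfl

theorem arrowMat_apply {n : ℕ} (p : RepSpace n) (a : Arrow) (i : Fin (dim n (tail a)))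
    (j : Fin (dim n (head a))) : arrowMat p a ⟨tail a, i⟩ ⟨head a, j⟩ = p ⟨a, (i, j)⟩ := by
  simp only [arrowMat, Matrix.sum_apply, Matrix.single_apply, Sigma.mk.injEq, heq_eq_eq, true_and]
  rw [Finset.sum_eq_single i, Finset.sum_eq_single j] <;> simp +contextual

theorem gradMat_eq_transpose {n : ℕ} (α : RepSpace n) (a : Arrow) :
    gradMat α a = (arrowMat α a).transpose := by
  simp only [gradMat, arrowMat, Matrix.transpose_sum, Matrix.transpose_single]

theorem arrowMat_x {n : ℕ} (p : RepSpace n) :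
    arrowMat p .x = blocks (matX p) 0 0 0 := by
  ext ⟨r, i⟩ ⟨c, j⟩
  cases r <;> cases c
  · exact arrowMat_apply p .x i j
  · exact arrowMat_apply_head p .x _ _ (by simp [head])
  · exact arrowMat_apply_tail p .x _ _ (by simp [tail])
  · exact arrowMat_apply_tail p .x _ _ (by simp [tail])

theorem arrowMat_y {n : ℕ} (p : RepSpace n) :
    arrowMat p .y = blocks (matY p) 0 0 0 := by
  ext ⟨r, i⟩ ⟨c, j⟩
  cases r <;> cases c
  · exact arrowMat_apply p .y i j
  · exact arrowMat_apply_head p .y _ _ (by simp [head])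
  · exact arrowMat_apply_tail p .y _ _ (by simp [tail])
  · exact arrowMat_apply_tail p .y _ _ (by simp [tail])

theorem arrowMat_v {n : ℕ} (p : RepSpace n) :
    arrowMat p .v = blocks 0 (matV p) 0 0 := by
  ext ⟨r, i⟩ ⟨c, j⟩
  cases r <;> cases c
  · exact arrowMat_apply_head p .v _ _ (by simp [head])
  · exact arrowMat_apply p .v i j
  · exact arrowMat_apply_tail p .v _ _ (by simp [tail])
  · exact arrowMat_apply_tail p .v _ _ (by simp [tail])

theorem arrowMat_w {n : ℕ} (p : RepSpace n) :
    arrowMat p .w = blocks 0 0 (matW p) 0 := by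
  ext ⟨r, i⟩ ⟨c, j⟩
  cases r <;> cases c
  · exact arrowMat_apply_tail p .w _ _ (by simp [tail])
  · exact arrowMat_apply_tail p .w _ _ (by simp [tail])
  · exact arrowMat_apply p .w i j
  · exact arrowMat_apply_head p .w _ _ (by simp [head])

theorem transpose_blocks {n : ℕ} (A : Matrix (Fin n) (Fin n) ℂ) (B : Matrix (Fin n) (Fin 1) ℂ)
    (C : Matrix (Fin 1) (Fin n) ℂ) (D : Matrix (Fin 1) (Fin 1) ℂ) :
    (blocks A B C D).transpose = blocks A.transpose C.transpose B.transpose D.transpose := by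
  ext ⟨r, i⟩ ⟨c, j⟩
  cases r <;> cases c <;> rfl

/-! ## The trace form on the blocks and its Hamiltonian vector fields -/

/-- The transposed gradient of a covector with respect to `X`. -/
def gradX {n : ℕ} (α : RepSpace n) : Matrix (Fin n) (Fin n) ℂ := (matX α).transpose

/-- The transposed gradient of a covector with respect to `Y`. -/
def gradY {n : ℕ} (α : RepSpace n) : Matrix (Fin n) (Fin n) ℂ := (matY α).transpose

/-- The transposed gradient of a covector with respect to `V`. -/
def gradV {n : ℕ} (α : RepSpace n) : Matrix (Fin 1) (Fin n) ℂ := (matV α).transpose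

/-- The transposed gradient of a covector with respect to `W`. -/
def gradW {n : ℕ} (α : RepSpace n) : Matrix (Fin n) (Fin 1) ℂ := (matW α).transpose

/-- The nonzero block of the matrix of `F_x`. -/
def gaugeX {n : ℕ} (p α : RepSpace n) : Matrix (Fin n) (Fin n) ℂ :=
  gradY α * matY p - matX p * gradX α

/-- The nonzero block of the matrix of `F_y`. -/
def gaugeY {n : ℕ} (p α : RepSpace n) : Matrix (Fin n) (Fin n) ℂ :=
  gradX α * matX p - matY p * gradY α

/-- The nonzero block of the matrix of `F_v`. -/
def gaugeV {n : ℕ} (p α : RepSpace n) : Matrix (Fin n) (Fin n) ℂ :=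
  gradW α * matW p - matV p * gradV α

theorem gaugeMat_x {n : ℕ} (p α : RepSpace n) :
    gaugeMat p α .x = blocks (gaugeX p α) 0 0 0 := by
  simp [gaugeMat, gradMat_eq_transpose, star, arrowMat_x, arrowMat_y, transpose_blocks,
    blocks_mul, blocks_sub, gaugeX, gradX, gradY]

theorem gaugeMat_y {n : ℕ} (p α : RepSpace n) :
    gaugeMat p α .y = blocks (gaugeY p α) 0 0 0 := by
  simp [gaugeMat, gradMat_eq_transpose, star, arrowMat_x, arrowMat_y, transpose_blocks,
    blocks_mul, blocks_sub, gaugeY, gradX, gradY]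

theorem gaugeMat_v {n : ℕ} (p α : RepSpace n) :
    gaugeMat p α .v = blocks (gaugeV p α) 0 0 0 := by
  simp [gaugeMat, gradMat_eq_transpose, star, arrowMat_v, arrowMat_w, transpose_blocks,
    blocks_mul, blocks_sub, gaugeV, gradV, gradW]

theorem gaugeMat_w {n : ℕ} (p α : RepSpace n) :
    gaugeMat p α .w = blocks 0 0 0 (gradV α * matV p - matW p * gradW α) := by
  simp [gaugeMat, gradMat_eq_transpose, star, arrowMat_v, arrowMat_w, transpose_blocks,
    blocks_mul, blocks_sub, gradV, gradW]

/-- F_x, F_y and F_v live in the block of the vertex 0 and F_w in the block of ∞, so every pair with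
F_w has trace zero and only three of the six gauge pairs survive. -/
theorem bivector_eq_trace_blocks {n : ℕ} (p α β : RepSpace n) :
    bivector p α β =
      (1 / 2) *
        (((1 + matY p * matX p) * gradX α * gradY β).trace -
          ((1 + matY p * matX p) * gradX β * gradY α).trace -
          ((1 + matX p * matY p) * gradY α * gradX β).trace +
          ((1 + matX p * matY p) * gradY β * gradX α).trace +
          ((1 + matW p * matV p) * gradV α * gradW β).trace -
          ((1 + matW p * matV p) * gradV β * gradW α).trace -
          ((1 + matV p * matW p) * gradW α * gradV β).trace +
          ((1 + matV p * matW p) * gradW β * gradV α).trace) -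
      (1 / 2) *
        ((gaugeX p α * gaugeY p β).trace - (gaugeX p β * gaugeY p α).trace +
          (gaugeX p α * gaugeV p β).trace - (gaugeX p β * gaugeV p α).trace +
          (gaugeY p α * gaugeV p β).trace - (gaugeY p β * gaugeV p α).trace) := by
  rw [bivector_eq_trace]
  simp only [sum_arrow, rank, star, eps, gaugeMat_x, gaugeMat_y, gaugeMat_v, gaugeMat_w,
    gradMat_eq_transpose, arrowMat_x, arrowMat_y, arrowMat_v, arrowMat_w, transpose_blocks,
    one_eq_blocks, blocks_mul, blocks_add, trace_blocks, Matrix.transpose_zero, Matrix.mul_zero,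
    Matrix.zero_mul, add_zero, zero_add, Matrix.trace_zero, mul_zero, zero_mul, gradX, gradY, gradV, gradW]
  norm_num
  ring

theorem dotProduct_eq_trace {n : ℕ} (α v : RepSpace n) :
    α ⬝ᵥ v = (gradX α * matX v).trace + (gradY α * matY v).trace + (gradV α * matV v).trace +
      (gradW α * matW v).trace := by
  have h : ∀ a : Arrow, ∑ c : Fin (dim n (tail a)) × Fin (dim n (head a)), α ⟨a, c⟩ * v ⟨a, c⟩ =
      ∑ j : Fin (dim n (head a)), ∑ i : Fin (dim n (tail a)), α ⟨a, (i, j)⟩ * v ⟨a, (i, j)⟩ :=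
    fun a => by rw [Fintype.sum_prod_type, Finset.sum_comm]
  rw [dotProduct, Fintype.sum_sigma, sum_arrow, h, h, h, h, ← add_assoc, ← add_assoc]
  rfl

/-- The Hamiltonian vector field of the bivector for a covector. -/
def hamField {n : ℕ} (p β : RepSpace n) : RepSpace n :=
  mkRep
    ((1 / 2 : ℂ) • (gradY β * (1 + matY p * matX p) + (1 + matX p * matY p) * gradY β +
      gaugeY p β * matX p + matX p * gaugeX p β + gaugeV p β * matX p - matX p * gaugeV p β))
    ((1 / 2 : ℂ) • (gaugeV p β * matY p - matY p * gaugeV p β - (1 + matY p * matX p) * gradX β -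
      gradX β * (1 + matX p * matY p) - matY p * gaugeY p β - gaugeX p β * matY p))
    ((1 / 2 : ℂ) • (gradW β * (1 + matW p * matV p) + (1 + matV p * matW p) * gradW β -
      (gaugeX p β + gaugeY p β) * matV p))
    ((1 / 2 : ℂ) • (matW p * (gaugeX p β + gaugeY p β) - (1 + matW p * matV p) * gradV β -
      gradV β * (1 + matV p * matW p)))

/-- Cyclicity of the trace moves each gradient of α to the front of its term; what stands behind it
is the corresponding component of `hamField`. -/
theorem bivector_eq_dotProduct {n : ℕ} (p α β : RepSpace n) :
    bivector p α β = α ⬝ᵥ hamField p β := by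
  have r1 : ∀ {k l : ℕ} (P : Matrix (Fin k) (Fin k) ℂ) (A : Matrix (Fin k) (Fin l) ℂ)
      (Q : Matrix (Fin l) (Fin k) ℂ), (P * A * Q).trace = (A * (Q * P)).trace := fun P A Q => by
    rw [Matrix.mul_assoc, Matrix.trace_mul_comm, Matrix.mul_assoc]
  have r2 : ∀ {k l : ℕ} (P : Matrix (Fin k) (Fin k) ℂ) (A : Matrix (Fin k) (Fin l) ℂ)
      (Q : Matrix (Fin l) (Fin k) ℂ), (P * A * Q).trace = (Q * (P * A)).trace := fun P A Q => by
    rw [Matrix.trace_mul_comm]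
  have e1 : ∀ M, (gaugeX p α * M).trace =
      (gradY α * (matY p * M)).trace - (gradX α * (M * matX p)).trace := fun M => by
    rw [gaugeX, Matrix.sub_mul, Matrix.trace_sub, r1 (matX p), Matrix.mul_assoc]
  have e2 : ∀ M, (gaugeY p α * M).trace =
      (gradX α * (matX p * M)).trace - (gradY α * (M * matY p)).trace := fun M => by
    rw [gaugeY, Matrix.sub_mul, Matrix.trace_sub, r1 (matY p), Matrix.mul_assoc]
  have e3 : ∀ M, (gaugeV p α * M).trace =
      (gradW α * (matW p * M)).trace - (gradV α * (M * matV p)).trace := fun M => by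
    rw [gaugeV, Matrix.sub_mul, Matrix.trace_sub, Matrix.mul_assoc, Matrix.mul_assoc (matV p),
      Matrix.trace_mul_comm (matV p), Matrix.mul_assoc]
  rw [bivector_eq_trace_blocks, dotProduct_eq_trace, hamField, matX_mkRep, matY_mkRep, matV_mkRep,
    matW_mkRep, r1 (1 + matY p * matX p) (gradX α), r2 (1 + matY p * matX p) (gradX β),
    r1 (1 + matX p * matY p) (gradY α), r2 (1 + matX p * matY p) (gradY β),
    r1 (1 + matW p * matV p) (gradV α), r2 (1 + matW p * matV p) (gradV β),
    r1 (1 + matV p * matW p) (gradW α), r2 (1 + matV p * matW p) (gradW β),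
    Matrix.trace_mul_comm (gaugeX p β) (gaugeY p α),
    Matrix.trace_mul_comm (gaugeX p β) (gaugeV p α),
    Matrix.trace_mul_comm (gaugeY p β) (gaugeV p α)]
  simp only [e1, e2, e3, Matrix.mul_smul, Matrix.trace_smul, Matrix.mul_add, Matrix.mul_sub,
    Matrix.add_mul, Matrix.trace_add, Matrix.trace_sub, smul_eq_mul]
  ring

/-! ## The moment map -/

/-- The derivative of `(1 + V W) (1 + X Y) - q (1 + Y X)`. -/
def momentDeriv {n : ℕ} (q : ℂ) (p v : RepSpace n) : Matrix (Fin n) (Fin n) ℂ :=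
  (matV v * matW p + matV p * matW v) * (1 + matX p * matY p) +
    (1 + matV p * matW p) * (matX v * matY p + matX p * matY v) -
    q • (matY v * matX p + matY p * matX v)

/-- The infinitesimal action of `gl_n`. -/
def orbitField {n : ℕ} (p : RepSpace n) (h : Matrix (Fin n) (Fin n) ℂ) : RepSpace n :=
  mkRep (h * matX p - matX p * h) (h * matY p - matY p * h) (h * matV p) (-(matW p * h))

/-- Up to sign, the sum of the gauge matrices at the vertex 0 is the dual of the infinitesimal
action. F_w does not appear because only the group at the vertex 0 acts. -/
theorem dotProduct_orbitField {n : ℕ} (p α : RepSpace n) (h : Matrix (Fin n) (Fin n) ℂ) :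
    α ⬝ᵥ orbitField p h = -((gaugeX p α + gaugeY p α + gaugeV p α) * h).trace := by
  rw [dotProduct_eq_trace, orbitField, matX_mkRep, matY_mkRep, matV_mkRep, matW_mkRep, gaugeX,
    gaugeY, gaugeV]
  have c : ∀ {k : ℕ} (A : Matrix (Fin k) (Fin n) ℂ) (P : Matrix (Fin n) (Fin k) ℂ),
      (A * (h * P)).trace = (P * (A * h)).trace := fun A P => by
    rw [← Matrix.mul_assoc, Matrix.trace_mul_comm]
  simp only [Matrix.add_mul, Matrix.sub_mul, Matrix.mul_sub, Matrix.mul_neg, Matrix.trace_add,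
    Matrix.trace_sub, Matrix.trace_neg, c, Matrix.mul_assoc]
  ring

theorem gauge_sum_eq_zero {n : ℕ} (p α : RepSpace n) (h : ∀ g, α ⬝ᵥ orbitField p g = 0) :
    gaugeX p α + gaugeY p α + gaugeV p α = 0 := by
  ext i j
  have h1 := h (Matrix.single j i 1)
  rw [dotProduct_orbitField, neg_eq_zero, Matrix.trace_mul_single, MulOpposite.op_one, one_smul] at h1
  exact h1

/-- Write A, B for the gauge matrices of x and v. When the gauge sum vanishes, the Hamiltonian field
changes VW by B(1 + VW), XY by (1 + XY)A, and YX by B(1 + YX) + (1 + YX)A. So the equation (1 +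
VW)(1 + XY) = q(1 + YX) is changed by B times itself plus itself times A, which is no change. -/
theorem momentDeriv_hamField {n : ℕ} (q : ℂ) (p β : RepSpace n)
    (hβ : gaugeX p β + gaugeY p β + gaugeV p β = 0)
    (hp : (1 + matV p * matW p) * (1 + matX p * matY p) = q • (1 + matY p * matX p)) :
    momentDeriv q p (hamField p β) = 0 := by
  have h0 : gaugeV p β = -(gaugeX p β + gaugeY p β) := by
    rw [eq_neg_iff_add_eq_zero, add_comm, hβ]
  have h1 : matV (hamField p β) * matW p + matV p * matW (hamField p β) =
      gaugeV p β * (1 + matV p * matW p) := by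
    have h2 : gaugeX p β + gaugeY p β = -gaugeV p β := by rw [h0, neg_neg]
    rw [hamField, matV_mkRep, matW_mkRep, h2, gaugeV]
    simp only [Matrix.mul_add, Matrix.add_mul, Matrix.mul_sub, Matrix.sub_mul, Matrix.mul_smul,
      Matrix.smul_mul, Matrix.mul_assoc, Matrix.mul_one, Matrix.one_mul, Matrix.mul_neg,
      Matrix.neg_mul]
    module
  have h2 : matX (hamField p β) * matY p + matX p * matY (hamField p β) =
      (1 + matX p * matY p) * gaugeX p β := by
    rw [hamField, matX_mkRep, matY_mkRep, h0, gaugeX, gaugeY]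
    simp only [Matrix.mul_add, Matrix.add_mul, Matrix.mul_sub, Matrix.sub_mul, Matrix.mul_smul,
      Matrix.smul_mul, Matrix.mul_assoc, Matrix.mul_one, Matrix.one_mul, Matrix.mul_neg,
      Matrix.neg_mul]
    module
  have h3 : matY (hamField p β) * matX p + matY p * matX (hamField p β) =
      gaugeV p β * (1 + matY p * matX p) + (1 + matY p * matX p) * gaugeX p β := by
    rw [hamField, matX_mkRep, matY_mkRep, h0, gaugeX, gaugeY]
    simp only [Matrix.mul_add, Matrix.add_mul, Matrix.mul_sub, Matrix.sub_mul, Matrix.mul_smul,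
      Matrix.smul_mul, Matrix.mul_assoc, Matrix.mul_one, Matrix.one_mul, Matrix.mul_neg,
      Matrix.neg_mul]
    module
  rw [momentDeriv, h1, h2, h3, Matrix.mul_assoc, hp, ← Matrix.mul_assoc (1 + matV p * matW p), hp,
    Matrix.mul_smul, Matrix.smul_mul, smul_add, sub_self]

/-- Without inverses the equation is polynomial in the matrices, so it can be differentiated
directly. -/
theorem momentLevel_equation {n : ℕ} {q : ℂ} {p : RepSpace n} (hp : p ∈ momentLevel n q) :
    (1 + matV p * matW p) * (1 + matX p * matY p) = q • (1 + matY p * matX p) := by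
  obtain ⟨-, h1, h2, -, -, h3, -⟩ := hp
  rw [Matrix.isUnit_iff_isUnit_det] at h1 h2
  have h4 : (1 + matV p * matW p) =
      q • ((1 + matY p * matX p) * (1 + matX p * matY p)⁻¹) := by
    have h5 := congrArg (fun M => (1 + matY p * matX p) * ((1 + matX p * matY p)⁻¹ * M)) h3
    simp only [← Matrix.mul_assoc] at h5
    rw [Matrix.mul_assoc (1 + matY p * matX p) _ (1 + matX p * matY p),
      Matrix.nonsing_inv_mul _ h1, Matrix.mul_one, Matrix.mul_nonsing_inv _ h2, Matrix.one_mul,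
      Matrix.mul_smul, Matrix.mul_one] at h5
    exact h5
  rw [h4, Matrix.smul_mul, Matrix.mul_assoc, Matrix.nonsing_inv_mul _ h1, Matrix.mul_one]

/-! ## Equivariance -/

/-- The pull-back of a covector under the action of `g`. -/
def pullCovector {n : ℕ} (g : GL (Fin n) ℂ) (α : RepSpace n) : RepSpace n :=
  mkRep (g⁻¹.val * gradX α * g.val).transpose (g⁻¹.val * gradY α * g.val).transpose
    (gradV α * g.val).transpose (g⁻¹.val * gradW α).transpose

theorem dotProduct_gact {n : ℕ} (g : GL (Fin n) ℂ) (α v : RepSpace n) :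
    α ⬝ᵥ gact g v = pullCovector g α ⬝ᵥ v := by
  rw [dotProduct_eq_trace, dotProduct_eq_trace]
  simp only [gact, pullCovector, gradX, gradY, gradV, gradW, matX_mkRep, matY_mkRep, matV_mkRep,
    matW_mkRep, Matrix.transpose_transpose]
  congr 1
  · congr 1
    · congr 1
      · rw [← Matrix.mul_assoc, Matrix.trace_mul_comm]
        simp only [Matrix.mul_assoc]
      · rw [← Matrix.mul_assoc, Matrix.trace_mul_comm]
        simp only [Matrix.mul_assoc]
    · rw [Matrix.mul_assoc]
  · rw [← Matrix.mul_assoc, Matrix.trace_mul_comm, Matrix.mul_assoc]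

theorem hamField_gact {n : ℕ} (g : GL (Fin n) ℂ) (p β : RepSpace n) :
    hamField (gact g p) β = gact g (hamField p (pullCovector g β)) := by
  have hg : ∀ {k : ℕ} (M : Matrix (Fin n) (Fin k) ℂ), g.val * (g⁻¹.val * M) = M := fun M => by
    rw [← Matrix.mul_assoc, ← Units.val_mul, mul_inv_cancel, Units.val_one, Matrix.one_mul]
  have hg' : ∀ {k : ℕ} (M : Matrix (Fin n) (Fin k) ℂ), g⁻¹.val * (g.val * M) = M := fun M => by
    rw [← Matrix.mul_assoc, ← Units.val_mul, inv_mul_cancel, Units.val_one, Matrix.one_mul]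
  have hg1 : g.val * g⁻¹.val = 1 := by rw [← Units.val_mul, mul_inv_cancel, Units.val_one]
  simp only [hamField, gact, pullCovector, gaugeX, gaugeY, gaugeV, gradX, gradY, gradV, gradW,
    matX_mkRep, matY_mkRep, matV_mkRep, matW_mkRep, Matrix.transpose_transpose, Matrix.mul_add,
    Matrix.add_mul, Matrix.mul_sub, Matrix.sub_mul, Matrix.mul_smul, Matrix.smul_mul,
    Matrix.mul_assoc, Matrix.mul_one, Matrix.one_mul, hg, hg', hg1]

/-- Every ingredient of `hamField` transforms by conjugation, so a bracket at any representative can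
be computed at `xiRep`. -/
theorem bivector_gact {n : ℕ} (g : GL (Fin n) ℂ) (p α β : RepSpace n) :
    bivector (gact g p) α β = bivector p (pullCovector g α) (pullCovector g β) := by
  rw [bivector_eq_dotProduct, bivector_eq_dotProduct, hamField_gact, dotProduct_gact]

/-! ### The linearized moment equation -/

theorem matX_add {n : ℕ} (p r : RepSpace n) : matX (p + r) = matX p + matX r := rfl
theorem matY_add {n : ℕ} (p r : RepSpace n) : matY (p + r) = matY p + matY r := rfl
theorem matV_add {n : ℕ} (p r : RepSpace n) : matV (p + r) = matV p + matV r := rfl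
theorem matW_add {n : ℕ} (p r : RepSpace n) : matW (p + r) = matW p + matW r := rfl
theorem matX_smul {n : ℕ} (c : ℂ) (p : RepSpace n) : matX (c • p) = c • matX p := rfl
theorem matY_smul {n : ℕ} (c : ℂ) (p : RepSpace n) : matY (c • p) = c • matY p := rfl
theorem matV_smul {n : ℕ} (c : ℂ) (p : RepSpace n) : matV (c • p) = c • matV p := rfl
theorem matW_smul {n : ℕ} (c : ℂ) (p : RepSpace n) : matW (c • p) = c • matW p := rfl

theorem repSpace_ext {n : ℕ} {p r : RepSpace n} (hX : matX p = matX r) (hY : matY p = matY r)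
    (hV : matV p = matV r) (hW : matW p = matW r) : p = r := by
  rw [← mkRep_mat p, hX, hY, hV, hW, mkRep_mat]

/-- The derivative of the moment map equation as a linear map. -/
def momentDerivLin {n : ℕ} (q : ℂ) (p : RepSpace n) :
    RepSpace n →ₗ[ℂ] Matrix (Fin n) (Fin n) ℂ where
  toFun := momentDeriv q p
  map_add' v w := by
    simp only [momentDeriv, matX_add, matY_add, matV_add, matW_add, Matrix.mul_add, Matrix.add_mul,
      smul_add]
    abel
  map_smul' c v := by
    simp only [momentDeriv, matX_smul, matY_smul, matV_smul, matW_smul, Matrix.mul_smul,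
      Matrix.smul_mul, smul_add, smul_sub, smul_comm q c, RingHom.id_apply, Matrix.add_mul,
      Matrix.mul_add, Matrix.one_mul]

/-- The difference of the two sides is conjugated by the group, so along the orbit its derivative is
its commutator with h, which is zero on the level. -/
theorem momentDeriv_orbitField {n : ℕ} (q : ℂ) (p : RepSpace n) (h : Matrix (Fin n) (Fin n) ℂ)
    (hp : (1 + matV p * matW p) * (1 + matX p * matY p) = q • (1 + matY p * matX p)) :
    momentDeriv q p (orbitField p h) = 0 := by
  have h1 : momentDeriv q p (orbitField p h) =
      h * ((1 + matV p * matW p) * (1 + matX p * matY p) - q • (1 + matY p * matX p)) -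
        ((1 + matV p * matW p) * (1 + matX p * matY p) - q • (1 + matY p * matX p)) * h := by
    rw [momentDeriv, orbitField, matX_mkRep, matY_mkRep, matV_mkRep, matW_mkRep]
    simp only [Matrix.mul_add, Matrix.add_mul, Matrix.mul_sub, Matrix.sub_mul, Matrix.mul_smul,
      Matrix.smul_mul, Matrix.mul_assoc, Matrix.mul_one, Matrix.one_mul, Matrix.mul_neg,
      Matrix.neg_mul]
    module
  rw [h1, hp, sub_self, Matrix.mul_zero, Matrix.zero_mul, sub_zero]

/-! ## The point `ξ(x, ν)` -/

section Point

variable {n : ℕ} {q : ℂ} {u : Phase n}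

theorem phase_ne (hu : u ∈ phaseDom n q) {i j : Fin n} (h : i ≠ j) : u.1 i - u.1 j ≠ 0 :=
  sub_ne_zero.2 (hu.2.1 i j h).1

theorem phase_ne_mul (hq1 : q ≠ 1) (hu : u ∈ phaseDom n q) (i j : Fin n) :
    u.1 i - q * u.1 j ≠ 0 := by
  intro h
  refine q_sub_div_ne hq1 hu i j ?_
  have := hu.1 j
  field_simp
  linear_combination -h

theorem zMat_apply (hu : u ∈ phaseDom n q) (i j : Fin n) :
    zMat q u i j = (q - 1) * u.2 j * u.1 j / (q * u.1 j - u.1 i) := by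
  have h := hu.1 j
  rw [zMat, Matrix.of_apply, ← mul_div_mul_right _ _ h, sub_mul q (_ / _), div_mul_cancel₀ _ h]

theorem zMat_diag (hq1 : q ≠ 1) (hu : u ∈ phaseDom n q) (i : Fin n) : zMat q u i i = u.2 i := by
  have h := hu.1 i
  have h1 : q - 1 ≠ 0 := sub_ne_zero.2 hq1
  rw [zMat, Matrix.of_apply, div_self h]
  field_simp

theorem diagonal_inv (hu : u ∈ phaseDom n q) :
    (Matrix.diagonal u.1)⁻¹ = Matrix.diagonal fun i => (u.1 i)⁻¹ := by
  refine Matrix.inv_eq_right_inv ?_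
  rw [Matrix.diagonal_mul_diagonal, ← Matrix.diagonal_one]
  congr 1
  funext i
  exact mul_inv_cancel₀ (hu.1 i)

theorem isUnit_diagonal (hu : u ∈ phaseDom n q) : IsUnit (Matrix.diagonal u.1) := by
  rw [Matrix.isUnit_iff_isUnit_det, Matrix.det_diagonal, isUnit_iff_ne_zero]
  exact Finset.prod_ne_zero_iff.2 fun i _ => hu.1 i

theorem one_add_mul_sub_inv {X : Matrix (Fin n) (Fin n) ℂ} (hX : IsUnit X)
    (Z : Matrix (Fin n) (Fin n) ℂ) : 1 + X * (Z - X⁻¹) = X * Z := by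
  rw [Matrix.mul_sub, Matrix.mul_nonsing_inv _ ((Matrix.isUnit_iff_isUnit_det _).1 hX)]
  abel

theorem one_add_sub_inv_mul {X : Matrix (Fin n) (Fin n) ℂ} (hX : IsUnit X)
    (Z : Matrix (Fin n) (Fin n) ℂ) : 1 + (Z - X⁻¹) * X = Z * X := by
  rw [Matrix.sub_mul, Matrix.nonsing_inv_mul _ ((Matrix.isUnit_iff_isUnit_det _).1 hX)]
  abel

theorem xiRep_XY (hu : u ∈ phaseDom n q) :
    1 + matX (xiRep q u) * matY (xiRep q u) = Matrix.diagonal u.1 * zMat q u :=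
  one_add_mul_sub_inv (isUnit_diagonal hu) _

theorem xiRep_YX (hu : u ∈ phaseDom n q) :
    1 + matY (xiRep q u) * matX (xiRep q u) = zMat q u * Matrix.diagonal u.1 :=
  one_add_sub_inv_mul (isUnit_diagonal hu) _

theorem matX_xiRep : matX (xiRep q u) = Matrix.diagonal u.1 := rfl

theorem matV_xiRep : matV (xiRep q u) = Matrix.of fun _ _ => 1 := rfl

theorem matY_xiRep_apply (hu : u ∈ phaseDom n q) (i j : Fin n) :
    matY (xiRep q u) i j = zMat q u i j - if i = j then (u.1 i)⁻¹ else 0 := by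
  change (zMat q u - (Matrix.diagonal u.1)⁻¹) i j = _
  rw [diagonal_inv hu, Matrix.sub_apply, Matrix.diagonal_apply]

/-- The transposed gradient with respect to `X` of the coordinate `ν_i` at `ξ(x, ν)`. -/
def nuGrad (q : ℂ) (u : Phase n) (i : Fin n) : Matrix (Fin n) (Fin n) ℂ :=
  Matrix.of fun k l => if k = i then
    (if l = i then -((u.1 i)⁻¹) ^ 2 else zMat q u i l / (u.1 i - u.1 l))
    else if l = i then zMat q u k i / (u.1 i - u.1 k) else 0

/-- The differentials at `ξ(x, ν)` of the coordinates `x_i` and `ν_i`. -/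
def coordCovector (q : ℂ) (u : Phase n) : Fin n ⊕ Fin n → RepSpace n
  | .inl i => mkRep (Matrix.single i i 1) 0 0 0
  | .inr i => mkRep (nuGrad q u i).transpose (Matrix.single i i 1) 0 0

theorem gradX_coordCovector_inl (i : Fin n) :
    gradX (coordCovector q u (.inl i)) = Matrix.single i i 1 := by
  simp [gradX, coordCovector]

theorem gradX_coordCovector_inr (i : Fin n) :
    gradX (coordCovector q u (.inr i)) = nuGrad q u i := by
  simp [gradX, coordCovector]

theorem gradY_coordCovector_inl (i : Fin n) : gradY (coordCovector q u (.inl i)) = 0 := by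
  simp [gradY, coordCovector]

theorem gradY_coordCovector_inr (i : Fin n) :
    gradY (coordCovector q u (.inr i)) = Matrix.single i i 1 := by
  simp [gradY, coordCovector]

theorem gradV_coordCovector (a : Fin n ⊕ Fin n) : gradV (coordCovector q u a) = 0 := by
  cases a <;> simp [gradV, coordCovector]

theorem gradW_coordCovector (a : Fin n ⊕ Fin n) : gradW (coordCovector q u a) = 0 := by
  cases a <;> simp [gradW, coordCovector]

theorem gaugeV_coordCovector (p : RepSpace n) (a : Fin n ⊕ Fin n) :
    gaugeV p (coordCovector q u a) = 0 := by
  rw [gaugeV, gradV_coordCovector, gradW_coordCovector, Matrix.zero_mul, Matrix.mul_zero, sub_zero]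

/-- An eigenvalue x_i of X and the diagonal entry ν_i of Z in an eigenbasis are conjugation
invariant, so their differentials kill the orbit. The entries Z_il / (x_i - x_l) of `nuGrad` come
from first order perturbation of the eigenbasis, and they are exactly what cancels here; the
diagonal entry comes from the term X⁻¹ in Z. -/
theorem gauge_coordCovector (hu : u ∈ phaseDom n q) (a : Fin n ⊕ Fin n) :
    gaugeX (xiRep q u) (coordCovector q u a) + gaugeY (xiRep q u) (coordCovector q u a) = 0 := by
  ext k l
  rw [gaugeX, gaugeY, matX_xiRep]
  cases a with
  | inl i =>
    simp only [gradX_coordCovector_inl, gradY_coordCovector_inl, Matrix.add_apply,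
      Matrix.sub_apply, Matrix.zero_mul, Matrix.mul_zero, Matrix.zero_apply, Matrix.diagonal_mul,
      Matrix.mul_diagonal, Matrix.single_apply]
    split_ifs with h
    · rw [← h.1, ← h.2]
      ring
    · simp
  | inr i =>
    simp only [gradX_coordCovector_inr, gradY_coordCovector_inr, Matrix.add_apply,
      Matrix.sub_apply, Matrix.zero_apply, Matrix.diagonal_mul, Matrix.mul_diagonal]
    by_cases hk : k = i
    · subst hk
      by_cases hl : l = k
      · subst hl
        simp
        ring
      · have h := phase_ne hu (Ne.symm hl)
        rw [Matrix.single_mul_apply_same, Matrix.mul_single_apply_of_ne _ _ _ _ _ hl,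
          matY_xiRep_apply hu, if_neg (Ne.symm hl)]
        simp only [nuGrad, Matrix.of_apply, if_true, if_neg hl]
        field_simp
        ring
    · by_cases hl : l = i
      · subst hl
        have h := phase_ne hu (Ne.symm hk)
        rw [Matrix.single_mul_apply_of_ne _ _ _ _ _ hk, Matrix.mul_single_apply_same,
          matY_xiRep_apply hu, if_neg hk]
        simp only [nuGrad, Matrix.of_apply, if_true, if_neg hk]
        field_simp
        ring
      · rw [Matrix.single_mul_apply_of_ne _ _ _ _ _ hk, Matrix.mul_single_apply_of_ne _ _ _ _ _ hl]
        simp [nuGrad, hk, hl]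

theorem dotProduct_coordCovector_orbitField (hu : u ∈ phaseDom n q) (a : Fin n ⊕ Fin n)
    (h : Matrix (Fin n) (Fin n) ℂ) :
    coordCovector q u a ⬝ᵥ orbitField (xiRep q u) h = 0 := by
  rw [dotProduct_orbitField, gauge_coordCovector hu, gaugeV_coordCovector]
  simp

/-- For coordinate covectors the gauge matrix of y is minus that of x and the one of v is zero, so
the gauge part of P cancels by symmetry of the trace. -/
theorem bivector_coordCovector_eq_trace (hu : u ∈ phaseDom n q) (a b : Fin n ⊕ Fin n) :
    bivector (xiRep q u) (coordCovector q u a) (coordCovector q u b) = (1 / 2) *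
      ((zMat q u * Matrix.diagonal u.1 * gradX (coordCovector q u a) *
          gradY (coordCovector q u b)).trace -
        (zMat q u * Matrix.diagonal u.1 * gradX (coordCovector q u b) *
          gradY (coordCovector q u a)).trace -
        (Matrix.diagonal u.1 * zMat q u * gradY (coordCovector q u a) *
          gradX (coordCovector q u b)).trace +
        (Matrix.diagonal u.1 * zMat q u * gradY (coordCovector q u b) *
          gradX (coordCovector q u a)).trace) := by
  have h := fun a => eq_neg_of_add_eq_zero_right (gauge_coordCovector hu a)
  rw [bivector_eq_trace_blocks, h, h, gaugeV_coordCovector, gaugeV_coordCovector,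
    gradV_coordCovector, gradV_coordCovector, gradW_coordCovector, gradW_coordCovector,
    xiRep_XY hu, xiRep_YX hu]
  simp only [Matrix.mul_zero, Matrix.trace_zero, Matrix.mul_neg, Matrix.trace_neg,
    Matrix.trace_mul_comm (gaugeX (xiRep q u) (coordCovector q u b))]
  ring

theorem bivector_coordCovector (hq1 : q ≠ 1) (hu : u ∈ phaseDom n q) (a b : Fin n ⊕ Fin n) :
    bivector (xiRep q u) (coordCovector q u a) (coordCovector q u b) = phaseTensor q u a b := by
  have hxn : ∀ i j, bivector (xiRep q u) (coordCovector q u (.inl i)) (coordCovector q u (.inr j)) =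
      if i = j then u.1 i * u.2 j else 0 := fun i j => by
    rw [bivector_coordCovector_eq_trace hu]
    simp only [gradX_coordCovector_inl, gradX_coordCovector_inr, gradY_coordCovector_inl,
      gradY_coordCovector_inr, Matrix.mul_zero, Matrix.zero_mul, Matrix.trace_zero]
    by_cases h : i = j
    · subst h
      have h1 : ∀ M : Matrix (Fin n) (Fin n) ℂ,
          (M * Matrix.single i i 1 * Matrix.single i i 1).trace = M i i := fun M => by
        rw [Matrix.mul_assoc, Matrix.single_mul_single_same, mul_one, Matrix.trace_mul_single,
          MulOpposite.op_one, one_smul]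
      rw [h1, h1, Matrix.mul_diagonal, Matrix.diagonal_mul, zMat_diag hq1 hu, if_pos rfl]
      ring
    · simp [Matrix.mul_assoc, h, Ne.symm h]
  match a, b with
  | .inl i, .inl j =>
    rw [bivector_coordCovector_eq_trace hu]
    simp [gradY_coordCovector_inl, phaseTensor]
  | .inl i, .inr j => exact hxn i j
  | .inr i, .inl j =>
    rw [bivector_antisymm, hxn, phaseTensor]
    by_cases h : i = j
    · simp [h]
    · simp [h, Ne.symm h]
  | .inr i, .inr j =>
    by_cases h : i = j
    · subst h
      have h1 := bivector_antisymm (xiRep q u) (coordCovector q u (.inr i))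
        (coordCovector q u (.inr i))
      rw [self_eq_neg] at h1
      simp [h1, phaseTensor]
    -- The factor E_jj together with the single row and column of `nuGrad` leaves only the entries
    -- Z_ij and Z_ji.
    · have e1 : ∀ i j, i ≠ j → (zMat q u * Matrix.diagonal u.1 * nuGrad q u i *
          Matrix.single j j 1).trace = zMat q u j i * u.1 i * (zMat q u i j / (u.1 i - u.1 j)) :=
        fun i j h => by
        rw [Matrix.trace_mul_single, MulOpposite.op_one, one_smul, Matrix.mul_apply,
          Finset.sum_eq_single i]
        · simp [Matrix.mul_diagonal, nuGrad, Ne.symm h]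
        · intro k _ hk
          simp [nuGrad, hk, Ne.symm h]
        · simp
      have e2 : ∀ i j, i ≠ j → (Matrix.diagonal u.1 * zMat q u * Matrix.single j j 1 *
          nuGrad q u i).trace = u.1 i * zMat q u i j * (zMat q u j i / (u.1 i - u.1 j)) :=
        fun i j h => by
        rw [Matrix.trace_mul_comm, ← Matrix.mul_assoc, Matrix.trace_mul_single,
          MulOpposite.op_one, one_smul, Matrix.mul_apply, Finset.sum_eq_single i]
        · simp [Matrix.diagonal_mul, nuGrad, Ne.symm h]
          ring
        · intro k _ hk
          simp [nuGrad, hk, Ne.symm h]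
        · simp
      rw [bivector_coordCovector_eq_trace hu, gradX_coordCovector_inr, gradX_coordCovector_inr,
        gradY_coordCovector_inr, gradY_coordCovector_inr, e1 i j h, e1 j i (Ne.symm h), e2 i j h,
        e2 j i (Ne.symm h), zMat_apply hu, zMat_apply hu, phaseTensor, if_neg h]
      have h1 := phase_ne hu h
      have h2 := phase_ne hu (Ne.symm h)
      have h3 := phase_ne_mul hq1 hu i j
      have h4 := phase_ne_mul hq1 hu j i
      have h5 : q * u.1 i - u.1 j ≠ 0 := by rwa [← neg_sub, neg_ne_zero]
      have h6 : q * u.1 j - u.1 i ≠ 0 := by rwa [← neg_sub, neg_ne_zero]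
      -- Opposite differences are brought to one sign, so that the denominators have common factors.
      rw [← neg_sub (u.1 i) (u.1 j), ← neg_sub (u.1 i) (q * u.1 j), ← neg_sub (u.1 j) (q * u.1 i)]
      field_simp
      ring

/-- Subtracting a suitable orbit direction removes the X and V components of v. The linearized
equation for the rest is b_l + (x_k - q x_l) Y_kl = 0 with a row b independent of k. The diagonal of
Y vanishes by pairing with dν, so b = 0; then Y = 0 because x_k ≠ q x_l, and W = 0 because 1 + XY is
invertible. -/
theorem exists_orbitField (hq1 : q ≠ 1) (hu : u ∈ phaseDom n q)
    (hunit : IsUnit (1 + matX (xiRep q u) * matY (xiRep q u)))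
    (hp : (1 + matV (xiRep q u) * matW (xiRep q u)) * (1 + matX (xiRep q u) * matY (xiRep q u)) =
      q • (1 + matY (xiRep q u) * matX (xiRep q u)))
    (v : RepSpace n) (hv : momentDeriv q (xiRep q u) v = 0)
    (hc : ∀ a, coordCovector q u a ⬝ᵥ v = 0) : ∃ h, v = orbitField (xiRep q u) h := by
  -- The off-diagonal part of h is forced by the X component of v. Its diagonal is then chosen so
  -- that the row sums of h give the V component, since V is the column of ones at this point.
  set M : Matrix (Fin n) (Fin n) ℂ := Matrix.of fun k l => matX v k l / (u.1 l - u.1 k) with hM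
  set h : Matrix (Fin n) (Fin n) ℂ :=
    M + Matrix.diagonal fun k => matV v k 0 - ∑ l, M k l with hh
  have hdX : ∀ i, matX v i i = 0 := fun i => by
    have h1 := hc (.inl i)
    rw [dotProduct_eq_trace, gradX_coordCovector_inl, gradY_coordCovector_inl,
      gradV_coordCovector, gradW_coordCovector] at h1
    simpa [Matrix.trace_single_mul] using h1
  refine ⟨h, sub_eq_zero.1 ?_⟩
  set w := v - orbitField (xiRep q u) h with hw
  have hwX : matX w = 0 := by
    change matX v - (h * matX (xiRep q u) - matX (xiRep q u) * h) = 0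
    ext k l
    rw [matX_xiRep, Matrix.sub_apply, Matrix.sub_apply, Matrix.mul_diagonal, Matrix.diagonal_mul]
    by_cases hkl : k = l
    · subst hkl
      simp [hdX, mul_comm]
    · have h1 := phase_ne hu (Ne.symm hkl)
      simp only [hh, hM, Matrix.add_apply, Matrix.of_apply, Matrix.diagonal_apply_ne _ hkl,
        Matrix.zero_apply]
      field_simp
      ring
  have hwV : matV w = 0 := by
    change matV v - h * matV (xiRep q u) = 0
    ext k l
    rw [Subsingleton.elim l 0]
    simp [hh, matV_xiRep, Matrix.mul_apply, Finset.sum_add_distrib, Matrix.diagonal_apply]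
  have hwm : momentDeriv q (xiRep q u) w = 0 := by
    have h1 := (momentDerivLin q (xiRep q u)).map_sub v (orbitField (xiRep q u) h)
    change momentDeriv q (xiRep q u) w = momentDeriv q (xiRep q u) v -
      momentDeriv q (xiRep q u) (orbitField (xiRep q u) h) at h1
    rw [h1, hv, momentDeriv_orbitField q _ h hp, sub_zero]
  have hdY : ∀ i, matY w i i = 0 := fun i => by
    have h1 : coordCovector q u (.inr i) ⬝ᵥ w = 0 := by
      rw [hw, dotProduct_sub, hc, dotProduct_coordCovector_orbitField hu, sub_zero]
    rw [dotProduct_eq_trace, hwX, hwV, gradY_coordCovector_inr, gradW_coordCovector] at h1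
    simpa [Matrix.trace_single_mul] using h1
  set b : Matrix (Fin 1) (Fin n) ℂ :=
    matW w * (1 + matX (xiRep q u) * matY (xiRep q u)) +
      matW (xiRep q u) * (matX (xiRep q u) * matY w) with hb
  have hm : matV (xiRep q u) * b + matX (xiRep q u) * matY w - q • (matY w * matX (xiRep q u)) =
      0 := by
    rw [← hwm, momentDeriv, hwX, hwV, hb]
    simp only [Matrix.mul_add, Matrix.add_mul, Matrix.mul_assoc, Matrix.one_mul, Matrix.mul_zero,
      Matrix.zero_mul, zero_add, add_zero]
    abel
  have hent : ∀ k l, b 0 l + u.1 k * matY w k l - q * (matY w k l * u.1 l) = 0 := fun k l => by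
    have h1 := congrFun (congrFun hm k) l
    rw [matX_xiRep, matV_xiRep, Matrix.sub_apply, Matrix.add_apply, Matrix.smul_apply,
      Matrix.mul_diagonal, Matrix.diagonal_mul, Matrix.mul_apply, Fin.sum_univ_one] at h1
    simpa using h1
  have hb0 : ∀ l, b 0 l = 0 := fun l => by
    have h1 := hent l l
    rw [hdY] at h1
    simpa using h1
  have hwY : matY w = 0 := by
    ext k l
    have h1 := hent k l
    rw [hb0] at h1
    have h2 : (u.1 k - q * u.1 l) * matY w k l = 0 := by linear_combination h1
    exact (mul_eq_zero.1 h2).resolve_left (phase_ne_mul hq1 hu k l)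
  have hwW : matW w = 0 := by
    have h1 : matW w * (1 + matX (xiRep q u) * matY (xiRep q u)) = 0 := by
      have h2 : b = 0 := by
        ext k l
        rw [Subsingleton.elim k 0]
        exact hb0 l
      rw [hb, hwY, Matrix.mul_zero, Matrix.mul_zero, add_zero] at h2
      exact h2
    have h2 := congrArg (· * (1 + matX (xiRep q u) * matY (xiRep q u))⁻¹) h1
    simpa only [Matrix.mul_assoc, Matrix.mul_nonsing_inv _
      ((Matrix.isUnit_iff_isUnit_det _).1 hunit), Matrix.mul_one, Matrix.zero_mul] using h2
  exact repSpace_ext hwX hwY hwV hwW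

/-- On covectors that vanish along the orbit, the bivector at `ξ(x, ν)` is the push-forward of the
bracket in the coordinates `(x, ν)`. -/
theorem bivector_xiRep (hq1 : q ≠ 1) (hu : u ∈ phaseDom n q)
    (hmem : xiRep q u ∈ momentLevel n q) (t : Fin n ⊕ Fin n → RepSpace n)
    (ht : ∀ a, momentDeriv q (xiRep q u) (t a) = 0)
    (hdual : ∀ a b, coordCovector q u a ⬝ᵥ t b = if a = b then 1 else 0)
    (α β : RepSpace n) (hα : ∀ h, α ⬝ᵥ orbitField (xiRep q u) h = 0)
    (hβ : ∀ h, β ⬝ᵥ orbitField (xiRep q u) h = 0) :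
    bivector (xiRep q u) α β =
      ∑ a, ∑ b, α ⬝ᵥ t a * β ⬝ᵥ t b * phaseTensor q u a b := by
  have hp := momentLevel_equation hmem
  -- Modulo the orbit, the Hamiltonian field of β is the combination of the t a with coefficients
  -- given by the coordinate covectors, and α does not see the orbit.
  have key : ∀ α β : RepSpace n, (∀ h, α ⬝ᵥ orbitField (xiRep q u) h = 0) →
      (∀ h, β ⬝ᵥ orbitField (xiRep q u) h = 0) → bivector (xiRep q u) α β =
        ∑ a, α ⬝ᵥ t a * bivector (xiRep q u) (coordCovector q u a) β := fun α β hα hβ => by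
    set v := hamField (xiRep q u) β with hv
    have h1 : momentDeriv q (xiRep q u) v = 0 :=
      momentDeriv_hamField q _ β (gauge_sum_eq_zero _ β hβ) hp
    obtain ⟨h, hh⟩ := exists_orbitField hq1 hu hmem.2.1 hp
      (v - ∑ a, (coordCovector q u a ⬝ᵥ v) • t a)
      (by
        have h2 := map_sub (momentDerivLin q (xiRep q u)) v
          (∑ a, (coordCovector q u a ⬝ᵥ v) • t a)
        rw [map_sum] at h2
        simp only [map_smul] at h2
        change momentDeriv _ _ _ = momentDeriv _ _ _ - ∑ a, _ • momentDeriv _ _ _ at h2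
        rw [h2, h1]
        simp [ht])
      (fun b => by
        rw [dotProduct_sub, dotProduct_sum]
        simp [dotProduct_smul, hdual])
    have h2 := hα h
    rw [← hh, dotProduct_sub, dotProduct_sum, sub_eq_zero] at h2
    rw [bivector_eq_dotProduct, h2]
    refine Finset.sum_congr rfl fun a _ => ?_
    rw [bivector_eq_dotProduct, dotProduct_smul, smul_eq_mul, mul_comm]
  have hcov := dotProduct_coordCovector_orbitField hu
  rw [key α β hα hβ]
  refine Finset.sum_congr rfl fun a _ => ?_
  -- The coordinate covectors vanish along the orbit too, so the same expansion applies to the other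
  -- argument.
  rw [bivector_antisymm, key β _ hβ (hcov a), ← Finset.sum_neg_distrib, Finset.mul_sum]
  refine Finset.sum_congr rfl fun b _ => ?_
  rw [bivector_antisymm, bivector_coordCovector hq1 hu]
  ring

end Point

/-! ## Matrix-valued analytic functions -/

section Analytic

variable {E : Type*} [NormedAddCommGroup E] [NormedSpace ℂ E] {k l m : ℕ}

/-- All entries of the matrix-valued function `M` are analytic at `z`. -/
def MatAnalyticAt (M : E → Matrix (Fin k) (Fin l) ℂ) (z : E) : Prop :=
  ∀ i j, AnalyticAt ℂ (fun w => M w i j) z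

theorem MatAnalyticAt.mul {A : E → Matrix (Fin k) (Fin l) ℂ} {B : E → Matrix (Fin l) (Fin m) ℂ}
    {z : E} (hA : MatAnalyticAt A z) (hB : MatAnalyticAt B z) :
    MatAnalyticAt (fun w => A w * B w) z := fun i j => by
  simp only [Matrix.mul_apply]
  exact Finset.analyticAt_fun_sum _ fun r _ => (hA i r).mul (hB r j)

theorem MatAnalyticAt.add {A B : E → Matrix (Fin k) (Fin l) ℂ} {z : E} (hA : MatAnalyticAt A z)
    (hB : MatAnalyticAt B z) : MatAnalyticAt (fun w => A w + B w) z := fun i j =>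
  (hA i j).add (hB i j)

theorem MatAnalyticAt.sub {A B : E → Matrix (Fin k) (Fin l) ℂ} {z : E} (hA : MatAnalyticAt A z)
    (hB : MatAnalyticAt B z) : MatAnalyticAt (fun w => A w - B w) z := fun i j =>
  (hA i j).sub (hB i j)

theorem matAnalyticAt_const (A : Matrix (Fin k) (Fin l) ℂ) (z : E) :
    MatAnalyticAt (fun _ => A) z := fun _ _ => analyticAt_const

theorem MatAnalyticAt.smul {c : E → ℂ} {A : E → Matrix (Fin k) (Fin l) ℂ} {z : E}
    (hc : AnalyticAt ℂ c z) (hA : MatAnalyticAt A z) : MatAnalyticAt (fun w => c w • A w) z :=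
  fun i j => hc.mul (hA i j)

theorem MatAnalyticAt.det {A : E → Matrix (Fin k) (Fin k) ℂ} {z : E} (hA : MatAnalyticAt A z) :
    AnalyticAt ℂ (fun w => (A w).det) z := by
  simp only [Matrix.det_apply']
  exact Finset.analyticAt_fun_sum _ fun s _ =>
    analyticAt_const.mul (Finset.analyticAt_fun_prod _ fun i _ => hA _ _)

theorem MatAnalyticAt.trace {A : E → Matrix (Fin k) (Fin k) ℂ} {z : E} (hA : MatAnalyticAt A z) :
    AnalyticAt ℂ (fun w => (A w).trace) z := by
  simp only [Matrix.trace, Matrix.diag_apply]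
  exact Finset.analyticAt_fun_sum _ fun i _ => hA i i

theorem MatAnalyticAt.adjugate {A : E → Matrix (Fin k) (Fin k) ℂ} {z : E}
    (hA : MatAnalyticAt A z) : MatAnalyticAt (fun w => (A w).adjugate) z := fun i j => by
  simp only [Matrix.adjugate_apply]
  refine MatAnalyticAt.det fun r c => ?_
  simp only [Matrix.updateRow_apply]
  split_ifs
  · exact analyticAt_const
  · exact hA r c

/-- Cramer's rule: the inverse is the adjugate divided by the determinant. -/
theorem MatAnalyticAt.inv {A : E → Matrix (Fin k) (Fin k) ℂ} {z : E} (hA : MatAnalyticAt A z)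
    (hz : IsUnit (A z)) : MatAnalyticAt (fun w => (A w)⁻¹) z := by
  simp only [Matrix.inv_def, Ring.inverse_eq_inv']
  exact MatAnalyticAt.smul (hA.det.inv ((Matrix.isUnit_iff_isUnit_det _).1 hz).ne_zero) hA.adjugate

theorem MatAnalyticAt.eventually_isUnit {A : E → Matrix (Fin k) (Fin k) ℂ} {z : E}
    (hA : MatAnalyticAt A z) (hz : IsUnit (A z)) : ∀ᶠ w in 𝓝 z, IsUnit (A w) := by
  simp only [Matrix.isUnit_iff_isUnit_det, isUnit_iff_ne_zero] at hz ⊢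
  exact hA.det.continuousAt.eventually_ne hz

theorem analyticAt_mkRep {n : ℕ} {X Y : E → Matrix (Fin n) (Fin n) ℂ}
    {V : E → Matrix (Fin n) (Fin 1) ℂ} {W : E → Matrix (Fin 1) (Fin n) ℂ} {z : E}
    (hX : MatAnalyticAt X z) (hY : MatAnalyticAt Y z) (hV : MatAnalyticAt V z)
    (hW : MatAnalyticAt W z) : AnalyticAt ℂ (fun w => mkRep (X w) (Y w) (V w) (W w)) z := by
  refine analyticAt_pi_iff.2 fun c => ?_
  obtain ⟨a, i, j⟩ := c
  cases a
  · exact hX i j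
  · exact hY i j
  · exact hV i j
  · exact hW i j

end Analytic

/-! ## Derivatives of matrix-valued curves -/

section Curves

variable {k l m : ℕ}

/-- The entrywise derivative of a curve of matrices. -/
def HasMatDerivAt (A : ℂ → Matrix (Fin k) (Fin l) ℂ) (A' : Matrix (Fin k) (Fin l) ℂ) (z : ℂ) :
    Prop :=
  ∀ i j, HasDerivAt (fun w => A w i j) (A' i j) z

theorem HasMatDerivAt.mul {A : ℂ → Matrix (Fin k) (Fin l) ℂ} {A' : Matrix (Fin k) (Fin l) ℂ}
    {B : ℂ → Matrix (Fin l) (Fin m) ℂ} {B' : Matrix (Fin l) (Fin m) ℂ} {z : ℂ}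
    (hA : HasMatDerivAt A A' z) (hB : HasMatDerivAt B B' z) :
    HasMatDerivAt (fun w => A w * B w) (A' * B z + A z * B') z := fun i j => by
  simp only [Matrix.mul_apply, Matrix.add_apply, ← Finset.sum_add_distrib]
  exact HasDerivAt.fun_sum fun r _ => (hA i r).mul (hB r j)

theorem HasMatDerivAt.add {A B : ℂ → Matrix (Fin k) (Fin l) ℂ} {A' B' : Matrix (Fin k) (Fin l) ℂ}
    {z : ℂ} (hA : HasMatDerivAt A A' z) (hB : HasMatDerivAt B B' z) :
    HasMatDerivAt (fun w => A w + B w) (A' + B') z := fun i j => (hA i j).add (hB i j)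

theorem HasMatDerivAt.sub {A B : ℂ → Matrix (Fin k) (Fin l) ℂ} {A' B' : Matrix (Fin k) (Fin l) ℂ}
    {z : ℂ} (hA : HasMatDerivAt A A' z) (hB : HasMatDerivAt B B' z) :
    HasMatDerivAt (fun w => A w - B w) (A' - B') z := fun i j => (hA i j).sub (hB i j)

theorem HasMatDerivAt.const_smul {A : ℂ → Matrix (Fin k) (Fin l) ℂ}
    {A' : Matrix (Fin k) (Fin l) ℂ} {z : ℂ} (c : ℂ) (hA : HasMatDerivAt A A' z) :
    HasMatDerivAt (fun w => c • A w) (c • A') z := fun i j => (hA i j).const_mul c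

theorem hasMatDerivAt_const (A : Matrix (Fin k) (Fin l) ℂ) (z : ℂ) :
    HasMatDerivAt (fun _ => A) 0 z := fun _ _ => hasDerivAt_const _ _

theorem HasMatDerivAt.unique {A : ℂ → Matrix (Fin k) (Fin l) ℂ} {A' B' : Matrix (Fin k) (Fin l) ℂ}
    {z : ℂ} (hA : HasMatDerivAt A A' z) (hB : HasMatDerivAt A B' z) : A' = B' := by
  ext i j
  exact (hA i j).unique (hB i j)

theorem hasMatDerivAt_one_add_smul (h : Matrix (Fin k) (Fin k) ℂ) :
    HasMatDerivAt (fun z => 1 + z • h) h 0 := fun i j => by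
  simpa using ((hasDerivAt_id (0 : ℂ)).mul_const (h i j)).const_add
    ((1 : Matrix (Fin k) (Fin k) ℂ) i j)

theorem eventually_isUnit_one_add_smul (h : Matrix (Fin k) (Fin k) ℂ) :
    ∀ᶠ z : ℂ in 𝓝 0, IsUnit (1 + z • h) := by
  refine MatAnalyticAt.eventually_isUnit (MatAnalyticAt.add (matAnalyticAt_const _ _)
    (MatAnalyticAt.smul analyticAt_id (matAnalyticAt_const _ _))) ?_
  simp

/-- Cramer's rule gives differentiability; differentiating (1 + zh)(1 + zh)⁻¹ = 1 then gives the
value. -/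
theorem hasMatDerivAt_inv_one_add_smul (h : Matrix (Fin k) (Fin k) ℂ) :
    HasMatDerivAt (fun z => (1 + z • h)⁻¹) (-h) 0 := by
  have ha : MatAnalyticAt (fun z : ℂ => (1 + z • h)⁻¹) 0 :=
    MatAnalyticAt.inv (MatAnalyticAt.add (matAnalyticAt_const _ _)
      (MatAnalyticAt.smul analyticAt_id (matAnalyticAt_const _ _))) (by simp)
  set B : Matrix (Fin k) (Fin k) ℂ := Matrix.of fun i j => deriv (fun z : ℂ => (1 + z • h)⁻¹ i j) 0
  have hB : HasMatDerivAt (fun z => (1 + z • h)⁻¹) B 0 := fun i j =>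
    (ha i j).differentiableAt.hasDerivAt
  have h1 := (hasMatDerivAt_one_add_smul h).mul hB
  have h2 : HasMatDerivAt (fun z => (1 + z • h) * (1 + z • h)⁻¹) 0 0 := fun i j => by
    refine (hasMatDerivAt_const (1 : Matrix (Fin k) (Fin k) ℂ) 0 i j).congr_of_eventuallyEq ?_
    filter_upwards [eventually_isUnit_one_add_smul h] with z hz
    rw [Matrix.mul_nonsing_inv _ ((Matrix.isUnit_iff_isUnit_det _).1 hz)]
  have h3 := h1.unique h2
  simp only [zero_smul, add_zero, inv_one, Matrix.mul_one, Matrix.one_mul] at h3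
  rwa [eq_neg_of_add_eq_zero_right h3] at hB

theorem hasMatDerivAt_matX {n : ℕ} {c : ℂ → RepSpace n} {v : RepSpace n} {z : ℂ}
    (h : HasDerivAt c v z) : HasMatDerivAt (fun w => matX (c w)) (matX v) z :=
  fun i j => hasDerivAt_pi.1 h ⟨.x, (i, j)⟩

theorem hasMatDerivAt_matY {n : ℕ} {c : ℂ → RepSpace n} {v : RepSpace n} {z : ℂ}
    (h : HasDerivAt c v z) : HasMatDerivAt (fun w => matY (c w)) (matY v) z :=
  fun i j => hasDerivAt_pi.1 h ⟨.y, (i, j)⟩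

theorem hasMatDerivAt_matV {n : ℕ} {c : ℂ → RepSpace n} {v : RepSpace n} {z : ℂ}
    (h : HasDerivAt c v z) : HasMatDerivAt (fun w => matV (c w)) (matV v) z :=
  fun i j => hasDerivAt_pi.1 h ⟨.v, (i, j)⟩

theorem hasMatDerivAt_matW {n : ℕ} {c : ℂ → RepSpace n} {v : RepSpace n} {z : ℂ}
    (h : HasDerivAt c v z) : HasMatDerivAt (fun w => matW (c w)) (matW v) z :=
  fun i j => hasDerivAt_pi.1 h ⟨.w, (i, j)⟩

theorem hasDerivAt_mkRep {n : ℕ} {X Y : ℂ → Matrix (Fin n) (Fin n) ℂ}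
    {V : ℂ → Matrix (Fin n) (Fin 1) ℂ} {W : ℂ → Matrix (Fin 1) (Fin n) ℂ}
    {X' Y' : Matrix (Fin n) (Fin n) ℂ} {V' : Matrix (Fin n) (Fin 1) ℂ}
    {W' : Matrix (Fin 1) (Fin n) ℂ} {z : ℂ}
    (hX : HasMatDerivAt X X' z) (hY : HasMatDerivAt Y Y' z) (hV : HasMatDerivAt V V' z)
    (hW : HasMatDerivAt W W' z) :
    HasDerivAt (fun w => mkRep (X w) (Y w) (V w) (W w)) (mkRep X' Y' V' W') z := by
  refine hasDerivAt_pi.2 fun c => ?_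
  obtain ⟨a, i, j⟩ := c
  cases a
  · exact hX i j
  · exact hY i j
  · exact hV i j
  · exact hW i j

/-- A curve in the moment level has its velocity in the kernel of the differential of the moment
map equation. -/
theorem momentDeriv_eq_zero_of_curve {n : ℕ} {q : ℂ} {c : ℂ → RepSpace n} {v : RepSpace n} {z : ℂ}
    (h : HasDerivAt c v z) (hc : ∀ᶠ w in 𝓝 z, c w ∈ momentLevel n q) :
    momentDeriv q (c z) v = 0 := by
  have hX := hasMatDerivAt_matX h
  have hY := hasMatDerivAt_matY h
  have hVW := (hasMatDerivAt_matV h).mul (hasMatDerivAt_matW h)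
  have h1 := (((hasMatDerivAt_const 1 z).add hVW).mul ((hasMatDerivAt_const 1 z).add
    (hX.mul hY))).sub (((hasMatDerivAt_const 1 z).add (hY.mul hX)).const_smul q)
  have h2 : HasMatDerivAt (fun w => (1 + matV (c w) * matW (c w)) * (1 + matX (c w) * matY (c w)) -
      q • (1 + matY (c w) * matX (c w))) 0 z := fun i j => by
    refine (hasMatDerivAt_const (0 : Matrix (Fin n) (Fin n) ℂ) z i j).congr_of_eventuallyEq ?_
    filter_upwards [hc] with w hw
    rw [momentLevel_equation hw, sub_self]
  have h3 := h1.unique h2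
  rw [zero_add, zero_add, zero_add] at h3
  exact h3

end Curves

/-! ## The group action -/

theorem gact_mem_momentLevel {n : ℕ} {q : ℂ} (g : GL (Fin n) ℂ) {p : RepSpace n}
    (hp : p ∈ momentLevel n q) : gact g p ∈ momentLevel n q := by
  have hg1 : g⁻¹.val * g.val = 1 := by rw [← Units.val_mul, inv_mul_cancel, Units.val_one]
  have hg2 : g.val * g⁻¹.val = 1 := by rw [← Units.val_mul, mul_inv_cancel, Units.val_one]
  have hg3 : ∀ {k : ℕ} (M : Matrix (Fin n) (Fin k) ℂ), g⁻¹.val * (g.val * M) = M := fun M => by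
    rw [← Matrix.mul_assoc, hg1, Matrix.one_mul]
  have hc : ∀ M : Matrix (Fin n) (Fin n) ℂ, 1 + g.val * (M * g⁻¹.val) =
      g.val * (1 + M) * g⁻¹.val := fun M => by
    simp only [Matrix.mul_add, Matrix.add_mul, Matrix.mul_one, hg2, Matrix.mul_assoc]
  have hu : ∀ M : Matrix (Fin n) (Fin n) ℂ, IsUnit M → IsUnit (g.val * M * g⁻¹.val) :=
    fun M hM => (g.isUnit.mul hM).mul g⁻¹.isUnit
  obtain ⟨h1, h2, h3, h4, h5, h6, h7⟩ := hp
  have e1 : 1 + matX (gact g p) * matY (gact g p) = g.val * (1 + matX p * matY p) * g⁻¹.val := by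
    rw [← hc]
    simp only [gact, matX_mkRep, matY_mkRep, Matrix.mul_assoc, hg3]
  have e2 : 1 + matY (gact g p) * matX (gact g p) = g.val * (1 + matY p * matX p) * g⁻¹.val := by
    rw [← hc]
    simp only [gact, matX_mkRep, matY_mkRep, Matrix.mul_assoc, hg3]
  have e3 : 1 + matV (gact g p) * matW (gact g p) = g.val * (1 + matV p * matW p) * g⁻¹.val := by
    rw [← hc]
    simp only [gact, matV_mkRep, matW_mkRep, Matrix.mul_assoc]
  have e4 : matW (gact g p) * matV (gact g p) = matW p * matV p := by
    simp only [gact, matV_mkRep, matW_mkRep, Matrix.mul_assoc, hg3]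
  refine ⟨hu _ h1, ?_, ?_, ?_, ?_, ?_, ?_⟩
  · rw [e1]; exact hu _ h2
  · rw [e2]; exact hu _ h3
  · rw [e3]; exact hu _ h4
  · rwa [e4]
  · have hinv : (g.val * (1 + matY p * matX p) * g⁻¹.val)⁻¹ =
        g.val * (1 + matY p * matX p)⁻¹ * g⁻¹.val := by
      refine Matrix.inv_eq_right_inv ?_
      simp only [Matrix.mul_assoc, hg3]
      rw [← Matrix.mul_assoc (1 + _) (1 + _)⁻¹,
        Matrix.mul_nonsing_inv _ ((Matrix.isUnit_iff_isUnit_det _).1 h3), Matrix.one_mul, hg2]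
    rw [e1, e2, e3, hinv]
    have h8 := congrArg (fun M => g.val * M * g⁻¹.val) h6
    simp only [Matrix.mul_smul, Matrix.mul_one, Matrix.smul_mul, hg2] at h8
    rw [← h8]
    simp only [Matrix.mul_assoc, hg3]
  · rwa [e4]

theorem toCM_eq_iff {n : ℕ} {q : ℂ} (p p' : momentLevel n q) :
    toCM p = toCM p' ↔ ∃ g : GL (Fin n) ℂ, gact g p.1 = p'.1 :=
  Quotient.eq (r := orbitSetoid n q)

theorem toCM_gact {n : ℕ} {q : ℂ} (g : GL (Fin n) ℂ) (p : momentLevel n q) :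
    toCM ⟨gact g p.1, gact_mem_momentLevel g p.2⟩ = toCM p :=
  ((toCM_eq_iff _ _).2 ⟨g, rfl⟩).symm

/-- The action of a group element as a continuous linear map. -/
def gactL {n : ℕ} (g : GL (Fin n) ℂ) : RepSpace n →L[ℂ] RepSpace n :=
  LinearMap.toContinuousLinearMap
    { toFun := gact g
      map_add' := fun p r => by
        refine repSpace_ext ?_ ?_ ?_ ?_ <;>
          simp only [gact, matX_mkRep, matY_mkRep, matV_mkRep, matW_mkRep, matX_add, matY_add,
            matV_add, matW_add, Matrix.mul_add, Matrix.add_mul]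
      map_smul' := fun c p => by
        refine repSpace_ext ?_ ?_ ?_ ?_ <;>
          simp only [gact, matX_mkRep, matY_mkRep, matV_mkRep, matW_mkRep, matX_smul, matY_smul,
            matV_smul, matW_smul, Matrix.mul_smul, Matrix.smul_mul, RingHom.id_apply] }

/-! ## The Poisson property of `ξ` -/

theorem isOpen_phaseDom (n : ℕ) (q : ℂ) : IsOpen (phaseDom n q) := by
  simp only [phaseDom, Set.ofPred_and, Set.ofPred_forall]
  refine IsOpen.inter (isOpen_iInter_of_finite fun i => isOpen_ne_fun (by fun_prop) (by fun_prop))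
    (IsOpen.inter (isOpen_iInter_of_finite fun i => isOpen_iInter_of_finite fun j =>
      isOpen_iInter_of_finite fun _ => IsOpen.inter (isOpen_ne_fun (by fun_prop) (by fun_prop))
        (isOpen_ne_fun (by fun_prop) (by fun_prop)))
      (isOpen_iInter_of_finite fun i => isOpen_ne_fun (by fun_prop) (by fun_prop)))

theorem analyticAt_phase_fst {n : ℕ} (i : Fin n) (u : Phase n) :
    AnalyticAt ℂ (fun w : Phase n => w.1 i) u :=
  ((ContinuousLinearMap.proj (R := ℂ) i).comp (ContinuousLinearMap.fst ℂ (Fin n → ℂ)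
    (Fin n → ℂ))).analyticAt u

theorem analyticAt_phase_snd {n : ℕ} (i : Fin n) (u : Phase n) :
    AnalyticAt ℂ (fun w : Phase n => w.2 i) u :=
  ((ContinuousLinearMap.proj (R := ℂ) i).comp (ContinuousLinearMap.snd ℂ (Fin n → ℂ)
    (Fin n → ℂ))).analyticAt u

section Poisson

variable {n : ℕ} {q : ℂ}

theorem analyticAt_xiRep (hq0 : q ≠ 0) (hq1 : q ≠ 1) {u : Phase n} (hu : u ∈ phaseDom n q) :
    AnalyticAt ℂ (xiRep q) u := by
  have hX : MatAnalyticAt (fun w : Phase n => Matrix.diagonal w.1) u := fun i j => by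
    by_cases h : i = j
    · subst h
      simpa using analyticAt_phase_fst i u
    · simpa [h] using analyticAt_const
  have hZ : MatAnalyticAt (fun w : Phase n => zMat q w) u := fun i j => by
    simp only [zMat, Matrix.of_apply]
    exact (analyticAt_const.mul (analyticAt_phase_snd j u)).div (analyticAt_const.sub
      ((analyticAt_phase_fst i u).div (analyticAt_phase_fst j u) (hu.1 j)))
      (q_sub_div_ne hq1 hu i j)
  have hW : MatAnalyticAt (fun w : Phase n => (Matrix.of fun (_ : Fin 1) j =>
      (q - 1) * w.2 j * w.1 j)) u := fun i j =>
    (analyticAt_const.mul (analyticAt_phase_snd j u)).mul (analyticAt_phase_fst j u)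
  exact analyticAt_mkRep hX (hZ.sub (hX.inv (isUnit_diagonal hu))) (matAnalyticAt_const _ _)
    (hW.mul ((hX.mul hZ).inv ((isUnit_diagonal hu).mul (isUnit_zMat hq0 hq1 hu))))

theorem hasDerivAt_xiRep_line (hq0 : q ≠ 0) (hq1 : q ≠ 1) {u : Phase n} (hu : u ∈ phaseDom n q)
    (e : Phase n) :
    HasDerivAt (fun z : ℂ => xiRep q (u + z • e)) (fderiv ℂ (xiRep q) u e) 0 := by
  have h1 : HasDerivAt (fun z : ℂ => u + z • e) e 0 := by
    simpa using ((hasDerivAt_id (0 : ℂ)).smul_const e).const_add u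
  have h2 : HasFDerivAt (xiRep q) (fderiv ℂ (xiRep q) u) (u + (0 : ℂ) • e) := by
    simpa using (analyticAt_xiRep hq0 hq1 hu).differentiableAt.hasFDerivAt
  exact h2.comp_hasDerivAt (0 : ℂ) h1

theorem eventually_line_mem {u : Phase n} (hu : u ∈ phaseDom n q) (e : Phase n) :
    ∀ᶠ z : ℂ in 𝓝 0, u + z • e ∈ phaseDom n q := by
  have h : ContinuousAt (fun z : ℂ => u + z • e) 0 := by fun_prop
  exact h.eventually_mem (by simpa using (isOpen_phaseDom n q).mem_nhds hu)

theorem momentDeriv_fderiv_xiRep (hq0 : q ≠ 0) (hq : ∀ k : ℕ, 0 < k → q ^ k ≠ 1) {u : Phase n}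
    (hu : u ∈ phaseDom n q) (e : Phase n) :
    momentDeriv q (xiRep q u) (fderiv ℂ (xiRep q) u e) = 0 := by
  have hq1 : q ≠ 1 := by simpa using hq 1 one_pos
  have h := momentDeriv_eq_zero_of_curve (q := q) (hasDerivAt_xiRep_line hq0 hq1 hu e)
    ((eventually_line_mem hu e).mono fun z hz => xiRep_mem hq0 hq hz)
  simpa using h

theorem matX_fderiv_xiRep (hq0 : q ≠ 0) (hq1 : q ≠ 1) {u : Phase n} (hu : u ∈ phaseDom n q)
    (e : Phase n) : matX (fderiv ℂ (xiRep q) u e) = Matrix.diagonal e.1 := by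
  refine (hasMatDerivAt_matX (hasDerivAt_xiRep_line hq0 hq1 hu e)).unique fun i j => ?_
  simp only [matX_xiRep, Matrix.diagonal_apply, Prod.fst_add, Prod.smul_fst, Pi.add_apply,
    Pi.smul_apply, smul_eq_mul]
  by_cases h : i = j
  · simpa [h] using ((hasDerivAt_id (0 : ℂ)).mul_const (e.1 j)).const_add (u.1 j)
  · simpa [h] using hasDerivAt_const (0 : ℂ) (0 : ℂ)

theorem matY_fderiv_xiRep (hq0 : q ≠ 0) (hq1 : q ≠ 1) {u : Phase n} (hu : u ∈ phaseDom n q)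
    (e : Phase n) (i : Fin n) :
    matY (fderiv ℂ (xiRep q) u e) i i = e.2 i + e.1 i / u.1 i ^ 2 := by
  refine (hasMatDerivAt_matY (hasDerivAt_xiRep_line hq0 hq1 hu e) i i).unique ?_
  have h1 : HasDerivAt (fun z : ℂ => u.2 i + z * e.2 i) (e.2 i) 0 := by
    simpa using ((hasDerivAt_id (0 : ℂ)).mul_const (e.2 i)).const_add (u.2 i)
  have h2 : HasDerivAt (fun z : ℂ => u.1 i + z * e.1 i) (e.1 i) 0 := by
    simpa using ((hasDerivAt_id (0 : ℂ)).mul_const (e.1 i)).const_add (u.1 i)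
  have h3 := h1.sub (h2.fun_inv (by simpa using hu.1 i))
  simp only [zero_mul, add_zero, neg_div, sub_neg_eq_add] at h3
  refine h3.congr_of_eventuallyEq ?_
  filter_upwards [eventually_line_mem hu e] with z hz
  rw [matY_xiRep_apply hz, zMat_diag hq1 hz, if_pos rfl]
  simp

/-- The standard basis of the space of coordinates. -/
def phaseBasis : Fin n ⊕ Fin n → Phase n
  | .inl i => (Pi.single i 1, 0)
  | .inr i => (0, Pi.single i 1)

/-- Along ξ the matrix X stays diagonal, so only the diagonal entry of `nuGrad` contributes; it
cancels the derivative of -1/x_i in Y_ii = ν_i - 1/x_i. -/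
theorem coordCovector_fderiv_xiRep (hq0 : q ≠ 0) (hq1 : q ≠ 1) {u : Phase n}
    (hu : u ∈ phaseDom n q) (a b : Fin n ⊕ Fin n) :
    coordCovector q u a ⬝ᵥ fderiv ℂ (xiRep q) u (phaseBasis b) = if a = b then 1 else 0 := by
  have hx : ∀ (i : Fin n) (e : Phase n),
      coordCovector q u (.inl i) ⬝ᵥ fderiv ℂ (xiRep q) u e = e.1 i := fun i e => by
    rw [dotProduct_eq_trace, gradX_coordCovector_inl, gradY_coordCovector_inl,
      gradV_coordCovector, gradW_coordCovector, matX_fderiv_xiRep hq0 hq1 hu]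
    simp [Matrix.trace_single_mul]
  have hn : ∀ (i : Fin n) (e : Phase n),
      coordCovector q u (.inr i) ⬝ᵥ fderiv ℂ (xiRep q) u e = e.2 i := fun i e => by
    rw [dotProduct_eq_trace, gradX_coordCovector_inr, gradY_coordCovector_inr,
      gradV_coordCovector, gradW_coordCovector, matX_fderiv_xiRep hq0 hq1 hu,
      Matrix.trace_single_mul, matY_fderiv_xiRep hq0 hq1 hu, Matrix.trace,
      Finset.sum_eq_single i]
    · simp [nuGrad, Matrix.mul_diagonal]
      ring
    · intro k _ hk
      simp [nuGrad, Matrix.mul_diagonal, hk]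
    · simp
  match a, b with
  | .inl i, .inl j => rw [hx]; simp [phaseBasis, Pi.single_apply]
  | .inl i, .inr j => rw [hx]; simp [phaseBasis]
  | .inr i, .inl j => rw [hn]; simp [phaseBasis]
  | .inr i, .inr j => rw [hn]; simp [phaseBasis, Pi.single_apply]

/-- The covector of partial derivatives of a function on the representation space. -/
def gradient (F : RepSpace n → ℂ) (p : RepSpace n) : RepSpace n :=
  fun c => fderiv ℂ F p (Pi.single c 1)

theorem gradient_dotProduct (F : RepSpace n → ℂ) (p v : RepSpace n) :
    gradient F p ⬝ᵥ v = fderiv ℂ F p v := by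
  have h : ∀ c, (Pi.single c (v c) : RepSpace n) = v c • Pi.single c 1 := fun c => by
    rw [← Pi.single_smul, smul_eq_mul, mul_one]
  conv_rhs => rw [← Finset.univ_sum_single v]
  rw [map_sum]
  refine Finset.sum_congr rfl fun c _ => ?_
  rw [h, map_smul, smul_eq_mul, mul_comm, gradient]

theorem quasiBracket_eq_bivector (F G : RepSpace n → ℂ) (p : RepSpace n) :
    quasiBracket F G p = bivector p (gradient F p) (gradient G p) := rfl

theorem gradient_comp_gact (g : GL (Fin n) ℂ) {F : RepSpace n → ℂ} {p : RepSpace n}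
    (hF : DifferentiableAt ℂ F (gact g p)) :
    gradient (F ∘ gact g) p = pullCovector g (gradient F (gact g p)) := by
  refine dotProduct_eq _ _ fun v => ?_
  have h : HasFDerivAt (F ∘ gact g) ((fderiv ℂ F (gact g p)).comp (gactL g)) p :=
    HasFDerivAt.comp p hF.hasFDerivAt (gactL g).hasFDerivAt
  rw [← dotProduct_gact, gradient_dotProduct, gradient_dotProduct, h.fderiv]
  rfl

theorem quasiBracket_gact (g : GL (Fin n) ℂ) {F G : RepSpace n → ℂ} {p : RepSpace n}
    (hF : DifferentiableAt ℂ F (gact g p)) (hG : DifferentiableAt ℂ G (gact g p)) :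
    quasiBracket F G (gact g p) = quasiBracket (F ∘ gact g) (G ∘ gact g) p := by
  rw [quasiBracket_eq_bivector, quasiBracket_eq_bivector, bivector_gact, gradient_comp_gact g hF,
    gradient_comp_gact g hG]

theorem IsLiftAt.eventually {f : CMSpace n q → ℂ} {p : momentLevel n q} {F : RepSpace n → ℂ}
    (h : IsLiftAt f p F) :
    ∀ᶠ r in 𝓝 p.1, ∀ hr : r ∈ momentLevel n q, F r = f (toCM ⟨r, hr⟩) := by
  have h1 := h.2
  rw [nhds_subtype_eq_comap, Filter.eventually_comap] at h1
  exact h1.mono fun r hr hm => hr ⟨r, hm⟩ rfl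

theorem IsLiftAt.comp_gact {f : CMSpace n q → ℂ} {p : momentLevel n q} {F : RepSpace n → ℂ}
    (g : GL (Fin n) ℂ)
    (h : IsLiftAt f ⟨gact g p.1, gact_mem_momentLevel g p.2⟩ F) : IsLiftAt f p (F ∘ gact g) := by
  refine ⟨AnalyticAt.comp h.1 ((gactL g).analyticAt p.1), ?_⟩
  have hc : ContinuousAt (fun m : momentLevel n q => gact g m.1) p :=
    ((gactL g).continuous.comp continuous_subtype_val).continuousAt
  filter_upwards [hc.eventually h.eventually] with m hm
  rw [Function.comp_apply, hm (gact_mem_momentLevel g m.2), toCM_gact]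

/-- Moving p by 1 + zh stays in one orbit inside the moment level, where F equals a function of the
class and is therefore constant. Hence dF vanishes on the velocity, whatever F does off the level.
-/
theorem IsLiftAt.gradient_orbitField {f : CMSpace n q → ℂ} {p : momentLevel n q}
    {F : RepSpace n → ℂ} (hF : IsLiftAt f p F) (h : Matrix (Fin n) (Fin n) ℂ) :
    gradient F p.1 ⬝ᵥ orbitField p.1 h = 0 := by
  set c : ℂ → RepSpace n := fun z => mkRep ((1 + z • h) * matX p.1 * (1 + z • h)⁻¹)
    ((1 + z • h) * matY p.1 * (1 + z • h)⁻¹) ((1 + z • h) * matV p.1)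
    (matW p.1 * (1 + z • h)⁻¹) with hc
  have hc0 : c 0 = p.1 := by
    simp only [hc, zero_smul, add_zero, inv_one, Matrix.one_mul, Matrix.mul_one, mkRep_mat]
  have hd : HasDerivAt c (orbitField p.1 h) 0 := by
    have hG := hasMatDerivAt_one_add_smul h
    have hI := hasMatDerivAt_inv_one_add_smul h
    have h1 := fun {l : ℕ} (M : Matrix (Fin n) (Fin l) ℂ) => hG.mul (hasMatDerivAt_const M 0)
    have h2 := hasDerivAt_mkRep ((h1 (matX p.1)).mul hI) ((h1 (matY p.1)).mul hI) (h1 (matV p.1))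
      ((hasMatDerivAt_const (matW p.1) 0).mul hI)
    simpa [orbitField, sub_eq_add_neg] using h2
  have hcomp : HasDerivAt (fun z => F (c z)) (fderiv ℂ F p.1 (orbitField p.1 h)) 0 := by
    have h1 : HasFDerivAt F (fderiv ℂ F p.1) (c 0) := by
      rw [hc0]
      exact hF.1.differentiableAt.hasFDerivAt
    exact h1.comp_hasDerivAt (0 : ℂ) hd
  have hev : ∀ᶠ z in 𝓝 (0 : ℂ), F (c z) = f (toCM p) := by
    have h1 : Filter.Tendsto c (𝓝 0) (𝓝 p.1) := by
      have h3 := hd.continuousAt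
      rwa [ContinuousAt, hc0] at h3
    filter_upwards [h1.eventually hF.eventually, eventually_isUnit_one_add_smul h] with z hz hu
    obtain ⟨g, hg⟩ := hu
    have h2 : c z = gact g p.1 := by
      simp only [hc, ← hg, gact, Matrix.coe_units_inv]
    rw [hz (by rw [h2]; exact gact_mem_momentLevel g p.2), ← toCM_gact g p]
    congr 2
    exact Subtype.ext h2
  rw [gradient_dotProduct]
  exact hcomp.unique ((hasDerivAt_const (0 : ℂ) (f (toCM p))).congr_of_eventuallyEq hev)

/-- The domain is open, so near u the pull-back of f is F composed with `xiRep`, and the chain rule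
applies. The default value of `xiPull` outside the domain plays no role. -/
theorem IsLiftAt.phaseDeriv_xiPull (hq0 : q ≠ 0) (hq : ∀ k : ℕ, 0 < k → q ^ k ≠ 1)
    {f : CMSpace n q → ℂ} {u : Phase n} (hu : u ∈ phaseDom n q) {F : RepSpace n → ℂ}
    (hF : IsLiftAt f ⟨xiRep q u, xiRep_mem hq0 hq hu⟩ F) (a : Fin n ⊕ Fin n) :
    phaseDeriv (xiPull hq0 hq f) u a =
      gradient F (xiRep q u) ⬝ᵥ fderiv ℂ (xiRep q) u (phaseBasis a) := by
  have hq1 : q ≠ 1 := by simpa using hq 1 one_pos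
  have hx := analyticAt_xiRep hq0 hq1 hu
  have h1 : xiPull hq0 hq f =ᶠ[𝓝 u] F ∘ xiRep q := by
    filter_upwards [(isOpen_phaseDom n q).mem_nhds hu, hx.continuousAt.eventually hF.eventually]
      with w hw hFw
    rw [xiPull, dif_pos hw, Function.comp_apply, hFw (xiRep_mem hq0 hq hw)]
    rfl
  have h2 : fderiv ℂ (xiPull hq0 hq f) u =
      (fderiv ℂ F (xiRep q u)).comp (fderiv ℂ (xiRep q) u) := by
    rw [h1.fderiv_eq]
    exact fderiv_comp u hF.1.differentiableAt hx.differentiableAt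
  rw [gradient_dotProduct]
  cases a <;> simp [phaseDeriv, h2, phaseBasis]

/-- `ξ` is a Poisson map. -/
theorem quasiBracket_eq_phaseBracket (hq0 : q ≠ 0) (hq : ∀ k : ℕ, 0 < k → q ^ k ≠ 1)
    (f g : CMSpace n q → ℂ) (u : phaseDom n q) (p : momentLevel n q) (F G : RepSpace n → ℂ)
    (hp : toCM p = xi hq0 hq u) (hF : IsLiftAt f p F) (hG : IsLiftAt g p G) :
    quasiBracket F G p.1 = phaseBracket q (xiPull hq0 hq f) (xiPull hq0 hq g) u.1 := by
  have hq1 : q ≠ 1 := by simpa using hq 1 one_pos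
  -- An arbitrary representative is moved to the standard one, and the extensions are pulled back
  -- along with it.
  obtain ⟨g₀, hg₀⟩ := (toCM_eq_iff _ _).1 hp.symm
  obtain rfl : p = ⟨gact g₀ (xiRep q u.1), gact_mem_momentLevel g₀ (xiRep_mem hq0 hq u.2)⟩ :=
    Subtype.ext hg₀.symm
  rw [quasiBracket_gact g₀ hF.1.differentiableAt hG.1.differentiableAt, quasiBracket_eq_bivector]
  have hF' := IsLiftAt.comp_gact (p := ⟨xiRep q u.1, xiRep_mem hq0 hq u.2⟩) g₀ hF
  have hG' := IsLiftAt.comp_gact (p := ⟨xiRep q u.1, xiRep_mem hq0 hq u.2⟩) g₀ hG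
  rw [bivector_xiRep hq1 u.2 (xiRep_mem hq0 hq u.2)
    (fun a => fderiv ℂ (xiRep q) u.1 (phaseBasis a))
    (fun a => momentDeriv_fderiv_xiRep hq0 hq u.2 _)
    (fun a b => coordCovector_fderiv_xiRep hq0 hq1 u.2 a b) _ _ hF'.gradient_orbitField
    hG'.gradient_orbitField, phaseBracket]
  simp only [hF'.phaseDeriv_xiPull hq0 hq u.2, hG'.phaseDeriv_xiPull hq0 hq u.2]

end Poisson

/-! ## The classes `ξ(x, ν)` -/

section Classes

variable {n : ℕ} {q : ℂ}

theorem gl_mul_inv (g : GL (Fin n) ℂ) : g.val * g⁻¹.val = 1 := by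
  rw [← Units.val_mul, mul_inv_cancel, Units.val_one]

theorem gl_inv_mul (g : GL (Fin n) ℂ) : g⁻¹.val * g.val = 1 := by
  rw [← Units.val_mul, inv_mul_cancel, Units.val_one]

theorem gl_inv_mul_cancel (g : GL (Fin n) ℂ) {k : ℕ} (M : Matrix (Fin n) (Fin k) ℂ) :
    g⁻¹.val * (g.val * M) = M := by
  rw [← Matrix.mul_assoc, gl_inv_mul, Matrix.one_mul]

/-- The matrix `Z = Y + X⁻¹`. -/
def matZ (p : RepSpace n) : Matrix (Fin n) (Fin n) ℂ := matY p + (matX p)⁻¹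

theorem matZ_gact (g : GL (Fin n) ℂ) {p : RepSpace n} (hp : IsUnit (matX p)) :
    matZ (gact g p) = g.val * matZ p * g⁻¹.val := by
  have h : (g.val * matX p * g⁻¹.val)⁻¹ = g.val * (matX p)⁻¹ * g⁻¹.val := by
    refine Matrix.inv_eq_right_inv ?_
    simp only [Matrix.mul_assoc, gl_inv_mul_cancel]
    rw [← Matrix.mul_assoc (matX p), Matrix.mul_nonsing_inv _
      ((Matrix.isUnit_iff_isUnit_det _).1 hp), Matrix.one_mul, gl_mul_inv]
  rw [matZ, matZ, Matrix.mul_add, Matrix.add_mul, ← h]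
  rfl

theorem matZ_xiRep (u : Phase n) : matZ (xiRep q u) = zMat q u := by
  rw [matZ, matX_xiRep]
  exact sub_add_cancel _ _

theorem matY_eq (p : RepSpace n) : matY p = matZ p - (matX p)⁻¹ := by
  rw [matZ, add_sub_cancel_right]

theorem momentLevel_XZ {p : RepSpace n} (hp : p ∈ momentLevel n q) :
    (1 + matV p * matW p) * (matX p * matZ p) = q • (matZ p * matX p) := by
  rw [← one_add_mul_sub_inv hp.1, ← one_add_sub_inv_mul hp.1, ← matY_eq]
  exact momentLevel_equation hp

theorem isUnit_XZ {p : RepSpace n} (hp : p ∈ momentLevel n q) : IsUnit (matX p * matZ p) := by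
  rw [← one_add_mul_sub_inv hp.1, ← matY_eq]
  exact hp.2.1

theorem isUnit_diagonal_of_ne_zero {d : Fin n → ℂ} (h : ∀ i, d i ≠ 0) :
    IsUnit (Matrix.diagonal d) := by
  rw [Matrix.isUnit_iff_isUnit_det, Matrix.det_diagonal, isUnit_iff_ne_zero]
  exact Finset.prod_ne_zero_iff.2 fun i _ => h i

/-- This is the entry (i, j) of (1 + VW)XZ = qZX. The rank one term VWXZ makes Z a matrix of Cauchy
type. -/
theorem entries_of_diagonal {u : Phase n} {p : RepSpace n} (hp : p ∈ momentLevel n q)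
    (hX : matX p = Matrix.diagonal u.1) (i j : Fin n) :
    (q * u.1 j - u.1 i) * matZ p i j = matV p i 0 * (matW p * (matX p * matZ p)) 0 j := by
  have h := momentLevel_XZ hp
  rw [Matrix.add_mul, Matrix.one_mul, Matrix.mul_assoc] at h
  have h1 := congrFun (congrFun h i) j
  rw [Matrix.add_apply, Matrix.mul_apply (M := matV p), Fin.sum_univ_one, Matrix.smul_apply, hX,
    Matrix.mul_diagonal, Matrix.diagonal_mul, smul_eq_mul] at h1
  rw [hX]
  linear_combination -h1

/-- A representation with `X = diag(x)` is of class `ξ(x, ν)` as soon as the diagonal of `Z` is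
`ν`. -/
theorem toCM_eq_xi_of_diagonal (hq0 : q ≠ 0) (hq : ∀ k : ℕ, 0 < k → q ^ k ≠ 1)
    (u : phaseDom n q) (p : momentLevel n q) (hX : matX p.1 = Matrix.diagonal u.1.1)
    (hZ : ∀ i, matZ p.1 i i = u.1.2 i) : toCM p = xi hq0 hq u := by
  have hq1 : q ≠ 1 := by simpa using hq 1 one_pos
  have hq1' : q - 1 ≠ 0 := sub_ne_zero.2 hq1
  have hent := entries_of_diagonal p.2 hX
  have hdiag : ∀ i, (q - 1) * u.1.2 i * u.1.1 i =
      matV p.1 i 0 * (matW p.1 * (matX p.1 * matZ p.1)) 0 i := fun i => by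
    rw [← hent, hZ]
    ring
  -- The diagonal entries of the equation give V_i as a factor of the nonzero number (q - 1) ν_i
  -- x_i; this is where ν_i ≠ 0 is needed.
  have hV : ∀ i, matV p.1 i 0 ≠ 0 := fun i h => by
    have h1 := hdiag i
    rw [h, zero_mul] at h1
    exact mul_ne_zero (mul_ne_zero hq1' (u.2.2.2 i)) (u.2.1 i) h1
  -- The diagonal matrices commute with X, and this one scales V to the column of ones.
  obtain ⟨g, hg⟩ := isUnit_diagonal_of_ne_zero (d := fun i => (matV p.1 i 0)⁻¹)
    fun i => inv_ne_zero (hV i)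
  have hg' : g⁻¹.val = Matrix.diagonal fun i => matV p.1 i 0 := by
    rw [Matrix.coe_units_inv, hg]
    refine Matrix.inv_eq_right_inv ?_
    rw [Matrix.diagonal_mul_diagonal, ← Matrix.diagonal_one]
    congr 1
    funext i
    exact inv_mul_cancel₀ (hV i)
  have hm := gact_mem_momentLevel g p.2
  have eX : matX (gact g p.1) = matX (xiRep q u.1) := by
    change g.val * matX p.1 * g⁻¹.val = _
    rw [hX, hg, hg', Matrix.diagonal_mul_diagonal, Matrix.diagonal_mul_diagonal, matX_xiRep]
    congr 1
    funext i
    have := hV i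
    field_simp
  have eZ : matZ (gact g p.1) = matZ (xiRep q u.1) := by
    rw [matZ_gact g p.2.1, hg, hg', matZ_xiRep]
    ext i j
    have h1 : q * u.1.1 j - u.1.1 i ≠ 0 := by
      rw [← neg_sub, neg_ne_zero]
      exact phase_ne_mul hq1 u.2 i j
    have h2 := hV i
    rw [Matrix.mul_diagonal, Matrix.diagonal_mul, zMat_apply u.2, eq_div_iff h1, hdiag]
    field_simp
    linear_combination matV p.1 j 0 * hent i j
  have eV : matV (gact g p.1) = matV (xiRep q u.1) := by
    change g.val * matV p.1 = _
    ext i j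
    rw [hg, Matrix.diagonal_mul, Subsingleton.elim j 0, inv_mul_cancel₀ (hV i), matV_xiRep]
    rfl
  have eY : matY (gact g p.1) = matY (xiRep q u.1) := by rw [matY_eq, matY_eq, eX, eZ]
  -- W is determined by the other three matrices: XZ is invertible, and a row can be read off from
  -- its product with the column of ones.
  have eW : matW (gact g p.1) = matW (xiRep q u.1) := by
    have h1 := momentLevel_XZ hm
    have h2 := momentLevel_XZ (xiRep_mem hq0 hq u.2)
    rw [eX, eZ, eV, ← h2] at h1
    have hu := isUnit_XZ (xiRep_mem hq0 hq u.2)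
    have h3 := add_left_cancel (hu.mul_right_cancel h1)
    ext i j
    have h4 := congrFun (congrFun h3 j) j
    rw [Matrix.mul_apply, Matrix.mul_apply, Fin.sum_univ_one, Fin.sum_univ_one, matV_xiRep] at h4
    rw [Subsingleton.elim i 0]
    simpa using h4
  exact (toCM_eq_iff _ _).2 ⟨g, repSpace_ext eX eY eV eW⟩

theorem toCM_eq_xi_of_conj (hq0 : q ≠ 0) (hq : ∀ k : ℕ, 0 < k → q ^ k ≠ 1)
    (u : phaseDom n q) (p : momentLevel n q) (g : GL (Fin n) ℂ)
    (hX : g.val * matX p.1 * g⁻¹.val = Matrix.diagonal u.1.1)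
    (hZ : ∀ i, (g.val * matZ p.1 * g⁻¹.val) i i = u.1.2 i) : toCM p = xi hq0 hq u := by
  rw [← toCM_gact g p]
  refine toCM_eq_xi_of_diagonal hq0 hq u _ hX fun i => ?_
  rw [← hZ i, ← matZ_gact g p.2.1]

theorem toCM_eq_xi_iff (hq0 : q ≠ 0) (hq : ∀ k : ℕ, 0 < k → q ^ k ≠ 1)
    (u : phaseDom n q) (p : momentLevel n q) :
    toCM p = xi hq0 hq u ↔ ∃ g : GL (Fin n) ℂ,
      g.val * matX p.1 * g⁻¹.val = Matrix.diagonal u.1.1 ∧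
      g.val * (matY p.1 + (matX p.1)⁻¹) * g⁻¹.val = zMat q u.1 := by
  have hq1 : q ≠ 1 := by simpa using hq 1 one_pos
  constructor
  · intro h
    obtain ⟨g, hg⟩ := (toCM_eq_iff _ _).1 h
    refine ⟨g, congrArg matX hg, ?_⟩
    have h1 := matZ_gact g p.2.1
    rw [hg] at h1
    exact h1.symm.trans (matZ_xiRep _)
  · rintro ⟨g, h1, h2⟩
    refine toCM_eq_xi_of_conj hq0 hq u p g h1 fun i => ?_
    rw [← zMat_diag hq1 u.2 i, ← h2]
    rfl

/-- A matrix intertwining two diagonal matrices with distinct entries has one nonzero entry in each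
row and column, which gives the permutation, and comparing Z there gives ν. Conversely, a
permutation matrix conjugates one representation to one with the permuted x and diagonal of Z, which
fix the class. -/
theorem xi_eq_xi_iff (hq0 : q ≠ 0) (hq : ∀ k : ℕ, 0 < k → q ^ k ≠ 1) (u u' : phaseDom n q) :
    xi hq0 hq u = xi hq0 hq u' ↔ ∃ s : Equiv.Perm (Fin n), u'.1 = permute s u.1 := by
  have hq1 : q ≠ 1 := by simpa using hq 1 one_pos
  constructor
  · intro h
    obtain ⟨g, h1, h2⟩ := (toCM_eq_xi_iff hq0 hq u' _).1 h
    change g.val * matX (xiRep q u.1) * g⁻¹.val = _ at h1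
    change g.val * matZ (xiRep q u.1) * g⁻¹.val = _ at h2
    have hcomm : ∀ M N : Matrix (Fin n) (Fin n) ℂ, g.val * M * g⁻¹.val = N →
        g.val * M = N * g.val := fun M N h => by
      rw [← h, Matrix.mul_assoc _ g⁻¹.val, gl_inv_mul, Matrix.mul_one]
    have e1 : ∀ i j, g.val i j * u.1.1 j = u'.1.1 i * g.val i j := fun i j => by
      have h3 := congrFun (congrFun (hcomm _ _ h1) i) j
      rwa [matX_xiRep, Matrix.mul_diagonal, Matrix.diagonal_mul] at h3
    have e2 := hcomm _ _ h2
    rw [matZ_xiRep] at e2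
    have hne : ∀ i, ∃ j, g.val i j ≠ 0 := fun i => by
      by_contra! hc
      have h3 := congrFun (congrFun (gl_mul_inv g) i) i
      rw [Matrix.mul_apply] at h3
      simp [hc] at h3
    -- Row i of the invertible g has a nonzero entry in some column s i, and intertwining then
    -- forces x'_i = x_(s i).
    choose s hs using hne
    have hx : ∀ i, u'.1.1 i = u.1.1 (s i) := fun i =>
      (mul_right_cancel₀ (hs i) ((mul_comm _ _).trans (e1 i (s i)))).symm
    have hinj' : Function.Injective u'.1.1 := fun i j h => by
      by_contra hij
      exact (u'.2.2.1 i j hij).1 h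
    have hinj : Function.Injective u.1.1 := fun i j h => by
      by_contra hij
      exact (u.2.2.1 i j hij).1 h
    have hsinj : Function.Injective s := fun i j h => hinj' (by rw [hx, hx, h])
    have hzero : ∀ i j, g.val i j ≠ 0 → j = s i := fun i j h => by
      refine hinj ?_
      rw [← hx]
      exact mul_left_cancel₀ h ((e1 i j).trans (mul_comm _ _))
    refine ⟨Equiv.ofBijective s hsinj.bijective_of_finite, Prod.ext (funext hx) (funext fun i => ?_)⟩
    -- In gZ = Z'g each sum has one term at the entry (i, s i), so ν'_i and ν_(s i) multiply the
    -- same nonzero entry of g.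
    have h3 := congrFun (congrFun e2 i) (s i)
    rw [Matrix.mul_apply, Matrix.mul_apply, Finset.sum_eq_single (s i), Finset.sum_eq_single i,
      zMat_diag hq1 u.2, zMat_diag hq1 u'.2, mul_comm] at h3
    · exact (mul_right_cancel₀ (hs i) h3).symm
    · intro k _ hk
      by_cases h4 : g.val k (s i) = 0
      · rw [h4, mul_zero]
      · exact absurd (hsinj (hzero k (s i) h4)).symm hk
    · simp
    · intro k _ hk
      by_cases h4 : g.val i k = 0
      · rw [h4, zero_mul]
      · exact absurd (hzero i k h4) hk
    · simp
  · rintro ⟨s, hs⟩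
    have hmul : ∀ (e₁ e₂ e₃ : Fin n → Fin n) (M N : Matrix (Fin n) (Fin n) ℂ),
        Function.Bijective e₂ → M.submatrix e₁ e₂ * N.submatrix e₂ e₃ = (M * N).submatrix e₁ e₃ :=
      fun e₁ e₂ e₃ M N h => (Matrix.submatrix_mul M N e₁ e₂ e₃ h).symm
    have hone : (1 : Matrix (Fin n) (Fin n) ℂ).submatrix s s = 1 := Matrix.submatrix_one_equiv s
    set P : Matrix (Fin n) (Fin n) ℂ := (1 : Matrix (Fin n) (Fin n) ℂ).submatrix s id with hP
    set Q : Matrix (Fin n) (Fin n) ℂ := (1 : Matrix (Fin n) (Fin n) ℂ).submatrix id s with hQ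
    have hPQ : P * Q = 1 := by
      rw [hP, hQ, hmul _ _ _ _ _ Function.bijective_id, Matrix.one_mul, hone]
    let g : GL (Fin n) ℂ := ⟨P, Q, hPQ, mul_eq_one_comm.1 hPQ⟩
    have hconj : ∀ M : Matrix (Fin n) (Fin n) ℂ, g.val * M * g⁻¹.val = M.submatrix s s :=
      fun M => by
      change P * M * Q = _
      nth_rw 1 [← Matrix.submatrix_id_id M]
      rw [hP, hQ, hmul _ _ _ _ _ Function.bijective_id, hmul _ _ _ _ _ Function.bijective_id,
        Matrix.one_mul, Matrix.mul_one]
    refine toCM_eq_xi_of_conj hq0 hq u' _ g ?_ fun i => ?_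
    · rw [hconj, hs]
      change (Matrix.diagonal u.1.1).submatrix s s = _
      ext i j
      simp [Matrix.diagonal_apply, permute]
    · rw [hconj, hs]
      change matZ (xiRep q u.1) (s i) (s i) = _
      rw [matZ_xiRep, zMat_diag hq1 u.2]
      rfl

/-! ## Local inverses -/

/-- This follows from multiplicativity of the adjugate and needs no invertibility of M, which
matters since it is used for the singular matrix x_i - X. -/
theorem adjugate_conj (g : GL (Fin n) ℂ) (M : Matrix (Fin n) (Fin n) ℂ) :
    (g.val * M * g⁻¹.val).adjugate = g.val * M.adjugate * g⁻¹.val := by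
  have hd : IsUnit g.val.det := (Matrix.isUnit_iff_isUnit_det _).1 g.isUnit
  have h2 : ∀ h : GL (Fin n) ℂ, h.val.adjugate = h.val.det • h⁻¹.val := fun h => by
    have hd : IsUnit h.val.det := (Matrix.isUnit_iff_isUnit_det _).1 h.isUnit
    rw [Matrix.coe_units_inv, Matrix.inv_def, smul_smul, Ring.inverse_eq_inv',
      mul_inv_cancel₀ hd.ne_zero, one_smul]
  rw [Matrix.adjugate_mul_distrib, Matrix.adjugate_mul_distrib, h2 g, h2 g⁻¹, inv_inv,
    Matrix.smul_mul, Matrix.mul_smul, Matrix.mul_smul, smul_smul, ← Matrix.det_mul, gl_inv_mul,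
    Matrix.det_one, one_smul, Matrix.mul_assoc]

theorem det_sub_conj {x : Fin n → ℂ} {X : Matrix (Fin n) (Fin n) ℂ} (g : GL (Fin n) ℂ)
    (hX : g.val * X * g⁻¹.val = Matrix.diagonal x) (t : ℂ) :
    (t • 1 - X).det = ∏ j, (t - x j) := by
  have h : g.val * (t • 1 - X) * g⁻¹.val = Matrix.diagonal fun j => t - x j := by
    rw [Matrix.mul_sub, Matrix.sub_mul, hX, Matrix.mul_smul, Matrix.mul_one, Matrix.smul_mul,
      gl_mul_inv, Matrix.smul_one_eq_diagonal, Matrix.diagonal_sub]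
  rw [← Matrix.det_diagonal, ← h, Matrix.det_mul, Matrix.det_mul, mul_right_comm, ← Matrix.det_mul,
    gl_mul_inv, Matrix.det_one, one_mul]

/-- The adjugate of x_i - X is a multiple of the projection to the eigenline of x_i. It extracts a
diagonal entry in an eigenbasis without choosing one; the product cancels in the quotient that
defines ν_i. -/
theorem trace_adjugate_conj {x : Fin n → ℂ} {X : Matrix (Fin n) (Fin n) ℂ} (g : GL (Fin n) ℂ)
    (hX : g.val * X * g⁻¹.val = Matrix.diagonal x) (i : Fin n) (Z : Matrix (Fin n) (Fin n) ℂ) :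
    ((x i • 1 - X).adjugate * Z).trace =
      (∏ j ∈ Finset.univ.erase i, (x i - x j)) * (g.val * Z * g⁻¹.val) i i := by
  have h : g.val * (x i • 1 - X) * g⁻¹.val = Matrix.diagonal fun j => x i - x j := by
    rw [Matrix.mul_sub, Matrix.sub_mul, hX, Matrix.mul_smul, Matrix.mul_one, Matrix.smul_mul,
      gl_mul_inv, Matrix.smul_one_eq_diagonal, Matrix.diagonal_sub]
  have h1 : ((x i • 1 - X).adjugate * Z).trace =
      ((g.val * (x i • 1 - X) * g⁻¹.val).adjugate * (g.val * Z * g⁻¹.val)).trace := by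
    rw [adjugate_conj]
    simp only [Matrix.mul_assoc, gl_inv_mul_cancel]
    rw [Matrix.trace_mul_comm g.val]
    simp only [Matrix.mul_assoc, gl_inv_mul, Matrix.mul_one]
  rw [h1, h, Matrix.adjugate_diagonal, Matrix.trace, Finset.sum_eq_single i]
  · simp [Matrix.diagonal_mul]
  · intro k _ hk
    rw [Matrix.diag_apply, Matrix.diagonal_mul, Finset.prod_eq_zero (i := i), zero_mul]
    · exact Finset.mem_erase.2 ⟨Ne.symm hk, Finset.mem_univ i⟩
    · exact sub_self _
  · simp

/-- A matrix with `n` different eigenvalues is diagonalizable. -/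
theorem exists_conj_diagonal {x : Fin n → ℂ} (hx : Function.Injective x)
    {X : Matrix (Fin n) (Fin n) ℂ} (h : ∀ i, (x i • 1 - X).det = 0) :
    ∃ g : GL (Fin n) ℂ, g.val * X * g⁻¹.val = Matrix.diagonal x := by
  choose v hv0 hv using fun i => Matrix.exists_mulVec_eq_zero_iff.2 (h i)
  have hev : ∀ i, X.mulVec (v i) = x i • v i := fun i => by
    have h1 := hv i
    rw [Matrix.sub_mulVec, Matrix.smul_mulVec, Matrix.one_mulVec, sub_eq_zero] at h1
    exact h1.symm
  have hli : LinearIndependent ℂ v := by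
    refine Module.End.eigenvectors_linearIndependent' (Matrix.mulVecLin X) x hx v fun i => ?_
    rw [Module.End.hasEigenvector_iff, Module.End.mem_eigenspace_iff]
    exact ⟨hev i, hv0 i⟩
  obtain ⟨g, hg⟩ := (Matrix.linearIndependent_cols_iff_isUnit
    (A := Matrix.of fun i j => v j i)).1 hli
  refine ⟨g⁻¹, ?_⟩
  have h2 : X * g.val = g.val * Matrix.diagonal x := by
    ext i j
    rw [Matrix.mul_diagonal, hg, Matrix.mul_apply]
    have h3 := congrFun (hev j) i
    rw [Matrix.mulVec, dotProduct] at h3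
    simpa [mul_comm] using h3
  rw [inv_inv, Matrix.mul_assoc, h2, gl_inv_mul_cancel]

theorem analyticAt_coord (c : Coord n) (p : RepSpace n) :
    AnalyticAt ℂ (fun m : RepSpace n => m c) p :=
  (ContinuousLinearMap.proj (R := ℂ) (φ := fun _ : Coord n => ℂ) c).analyticAt p

/-- A simple root of the characteristic polynomial of `X` depends analytically on the
representation. -/
theorem exists_analytic_root {p : RepSpace n} {x : Fin n → ℂ} (hx : Function.Injective x)
    (g : GL (Fin n) ℂ) (hX : g.val * matX p * g⁻¹.val = Matrix.diagonal x) (i : Fin n) :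
    ∃ r : RepSpace n → ℂ, AnalyticAt ℂ r p ∧ r p = x i ∧
      ∀ᶠ m : RepSpace n × ℂ in 𝓝 (p, x i), (m.2 • 1 - matX m.1).det = 0 ↔ r m.1 = m.2 := by
  set f : RepSpace n × ℂ → ℂ := fun m => (m.2 • (1 : Matrix (Fin n) (Fin n) ℂ) - matX m.1).det
    with hf
  have hfa : AnalyticAt ℂ f (p, x i) := by
    refine MatAnalyticAt.det (MatAnalyticAt.sub (MatAnalyticAt.smul analyticAt_snd
      (matAnalyticAt_const _ _)) fun k l => ?_)
    exact ((ContinuousLinearMap.proj (R := ℂ) (⟨.x, (k, l)⟩ : Coord n)).comp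
      (ContinuousLinearMap.fst ℂ (RepSpace n) ℂ)).analyticAt _
  have hf0 : f (p, x i) = 0 := by
    rw [hf]
    simp only [det_sub_conj g hX]
    exact Finset.prod_eq_zero (Finset.mem_univ i) (sub_self _)
  have hc : ContDiffAt ℂ ⊤ f (p, x i) := hfa.contDiffAt
  -- The derivative of the characteristic polynomial at x_i, nonzero because the root is simple;
  -- this is the hypothesis of the implicit function theorem.
  have hd : fderiv ℂ f (p, x i) (0, 1) = ∏ j ∈ Finset.univ.erase i, (x i - x j) := by
    have h1 : HasDerivAt (fun t : ℂ => f (p, t)) (fderiv ℂ f (p, x i) (0, 1)) (x i) :=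
      hfa.differentiableAt.hasFDerivAt.comp_hasDerivAt (x i)
        ((hasDerivAt_const (x i) p).prodMk (hasDerivAt_id (x i)))
    have h2 : HasDerivAt (fun t : ℂ => f (p, t)) (∏ j ∈ Finset.univ.erase i, (x i - x j))
        (x i) := by
      have h3 : (fun t : ℂ => f (p, t)) =
          fun t => (t - x i) * ∏ j ∈ Finset.univ.erase i, (t - x j) := by
        funext t
        rw [hf]
        simp only [det_sub_conj g hX]
        rw [Finset.mul_prod_erase _ (fun j => t - x j) (Finset.mem_univ i)]
      have h4 : DifferentiableAt ℂ (fun t => ∏ j ∈ Finset.univ.erase i, (t - x j)) (x i) := by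
        fun_prop
      rw [h3]
      simpa using ((hasDerivAt_id (x i)).sub_const (x i)).fun_mul h4.hasDerivAt
    exact h1.unique h2
  have hne : fderiv ℂ f (p, x i) (0, 1) ≠ 0 := by
    rw [hd]
    exact Finset.prod_ne_zero_iff.2 fun j hj =>
      sub_ne_zero.2 fun h => (Finset.ne_of_mem_erase hj) (hx h).symm
  have hinv : (fderiv ℂ f (p, x i) ∘L .inr ℂ (RepSpace n) ℂ).IsInvertible := by
    refine ⟨ContinuousLinearEquiv.unitsEquivAut ℂ (Units.mk0 _ hne), ?_⟩
    ext
    simp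
  refine ⟨hc.implicitFunction (by simp) hinv,
    (hc.contDiffAt_implicitFunction (by simp) hinv).analyticAt,
    hc.implicitFunction_apply_self (by simp) hinv, ?_⟩
  have h := hc.eventually_apply_eq_iff_implicitFunction (by simp) hinv
  rwa [hf0] at h

/-- The lift is a translate of `xiRep`. The inverse consists of the analytic eigenvalues and of the
quotients of adjugate traces; that these values determine the class is `toCM_eq_xi_of_conj`. -/
theorem isLocalBiholomorphism_xi (hq0 : q ≠ 0) (hq : ∀ k : ℕ, 0 < k → q ^ k ≠ 1) :
    IsLocalBiholomorphism (xi (n := n) hq0 hq) := by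
  have hq1 : q ≠ 1 := by simpa using hq 1 one_pos
  intro u p hp
  constructor
  · obtain ⟨g, hg⟩ := (toCM_eq_iff _ _).1 hp.symm
    refine ⟨gact g ∘ xiRep q, ((gactL g).analyticAt _).comp (analyticAt_xiRep hq0 hq1 u.2), hg,
      Filter.Eventually.of_forall fun u' => ?_⟩
    exact ⟨gact_mem_momentLevel g (xiRep_mem hq0 hq u'.2),
      toCM_gact g ⟨xiRep q u'.1, xiRep_mem hq0 hq u'.2⟩⟩
  · obtain ⟨g, hgX, hgZ⟩ := (toCM_eq_xi_iff hq0 hq u p).1 hp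
    have hinj : ∀ u : phaseDom n q, Function.Injective u.1.1 := fun u i j h => by
      by_contra hij
      exact (u.2.2.1 i j hij).1 h
    have hprod : ∀ (u : phaseDom n q) (i : Fin n),
        ∏ j ∈ Finset.univ.erase i, (u.1.1 i - u.1.1 j) ≠ 0 := fun u i =>
      Finset.prod_ne_zero_iff.2 fun j hj => phase_ne u.2 (Finset.ne_of_mem_erase hj).symm
    choose r hra hrp hr using exists_analytic_root (hinj u) g hgX
    have hone : ∀ (g : GL (Fin n) ℂ) (i : Fin n), (g.val * (1 : Matrix (Fin n) (Fin n) ℂ) * g⁻¹.val) i i = 1 := fun g i => by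
      rw [Matrix.mul_one, gl_mul_inv, Matrix.one_apply_eq]
    have hnu : ∀ (u : phaseDom n q) (m : RepSpace n) (g : GL (Fin n) ℂ),
        g.val * matX m * g⁻¹.val = Matrix.diagonal u.1.1 → ∀ i,
        ((u.1.1 i • 1 - matX m).adjugate * matZ m).trace /
          ((u.1.1 i • 1 - matX m).adjugate * 1).trace = (g.val * matZ m * g⁻¹.val) i i :=
      fun u m g h i => by
      rw [trace_adjugate_conj g h, trace_adjugate_conj g h, hone, mul_one,
        mul_div_cancel_left₀ _ (hprod u i)]
    refine ⟨fun m => (fun i => r i m, fun i =>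
      ((r i m • 1 - matX m).adjugate * matZ m).trace /
        ((r i m • 1 - matX m).adjugate * 1).trace), ?_, ?_⟩
    · have hmX : MatAnalyticAt (fun m : RepSpace n => matX m) p.1 := fun k l =>
        analyticAt_coord ⟨.x, (k, l)⟩ p.1
      have hmY : MatAnalyticAt (fun m : RepSpace n => matY m) p.1 := fun k l =>
        analyticAt_coord ⟨.y, (k, l)⟩ p.1
      have hadj : ∀ i, MatAnalyticAt (fun m : RepSpace n => (r i m • 1 - matX m).adjugate) p.1 :=
        fun i => MatAnalyticAt.adjugate (MatAnalyticAt.sub (MatAnalyticAt.smul (hra i)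
          (matAnalyticAt_const _ _)) hmX)
      refine (analyticAt_pi_iff.2 hra).prod (analyticAt_pi_iff.2 fun i => ?_)
      refine AnalyticAt.div ((hadj i).mul (hmY.add (hmX.inv p.2.1))).trace
        ((hadj i).mul (matAnalyticAt_const _ _)).trace ?_
      rw [hrp, trace_adjugate_conj g hgX, hone, mul_one]
      exact hprod u i
    -- The roots of the implicit function theorem are unique near (p, x_i), so for nearby points the
    -- vanishing of the determinant at x'_i is the same as r_i = x'_i.
    · have hev : ∀ i, ∀ᶠ t : phaseDom n q × momentLevel n q in 𝓝 (u, p),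
          (t.1.1.1 i • 1 - matX t.2.1).det = 0 ↔ r i t.2.1 = t.1.1.1 i := fun i => by
        have hc : ContinuousAt (fun t : phaseDom n q × momentLevel n q => (t.2.1, t.1.1.1 i))
            (u, p) := by
          refine Continuous.continuousAt ?_
          exact (continuous_subtype_val.comp continuous_snd).prodMk ((continuous_apply i).comp
            (continuous_fst.comp (continuous_subtype_val.comp continuous_fst)))
        exact hc.eventually (hr i)
      filter_upwards [Filter.eventually_all.2 hev] with t ht
      constructor
      · intro h
        obtain ⟨g', hX', hZ'⟩ := (toCM_eq_xi_iff hq0 hq t.1 t.2).1 h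
        have hroot : ∀ i, r i t.2.1 = t.1.1.1 i := fun i => (ht i).1 (by
          rw [det_sub_conj g' hX']
          exact Finset.prod_eq_zero (Finset.mem_univ i) (sub_self _))
        refine Prod.ext (funext hroot) (funext fun i => ?_)
        change _ / _ = _
        rw [hroot, hnu t.1 t.2.1 g' hX', ← zMat_diag hq1 t.1.2, ← hZ']
        rfl
      · intro h
        have hroot : ∀ i, r i t.2.1 = t.1.1.1 i := fun i => congrFun (congrArg Prod.fst h) i
        -- All x'_i are eigenvalues, and they are distinct, so X is conjugate to diag(x').
        obtain ⟨g', hX'⟩ := exists_conj_diagonal (hinj t.1) fun i => (ht i).2 (hroot i)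
        refine toCM_eq_xi_of_conj hq0 hq t.1 t.2 g' hX' fun i => ?_
        rw [← hnu t.1 t.2.1 g' hX', ← congrFun (congrArg Prod.snd h) i]
        simp only [hroot]

end Classes

/-! ## The bracket in the coordinates `(x, ν)` -/

section PhaseBracket

variable {n : ℕ} {q : ℂ}

/-- The coordinates `x_i` and `ν_i`. -/
def coordFun : Fin n ⊕ Fin n → Phase n → ℂ
  | .inl i => xFun i
  | .inr i => nuFun i

theorem analyticAt_coordFun (a : Fin n ⊕ Fin n) (u : Phase n) :
    AnalyticAt ℂ (coordFun a) u := by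
  cases a
  · exact analyticAt_phase_fst _ u
  · exact analyticAt_phase_snd _ u

theorem phaseDeriv_eq (f : Phase n → ℂ) (u : Phase n) (a : Fin n ⊕ Fin n) :
    phaseDeriv f u a = fderiv ℂ f u (phaseBasis a) := by
  cases a <;> rfl

theorem phaseDeriv_coordFun (a b : Fin n ⊕ Fin n) (u : Phase n) :
    phaseDeriv (coordFun b) u a = if a = b then 1 else 0 := by
  rw [phaseDeriv_eq]
  have hx : ∀ (i : Fin n) (e : Phase n), fderiv ℂ (xFun i) u e = e.1 i := fun i e => by
    have h : xFun i = ((ContinuousLinearMap.proj (R := ℂ) (φ := fun _ : Fin n => ℂ) i).comp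
      (ContinuousLinearMap.fst ℂ (Fin n → ℂ) (Fin n → ℂ)) : Phase n → ℂ) := rfl
    rw [h, ContinuousLinearMap.fderiv]
    rfl
  have hn : ∀ (i : Fin n) (e : Phase n), fderiv ℂ (nuFun i) u e = e.2 i := fun i e => by
    have h : nuFun i = ((ContinuousLinearMap.proj (R := ℂ) (φ := fun _ : Fin n => ℂ) i).comp
      (ContinuousLinearMap.snd ℂ (Fin n → ℂ) (Fin n → ℂ)) : Phase n → ℂ) := rfl
    rw [h, ContinuousLinearMap.fderiv]
    rfl
  match a, b with
  | .inl i, .inl j => simp [coordFun, hx, phaseBasis, Pi.single_apply, eq_comm]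
  | .inl i, .inr j => simp [coordFun, hn, phaseBasis]
  | .inr i, .inl j => simp [coordFun, hx, phaseBasis]
  | .inr i, .inr j => simp [coordFun, hn, phaseBasis, Pi.single_apply, eq_comm]

/-- The logarithmic derivatives `x_i ∂/∂x_i` and `ν_i ∂/∂ν_i`. -/
def logDeriv (a : Fin n ⊕ Fin n) (f : Phase n → ℂ) : Phase n → ℂ :=
  fun u => coordFun a u * phaseDeriv f u a

theorem AnalyticAt.logDeriv {f : Phase n → ℂ} {u : Phase n} (hf : AnalyticAt ℂ f u)
    (a : Fin n ⊕ Fin n) : AnalyticAt ℂ (logDeriv a f) u := by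
  refine (analyticAt_coordFun a u).mul ?_
  simp only [phaseDeriv_eq]
  exact ((ContinuousLinearMap.apply ℂ ℂ (phaseBasis a)).analyticAt _).comp hf.fderiv

theorem logDeriv_add {f g : Phase n → ℂ} {u : Phase n} (hf : DifferentiableAt ℂ f u)
    (hg : DifferentiableAt ℂ g u) (a : Fin n ⊕ Fin n) :
    logDeriv a (f + g) u = logDeriv a f u + logDeriv a g u := by
  simp only [logDeriv, phaseDeriv_eq, fderiv_add hf hg, add_apply, mul_add]

theorem logDeriv_smul {f : Phase n → ℂ} {u : Phase n} (c : ℂ) (hf : DifferentiableAt ℂ f u)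
    (a : Fin n ⊕ Fin n) : logDeriv a (c • f) u = c * logDeriv a f u := by
  simp only [logDeriv, phaseDeriv_eq, fderiv_const_smul hf, smul_apply,
    smul_eq_mul]
  ring

theorem logDeriv_mul {f g : Phase n → ℂ} {u : Phase n} (hf : DifferentiableAt ℂ f u)
    (hg : DifferentiableAt ℂ g u) (a : Fin n ⊕ Fin n) :
    logDeriv a (f * g) u = logDeriv a f u * g u + f u * logDeriv a g u := by
  simp only [logDeriv, phaseDeriv_eq, fderiv_mul hf hg, add_apply,
    smul_apply, smul_eq_mul]
  ring

theorem logDeriv_sum {ι : Type*} (s : Finset ι) {f : ι → Phase n → ℂ} {u : Phase n}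
    (hf : ∀ i ∈ s, DifferentiableAt ℂ (f i) u) (a : Fin n ⊕ Fin n) :
    logDeriv a (∑ i ∈ s, f i) u = ∑ i ∈ s, logDeriv a (f i) u := by
  simp only [logDeriv, phaseDeriv_eq, fderiv_sum hf, sum_apply, Finset.mul_sum]

/-- Symmetry of the second derivative; the extra first order term of x ∂/∂x occurs only for equal
indices. Commutation of the frame is what keeps structure constants out of the Jacobi identity. -/
theorem logDeriv_comm {f : Phase n → ℂ} {u : Phase n} (hf : AnalyticAt ℂ f u)
    (a b : Fin n ⊕ Fin n) : logDeriv a (logDeriv b f) u = logDeriv b (logDeriv a f) u := by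
  have hsymm : IsSymmSndFDerivAt ℂ f u := ContDiffAt.isSymmSndFDerivAt (n := ⊤) hf.contDiffAt (by simp)
  have hd : DifferentiableAt ℂ (fderiv ℂ f) u := hf.fderiv.differentiableAt
  have h : ∀ a b, logDeriv a (logDeriv b f) u = (if a = b then coordFun a u * phaseDeriv f u a else 0) +
      coordFun a u * coordFun b u * fderiv ℂ (fderiv ℂ f) u (phaseBasis a) (phaseBasis b) :=
    fun a b => by
    have h1 : phaseDeriv (fun u => phaseDeriv f u b) u a =
        fderiv ℂ (fderiv ℂ f) u (phaseBasis a) (phaseBasis b) := by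
      simp only [phaseDeriv_eq]
      rw [fderiv_clm_apply hd (differentiableAt_const _)]
      simp
    have h2 : logDeriv b f = coordFun b * fun u => phaseDeriv f u b := rfl
    have h3 : DifferentiableAt ℂ (fun u => phaseDeriv f u b) u := by
      simp only [phaseDeriv_eq]
      exact hd.clm_apply (differentiableAt_const _)
    rw [h2, logDeriv_mul (analyticAt_coordFun b u).differentiableAt h3, logDeriv, logDeriv,
      phaseDeriv_coordFun, h1]
    split_ifs with hab
    · subst hab
      ring
    · ring
  rw [h, h, hsymm.eq]
  congr 1
  · by_cases hab : a = b
    · subst hab; rfl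
    · rw [if_neg hab, if_neg (Ne.symm hab)]
  · ring

/-- The coefficient of `ν_i ν_j` in `{ν_i, ν_j}'`. -/
def nuCoeff (q : ℂ) (i j : Fin n) (u : Phase n) : ℂ :=
  if i = j then 0 else (1 - q) ^ 2 * (u.1 i + u.1 j) * u.1 i * u.1 j /
    ((u.1 i - u.1 j) * (u.1 i - q * u.1 j) * (u.1 j - q * u.1 i))

/-- The coefficients of the bracket in the frame of logarithmic derivatives. -/
def logTensor (q : ℂ) : Fin n ⊕ Fin n → Fin n ⊕ Fin n → Phase n → ℂ
  | .inl _, .inl _ => 0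
  | .inl i, .inr j => fun _ => if i = j then 1 else 0
  | .inr i, .inl j => fun _ => if i = j then -1 else 0
  | .inr i, .inr j => nuCoeff q i j

theorem nuCoeff_antisymm (i j : Fin n) (u : Phase n) :
    nuCoeff q i j u = -nuCoeff q j i u := by
  rw [nuCoeff, nuCoeff]
  by_cases h : i = j
  · simp [h]
  · rw [if_neg h, if_neg (Ne.symm h), ← div_neg]
    congr 1 <;> ring

theorem logTensor_antisymm (a b : Fin n ⊕ Fin n) (u : Phase n) :
    logTensor q a b u = -logTensor q b a u := by
  match a, b with
  | .inl i, .inl j => simp [logTensor]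
  | .inl i, .inr j => simp [logTensor, eq_comm, apply_ite]
  | .inr i, .inl j => simp [logTensor, eq_comm, apply_ite]
  | .inr i, .inr j => exact nuCoeff_antisymm i j u

/-- Every bracket of coordinates is divisible by the two coordinates, and the quotient depends on x
only. -/
theorem phaseTensor_eq (u : Phase n) (a b : Fin n ⊕ Fin n) :
    phaseTensor q u a b = coordFun a u * coordFun b u * logTensor q a b u := by
  match a, b with
  | .inl i, .inl j => simp [phaseTensor, logTensor]
  | .inl i, .inr j => simp [phaseTensor, logTensor, coordFun, xFun, nuFun]
  | .inr i, .inl j =>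
    by_cases h : i = j <;> simp [phaseTensor, logTensor, coordFun, xFun, nuFun, h, mul_comm]
  | .inr i, .inr j =>
    simp only [phaseTensor, logTensor, coordFun, nuFun, nuCoeff]
    split_ifs
    · simp
    · ring

theorem phaseBracket_eq (f g : Phase n → ℂ) :
    phaseBracket q f g = ∑ a, ∑ b, logDeriv a f * logDeriv b g * logTensor q a b := by
  funext u
  simp only [Finset.sum_apply, Pi.mul_apply, phaseBracket, phaseTensor_eq, logDeriv]
  exact Finset.sum_congr rfl fun a _ => Finset.sum_congr rfl fun b _ => by ring

theorem phaseBracket_apply (f g : Phase n → ℂ) (u : Phase n) :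
    phaseBracket q f g u = ∑ a, ∑ b, logDeriv a f u * logDeriv b g u * logTensor q a b u := by
  simp only [phaseBracket_eq, Finset.sum_apply, Pi.mul_apply]

theorem phaseBracket_antisymm (f g : Phase n → ℂ) (u : Phase n) :
    phaseBracket q f g u = -phaseBracket q g f u := by
  rw [phaseBracket_apply, phaseBracket_apply, Finset.sum_comm, ← Finset.sum_neg_distrib]
  refine Finset.sum_congr rfl fun a _ => ?_
  rw [← Finset.sum_neg_distrib]
  refine Finset.sum_congr rfl fun b _ => ?_
  rw [logTensor_antisymm]
  ring

theorem analyticAt_logTensor (hq1 : q ≠ 1) {u : Phase n} (hu : u ∈ phaseDom n q)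
    (a b : Fin n ⊕ Fin n) : AnalyticAt ℂ (logTensor q a b) u := by
  match a, b with
  | .inl i, .inl j => exact analyticAt_const
  | .inl i, .inr j => exact analyticAt_const
  | .inr i, .inl j => exact analyticAt_const
  | .inr i, .inr j =>
    change AnalyticAt ℂ (nuCoeff q i j) u
    have hi := analyticAt_phase_fst i u
    have hj := analyticAt_phase_fst j u
    by_cases h : i = j
    · have h1 : nuCoeff q i j = fun _ : Phase n => 0 := funext fun u => if_pos h
      rw [h1]
      exact analyticAt_const
    · have h1 : nuCoeff q i j = fun u : Phase n => (1 - q) ^ 2 * (u.1 i + u.1 j) * u.1 i * u.1 j /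
          ((u.1 i - u.1 j) * (u.1 i - q * u.1 j) * (u.1 j - q * u.1 i)) := funext fun u => if_neg h
      rw [h1]
      exact (((analyticAt_const.mul (hi.add hj)).mul hi).mul hj).div
        (((hi.sub hj).mul (hi.sub (analyticAt_const.mul hj))).mul
          (hj.sub (analyticAt_const.mul hi)))
        (mul_ne_zero (mul_ne_zero (phase_ne hu h) (phase_ne_mul hq1 hu i j))
          (phase_ne_mul hq1 hu j i))

theorem analyticAt_phaseBracket (hq1 : q ≠ 1) {f g : Phase n → ℂ} {u : Phase n}
    (hu : u ∈ phaseDom n q) (hf : AnalyticAt ℂ f u) (hg : AnalyticAt ℂ g u) :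
    AnalyticAt ℂ (phaseBracket q f g) u := by
  rw [phaseBracket_eq]
  exact Finset.analyticAt_sum _ fun a _ => Finset.analyticAt_sum _ fun b _ =>
    ((AnalyticAt.logDeriv hf a).mul (AnalyticAt.logDeriv hg b)).mul (analyticAt_logTensor hq1 hu a b)

/-! ### The Jacobi identity -/

theorem phaseDeriv_eq_zero_of_line {f : Phase n → ℂ} {u : Phase n} (hf : DifferentiableAt ℂ f u)
    (a : Fin n ⊕ Fin n) (h : ∀ z : ℂ, f (u + z • phaseBasis a) = f u) : phaseDeriv f u a = 0 := by
  have h1 : HasDerivAt (fun z : ℂ => u + z • phaseBasis a) (phaseBasis a) 0 := by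
    simpa using ((hasDerivAt_id (0 : ℂ)).smul_const (phaseBasis a)).const_add u
  have h2 : HasFDerivAt f (fderiv ℂ f u) (u + (0 : ℂ) • phaseBasis a) := by
    simpa using hf.hasFDerivAt
  have h3 := h2.comp_hasDerivAt (0 : ℂ) h1
  rw [phaseDeriv_eq]
  refine h3.unique ?_
  simpa [Function.comp_def, h] using hasDerivAt_const (0 : ℂ) (f u)

theorem logDeriv_logTensor (hq1 : q ≠ 1) {u : Phase n} (hu : u ∈ phaseDom n q)
    (a b d : Fin n ⊕ Fin n)
    (h : ∀ k i j, d = .inl k → a = .inr i → b = .inr j → k ≠ i ∧ k ≠ j) :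
    logDeriv d (logTensor q a b) u = 0 := by
  rw [logDeriv, phaseDeriv_eq_zero_of_line (analyticAt_logTensor hq1 hu a b).differentiableAt,
    mul_zero]
  intro z
  match a, b with
  | .inl i, .inl j => rfl
  | .inl i, .inr j => rfl
  | .inr i, .inl j => rfl
  | .inr i, .inr j =>
    have h1 : ∀ l, l = i ∨ l = j → (u + z • phaseBasis d).1 l = u.1 l := fun l hl => by
      match d with
      | .inr k => simp [phaseBasis]
      | .inl k =>
        have h2 := h k i j rfl rfl rfl
        have h3 : l ≠ k := by
          rintro rfl
          exact hl.elim h2.1 h2.2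
        simp [phaseBasis, h3]
    simp only [logTensor, nuCoeff, h1 i (Or.inl rfl), h1 j (Or.inr rfl)]

/-- Only triples of three ν indices contribute, with the cyclic sum of -x_i ∂c_jk/∂x_i for the
coefficients c = `nuCoeff`. For distinct indices every term is zero, as c_jk depends on x_j and x_k
only; for coinciding indices antisymmetry cancels the terms. The shape of the rational function
plays no further role. -/
theorem jacobi_logTensor (hq1 : q ≠ 1) {u : Phase n} (hu : u ∈ phaseDom n q)
    (a b c : Fin n ⊕ Fin n) :
    ∑ d, (logTensor q a d u * logDeriv d (logTensor q b c) u +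
      logTensor q b d u * logDeriv d (logTensor q c a) u +
      logTensor q c d u * logDeriv d (logTensor q a b) u) = 0 := by
  -- The coefficients do not depend on ν, and in the row of ν_i only the derivative along x_i has a
  -- nonzero entry, -1.
  have hterm : ∀ a b c : Fin n ⊕ Fin n, ∑ d, logTensor q a d u * logDeriv d (logTensor q b c) u =
      match a, b, c with
      | .inr i, .inr j, .inr k => -logDeriv (.inl i) (nuCoeff q j k) u
      | _, _, _ => 0 := fun a b c => by
    have hr : ∀ k, logDeriv (.inr k) (logTensor q b c) u = 0 := fun k =>
      logDeriv_logTensor hq1 hu _ _ _ fun _ _ _ h => by simp at h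
    rw [Fintype.sum_sum_type]
    simp only [hr, mul_zero, Finset.sum_const_zero, add_zero]
    match a, b, c with
    | .inl i, _, _ => simp [logTensor]
    | .inr i, .inr j, .inr k =>
      simp only [logTensor]
      rw [Finset.sum_eq_single i]
      · simp
      · intro l _ hl
        simp [Ne.symm hl]
      · simp
    | .inr i, .inl j, c =>
      refine Finset.sum_eq_zero fun l _ => ?_
      rw [logDeriv_logTensor hq1 hu _ _ _ fun _ _ _ _ h => by simp at h, mul_zero]
    | .inr i, .inr j, .inl k =>
      refine Finset.sum_eq_zero fun l _ => ?_
      rw [logDeriv_logTensor hq1 hu _ _ _ fun _ _ _ _ _ h => by simp at h, mul_zero]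
  rw [Finset.sum_add_distrib, Finset.sum_add_distrib, hterm, hterm, hterm]
  match a, b, c with
  | .inl _, _, _ => simp
  | .inr _, .inl _, _ => simp
  | .inr _, .inr _, .inl _ => simp
  | .inr i, .inr j, .inr k =>
    have hanti : ∀ l i j : Fin n, logDeriv (.inl l) (nuCoeff q i j) u =
        -logDeriv (.inl l) (nuCoeff q j i) u := fun l i j => by
      have h1 : nuCoeff q i j = (-1 : ℂ) • nuCoeff q j i := funext fun u => by
        rw [nuCoeff_antisymm]
        simp
      rw [h1, logDeriv_smul (f := nuCoeff q j i) _ (analyticAt_logTensor hq1 hu (.inr j) (.inr i)).differentiableAt]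
      ring
    have hself : ∀ l i : Fin n, logDeriv (.inl l) (nuCoeff q i i) u = 0 := fun l i =>
      self_eq_neg.1 (hanti l i i)
    have hzero : ∀ l i j : Fin n, l ≠ i → l ≠ j → logDeriv (.inl l) (nuCoeff q i j) u = 0 :=
      fun l i j h1 h2 => logDeriv_logTensor hq1 hu (.inr i) (.inr j) (.inl l)
        fun l' i' j' e1 e2 e3 => by
          cases e1; cases e2; cases e3
          exact ⟨h1, h2⟩
    simp only
    by_cases hij : i = j
    · subst hij
      rw [hself, hanti i i k]
      ring
    · by_cases hik : i = k
      · subst hik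
        rw [hself, hanti i j i]
        ring
      · by_cases hjk : j = k
        · subst hjk
          rw [hself, hanti j j i]
          ring
        · rw [hzero _ _ _ hij hik, hzero _ _ _ hjk (Ne.symm hij),
            hzero _ _ _ (Ne.symm hik) (Ne.symm hjk)]
          ring

/-- The algebraic core of the Jacobi identity for a bracket `∑ f_a g_b S_{ab}` in a commuting
frame. -/
theorem jacobi_of_tensor {ι : Type*} [Fintype ι] (S : ι → ι → ℂ) (dS : ι → ι → ι → ℂ)
    (hS : ∀ a b, S a b = -S b a)
    (hJ : ∀ a b c, ∑ d, (S a d * dS d b c + S b d * dS d c a + S c d * dS d a b) = 0)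
    (f g h : ι → ℂ) (F G H : ι → ι → ℂ) (hF : ∀ a b, F a b = F b a) (hG : ∀ a b, G a b = G b a)
    (hH : ∀ a b, H a b = H b a) :
    ∑ a, ∑ d, f a * (∑ b, ∑ c, (G d b * h c * S b c + g b * H d c * S b c + g b * h c * dS d b c)) *
        S a d +
      ∑ a, ∑ d, g a * (∑ b, ∑ c, (H d b * f c * S b c + h b * F d c * S b c +
        h b * f c * dS d b c)) * S a d +
      ∑ a, ∑ d, h a * (∑ b, ∑ c, (F d b * g c * S b c + f b * G d c * S b c +
        f b * g c * dS d b c)) * S a d = 0 := by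
  -- An iterated bracket splits into two sums with second derivatives and one with the derivative of
  -- the tensor.
  have hsplit : ∀ (f g h : ι → ℂ) (G H : ι → ι → ℂ),
      ∑ a, ∑ d, f a * (∑ b, ∑ c, (G d b * h c * S b c + g b * H d c * S b c +
        g b * h c * dS d b c)) * S a d =
      ∑ a, ∑ d, ∑ b, ∑ c, f a * S a d * G d b * S b c * h c +
      ∑ a, ∑ d, ∑ b, ∑ c, f a * S a d * H d c * S b c * g b +
      ∑ a, ∑ b, ∑ c, f a * g b * h c * ∑ d, S a d * dS d b c := fun f g h G H => by
    have h1 : ∑ a, ∑ b, ∑ c, f a * g b * h c * ∑ d, S a d * dS d b c =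
        ∑ a, ∑ d, ∑ b, ∑ c, f a * S a d * g b * h c * dS d b c := by
      refine Finset.sum_congr rfl fun a _ => ?_
      simp only [Finset.mul_sum]
      calc _ = ∑ b, ∑ d, ∑ c, f a * g b * h c * (S a d * dS d b c) :=
            Finset.sum_congr rfl fun b _ => Finset.sum_comm
        _ = ∑ d, ∑ b, ∑ c, f a * g b * h c * (S a d * dS d b c) := Finset.sum_comm
        _ = _ := Finset.sum_congr rfl fun d _ => Finset.sum_congr rfl fun b _ =>
            Finset.sum_congr rfl fun c _ => by ring
    rw [h1]
    simp only [← Finset.sum_add_distrib]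
    refine Finset.sum_congr rfl fun a _ => Finset.sum_congr rfl fun d _ => ?_
    rw [Finset.mul_sum, Finset.sum_mul]
    refine Finset.sum_congr rfl fun b _ => ?_
    rw [Finset.mul_sum, Finset.sum_mul]
    exact Finset.sum_congr rfl fun c _ => by ring
  -- Second derivatives of one function occur in two of the three iterated brackets; these sums
  -- cancel by symmetry of the Hessian and antisymmetry of S.
  have hcancel : ∀ (f h : ι → ℂ) (G : ι → ι → ℂ), (∀ a b, G a b = G b a) →
      ∑ a, ∑ d, ∑ b, ∑ c, f a * S a d * G d b * S b c * h c +
      ∑ a, ∑ d, ∑ b, ∑ c, h a * S a d * G d c * S b c * f b = 0 := fun f h G hG => by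
    have h1 : ∑ a, ∑ d, ∑ b, ∑ c, h a * S a d * G d c * S b c * f b =
        ∑ b, ∑ c, ∑ d, ∑ a, h a * S a d * G d c * S b c * f b := by
      calc _ = ∑ d, ∑ a, ∑ b, ∑ c, h a * S a d * G d c * S b c * f b := Finset.sum_comm
        _ = ∑ d, ∑ b, ∑ a, ∑ c, h a * S a d * G d c * S b c * f b :=
            Finset.sum_congr rfl fun d _ => Finset.sum_comm
        _ = ∑ d, ∑ b, ∑ c, ∑ a, h a * S a d * G d c * S b c * f b :=
            Finset.sum_congr rfl fun d _ => Finset.sum_congr rfl fun b _ => Finset.sum_comm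
        _ = ∑ b, ∑ d, ∑ c, ∑ a, h a * S a d * G d c * S b c * f b := Finset.sum_comm
        _ = _ := Finset.sum_congr rfl fun b _ => Finset.sum_comm
    rw [h1, ← Finset.sum_add_distrib]
    refine Finset.sum_eq_zero fun a _ => ?_
    rw [← Finset.sum_add_distrib]
    refine Finset.sum_eq_zero fun d _ => ?_
    rw [← Finset.sum_add_distrib]
    refine Finset.sum_eq_zero fun b _ => ?_
    rw [← Finset.sum_add_distrib]
    refine Finset.sum_eq_zero fun c _ => ?_
    rw [hS c b, hG b d]
    ring
  -- After cyclic relabelling, the coefficient of f_a g_b h_c is the tensor identity `hJ`.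
  have hcyc : ∑ a, ∑ b, ∑ c, f a * g b * h c * ∑ d, S a d * dS d b c +
      ∑ a, ∑ b, ∑ c, g a * h b * f c * ∑ d, S a d * dS d b c +
      ∑ a, ∑ b, ∑ c, h a * f b * g c * ∑ d, S a d * dS d b c = 0 := by
    have h1 : ∑ a, ∑ b, ∑ c, g a * h b * f c * ∑ d, S a d * dS d b c =
        ∑ c, ∑ a, ∑ b, g a * h b * f c * ∑ d, S a d * dS d b c := by
      calc _ = ∑ a, ∑ c, ∑ b, g a * h b * f c * ∑ d, S a d * dS d b c :=
            Finset.sum_congr rfl fun a _ => Finset.sum_comm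
        _ = _ := Finset.sum_comm
    have h2 : ∑ a, ∑ b, ∑ c, h a * f b * g c * ∑ d, S a d * dS d b c =
        ∑ b, ∑ c, ∑ a, h a * f b * g c * ∑ d, S a d * dS d b c := by
      calc _ = ∑ b, ∑ a, ∑ c, h a * f b * g c * ∑ d, S a d * dS d b c := Finset.sum_comm
        _ = _ := Finset.sum_congr rfl fun b _ => Finset.sum_comm
    rw [h1, h2]
    simp only [← Finset.sum_add_distrib]
    refine Finset.sum_eq_zero fun a _ => Finset.sum_eq_zero fun b _ =>
      Finset.sum_eq_zero fun c _ => ?_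
    have h3 := hJ a b c
    rw [Finset.sum_add_distrib, Finset.sum_add_distrib] at h3
    linear_combination f a * g b * h c * h3
  rw [hsplit f g h, hsplit g h f, hsplit h f g]
  linear_combination hcancel f h G hG + hcancel g f H hH + hcancel h g F hF + hcyc

theorem logDeriv_phaseBracket (hq1 : q ≠ 1) {f g : Phase n → ℂ} {u : Phase n}
    (hu : u ∈ phaseDom n q) (hf : AnalyticAt ℂ f u) (hg : AnalyticAt ℂ g u) (d : Fin n ⊕ Fin n) :
    logDeriv d (phaseBracket q f g) u = ∑ b, ∑ c,
      (logDeriv d (logDeriv b f) u * logDeriv c g u * logTensor q b c u +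
        logDeriv b f u * logDeriv d (logDeriv c g) u * logTensor q b c u +
        logDeriv b f u * logDeriv c g u * logDeriv d (logTensor q b c) u) := by
  have h1 := fun b => (AnalyticAt.logDeriv hf b).differentiableAt
  have h2 := fun c => (AnalyticAt.logDeriv hg c).differentiableAt
  have h3 := fun b c => (analyticAt_logTensor hq1 hu b c).differentiableAt
  have h4 := fun b c => ((h1 b).mul (h2 c)).mul (h3 b c)
  rw [phaseBracket_eq, logDeriv_sum _ fun b _ => DifferentiableAt.sum fun c _ => h4 b c]
  refine Finset.sum_congr rfl fun b _ => ?_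
  rw [logDeriv_sum _ fun c _ => h4 b c]
  refine Finset.sum_congr rfl fun c _ => ?_
  rw [logDeriv_mul ((h1 b).mul (h2 c)) (h3 b c), logDeriv_mul (h1 b) (h2 c), Pi.mul_apply]
  ring

theorem isPoissonBracketOn_phaseBracket (hq1 : q ≠ 1) :
    IsPoissonBracketOn (phaseDom n q) (phaseBracket q) where
  holomorphic f g hf hg u hu := analyticAt_phaseBracket hq1 hu (hf u hu) (hg u hu)
  linear a b f g h hf hg _ u hu := by
    have hf' := (hf u hu).differentiableAt
    have hg' := (hg u hu).differentiableAt
    simp only [Pi.add_apply, Pi.smul_apply, smul_eq_mul, phaseBracket_apply,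
      logDeriv_add (hf'.const_smul a) (hg'.const_smul b), logDeriv_smul _ hf', logDeriv_smul _ hg',
      Finset.mul_sum, ← Finset.sum_add_distrib]
    exact Finset.sum_congr rfl fun c _ => Finset.sum_congr rfl fun d _ => by ring
  antisymm f g _ _ u _ := phaseBracket_antisymm f g u
  leibniz f g h _ hg hh u hu := by
    simp only [Pi.add_apply, Pi.mul_apply, phaseBracket_apply,
      logDeriv_mul (hg u hu).differentiableAt (hh u hu).differentiableAt, Finset.mul_sum,
      Finset.sum_mul, ← Finset.sum_add_distrib]
    exact Finset.sum_congr rfl fun c _ => Finset.sum_congr rfl fun d _ => by ring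
  jacobi f g h hf hg hh u hu := by
    have hf' := hf u hu
    have hg' := hg u hu
    have hh' := hh u hu
    have key := jacobi_of_tensor (fun a b => logTensor q a b u)
      (fun d b c => logDeriv d (logTensor q b c) u) (fun a b => logTensor_antisymm a b u)
      (fun a b c => jacobi_logTensor hq1 hu a b c) (fun a => logDeriv a f u)
      (fun a => logDeriv a g u) (fun a => logDeriv a h u)
      (fun a b => logDeriv a (logDeriv b f) u) (fun a b => logDeriv a (logDeriv b g) u)
      (fun a b => logDeriv a (logDeriv b h) u) (fun a b => logDeriv_comm hf' a b)
      (fun a b => logDeriv_comm hg' a b) (fun a b => logDeriv_comm hh' a b)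
    rw [Pi.add_apply, Pi.add_apply, Pi.zero_apply, ← key, phaseBracket_apply, phaseBracket_apply,
      phaseBracket_apply]
    simp only [logDeriv_phaseBracket hq1 hu hg' hh', logDeriv_phaseBracket hq1 hu hh' hf',
      logDeriv_phaseBracket hq1 hu hf' hg']

end PhaseBracket

/-! ### Brackets of the coordinate functions -/

section Coordinates

variable {n : ℕ} {q : ℂ}

theorem phaseBracket_coordFun (a b : Fin n ⊕ Fin n) (u : Phase n) :
    phaseBracket q (coordFun a) (coordFun b) u = phaseTensor q u a b := by
  simp [phaseBracket, phaseDeriv_coordFun]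

theorem phaseBracket_values (u : Phase n) (i j : Fin n) :
    phaseBracket q (xFun i) (xFun j) u = 0 ∧
    phaseBracket q (xFun i) (nuFun j) u = (if i = j then u.1 i * u.2 j else 0) ∧
    phaseBracket q (nuFun i) (nuFun j) u = (if i = j then 0 else
      (1 - q) ^ 2 * (u.1 i + u.1 j) * u.1 i * u.1 j * u.2 i * u.2 j /
        ((u.1 i - u.1 j) * (u.1 i - q * u.1 j) * (u.1 j - q * u.1 i))) :=
  ⟨phaseBracket_coordFun (.inl i) (.inl j) u, phaseBracket_coordFun (.inl i) (.inr j) u,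
    phaseBracket_coordFun (.inr i) (.inr j) u⟩

/-! ### Invariance under the symmetric group -/

theorem permute_mem {u : Phase n} (s : Equiv.Perm (Fin n)) (hu : u ∈ phaseDom n q) :
    permute s u ∈ phaseDom n q :=
  ⟨fun i => hu.1 (s i), fun i j h => hu.2.1 (s i) (s j) (s.injective.ne h), fun i => hu.2.2 (s i)⟩

/-- The simultaneous permutation of the coordinates as a continuous linear map. -/
def permuteL (s : Equiv.Perm (Fin n)) : Phase n →L[ℂ] Phase n :=
  LinearMap.toContinuousLinearMap
    { toFun := permute s
      map_add' := fun _ _ => rfl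
      map_smul' := fun _ _ => rfl }

/-- Since `permute s` precomposes with s, it carries the basis vector with label s i to the one with
label i; this fixes the direction of the relabelling below. -/
theorem permute_phaseBasis (s : Equiv.Perm (Fin n)) (a : Fin n ⊕ Fin n) :
    permute s (phaseBasis (Equiv.sumCongr s s a)) = phaseBasis a := by
  cases a with
  | inl i =>
    refine Prod.ext (funext fun j => ?_) rfl
    simp [permute, phaseBasis, Pi.single_apply]
  | inr i =>
    refine Prod.ext rfl (funext fun j => ?_)
    simp [permute, phaseBasis, Pi.single_apply]

theorem phaseDeriv_comp_permute (s : Equiv.Perm (Fin n)) {f : Phase n → ℂ} {u : Phase n}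
    (hf : DifferentiableAt ℂ f (permute s u)) (a : Fin n ⊕ Fin n) :
    phaseDeriv (f ∘ permute s) u (Equiv.sumCongr s s a) = phaseDeriv f (permute s u) a := by
  have h : HasFDerivAt (f ∘ permute s) ((fderiv ℂ f (permute s u)).comp (permuteL s)) u :=
    HasFDerivAt.comp u hf.hasFDerivAt (permuteL s).hasFDerivAt
  rw [phaseDeriv_eq, phaseDeriv_eq, h.fderiv, ← permute_phaseBasis s a]
  rfl

theorem phaseTensor_permute (s : Equiv.Perm (Fin n)) (u : Phase n) (a b : Fin n ⊕ Fin n) :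
    phaseTensor q (permute s u) a b =
      phaseTensor q u (Equiv.sumCongr s s a) (Equiv.sumCongr s s b) := by
  match a, b with
  | .inl i, .inl j => rfl
  | .inl i, .inr j => simp [phaseTensor, permute]
  | .inr i, .inl j => simp [phaseTensor, permute]
  | .inr i, .inr j => simp [phaseTensor, permute]

theorem phaseBracket_comp_permute (s : Equiv.Perm (Fin n)) {f g : Phase n → ℂ} {u : Phase n}
    (hf : DifferentiableAt ℂ f (permute s u)) (hg : DifferentiableAt ℂ g (permute s u)) :
    phaseBracket q (f ∘ permute s) (g ∘ permute s) u = phaseBracket q f g (permute s u) := by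
  rw [phaseBracket, ← Equiv.sum_comp (Equiv.sumCongr s s)]
  refine Finset.sum_congr rfl fun a _ => ?_
  rw [← Equiv.sum_comp (Equiv.sumCongr s s)]
  refine Finset.sum_congr rfl fun b _ => ?_
  rw [phaseDeriv_comp_permute s hf, phaseDeriv_comp_permute s hg, phaseTensor_permute]

/-! ### Log-canonical coordinates -/

/-- The factor `σ_i / ν_i`. -/
def sigmaFactor (q : ℂ) (i : Fin n) (x : Fin n → ℂ) : ℂ :=
  ∏ j ∈ Finset.univ.erase i, (1 - x i * (x j)⁻¹) / (1 - q * x i * (x j)⁻¹)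

theorem one_sub_ne {u : Phase n} (hu : u ∈ phaseDom n q) {i j : Fin n} (h : i ≠ j) :
    1 - u.1 i * (u.1 j)⁻¹ ≠ 0 := fun h1 => by
  have h2 := hu.1 j
  refine phase_ne hu h ?_
  field_simp at h1
  linear_combination -h1

theorem one_sub_mul_ne (hq1 : q ≠ 1) {u : Phase n} (hu : u ∈ phaseDom n q) (i j : Fin n) :
    1 - q * u.1 i * (u.1 j)⁻¹ ≠ 0 := fun h1 => by
  have h2 := hu.1 j
  refine phase_ne_mul hq1 hu j i ?_
  field_simp at h1
  linear_combination h1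

theorem sigmaFactor_ne_zero (hq1 : q ≠ 1) {u : Phase n} (hu : u ∈ phaseDom n q) (i : Fin n) :
    sigmaFactor q i u.1 ≠ 0 :=
  Finset.prod_ne_zero_iff.2 fun _ hj =>
    div_ne_zero (one_sub_ne hu (Finset.ne_of_mem_erase hj).symm) (one_sub_mul_ne hq1 hu _ _)

theorem analyticAt_sigmaFactor (hq1 : q ≠ 1) {u : Phase n} (hu : u ∈ phaseDom n q) (i : Fin n) :
    AnalyticAt ℂ (fun w : Phase n => sigmaFactor q i w.1) u := by
  refine Finset.analyticAt_fun_prod _ fun j _ => ?_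
  have hi := analyticAt_phase_fst i u
  have hj := (analyticAt_phase_fst j u).fun_inv (hu.1 j)
  exact (analyticAt_const.sub (hi.mul hj)).div
    (analyticAt_const.sub ((analyticAt_const.mul hi).mul hj)) (one_sub_mul_ne hq1 hu i j)

theorem analyticAt_sigmaFun (hq1 : q ≠ 1) {u : Phase n} (hu : u ∈ phaseDom n q) (i : Fin n) :
    AnalyticAt ℂ (sigmaFun q i) u :=
  (analyticAt_phase_snd i u).mul (analyticAt_sigmaFactor hq1 hu i)

/-- σ_i is ν_i times a function of x. -/
theorem logDeriv_nu_sigmaFun (hq1 : q ≠ 1) {u : Phase n} (hu : u ∈ phaseDom n q) (k i : Fin n) :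
    logDeriv (.inr k) (sigmaFun q i) u = if k = i then sigmaFun q i u else 0 := by
  have h1 : sigmaFun q i = coordFun (.inr i) * fun w : Phase n => sigmaFactor q i w.1 := rfl
  have h2 := (analyticAt_sigmaFactor hq1 hu i).differentiableAt
  rw [h1, logDeriv_mul (analyticAt_coordFun _ u).differentiableAt h2]
  have h3 : phaseDeriv (fun w : Phase n => sigmaFactor q i w.1) u (.inr k) = 0 :=
    phaseDeriv_eq_zero_of_line h2 _ fun z => by simp [phaseBasis]
  simp only [logDeriv, h3, phaseDeriv_coordFun, Pi.mul_apply, mul_zero, add_zero]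
  by_cases h : k = i
  · simp [h]
  · simp [h]

/-- With a = x_k and b = x_i, the left side is what the quotient rule yields for x_k ∂/∂x_k of the
one factor of σ_i that contains x_k, with R the product of the others; the right side is the
logarithmic derivative times the value. -/
theorem moebius_deriv_identity {a b d e R : ℂ} (ha : a ≠ 0) (hd : d ≠ 0) (he : e ≠ 0)
    (hda : d = a - q * b) (hea : e = a - b) :
    R * ((-(b * (-1 / a ^ 2)) * (d / a) - e / a * -(q * b * (-1 / a ^ 2))) / (d / a) ^ 2) * a =
      R * (e / a / (d / a)) * (a / e - a / d) := by
  field_simp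
  rw [hda, hea]
  ring

/-- With a = x_i and b = x_j, the rational function in {ν_i, ν_j}' is in partial fractions the
difference of the logarithmic derivatives of σ_j and σ_i, which is why σ is log-canonical. -/
theorem sigma_bracket_identity {a b : ℂ} (s t : ℂ) (h1 : a - b ≠ 0) (h2 : a - q * b ≠ 0)
    (h3 : b - q * a ≠ 0) :
    s * t * ((b / (b - a) - b / (b - q * a)) - (a / (a - b) - a / (a - q * b)) +
      (1 - q) ^ 2 * (a + b) * a * b / ((a - b) * (a - q * b) * (b - q * a))) = 0 := by
  have h : (b / (b - a) - b / (b - q * a)) - (a / (a - b) - a / (a - q * b)) =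
      -((1 - q) ^ 2 * (a + b) * a * b / ((a - b) * (a - q * b) * (b - q * a))) := by
    rw [← neg_sub a b, div_neg, ← neg_div, div_sub_div _ _ h1 h3, div_sub_div _ _ h1 h2,
      div_sub_div _ _ (mul_ne_zero h1 h3) (mul_ne_zero h1 h2), ← neg_div,
      div_eq_div_iff (by simp [h1, h2, h3]) (by simp [h1, h2, h3])]
    ring
  rw [h, neg_add_cancel, mul_zero]

/-- For k ≠ i only the factor j = k contains x_k, so the derivative along this line is that of a
Möbius function of 1/x_k. -/
theorem logDeriv_x_sigmaFun (hq1 : q ≠ 1) {u : Phase n} (hu : u ∈ phaseDom n q) {k i : Fin n}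
    (hki : k ≠ i) : logDeriv (.inl k) (sigmaFun q i) u =
      sigmaFun q i u * (u.1 k / (u.1 k - u.1 i) - u.1 k / (u.1 k - q * u.1 i)) := by
  set R : ℂ := u.2 i * ∏ j ∈ (Finset.univ.erase i).erase k,
    (1 - u.1 i * (u.1 j)⁻¹) / (1 - q * u.1 i * (u.1 j)⁻¹) with hR
  have hmem : k ∈ Finset.univ.erase i := Finset.mem_erase.2 ⟨hki, Finset.mem_univ k⟩
  have hline : ∀ z : ℂ, sigmaFun q i (u + z • phaseBasis (.inl k)) =
      R * ((1 - u.1 i * (u.1 k + z)⁻¹) / (1 - q * u.1 i * (u.1 k + z)⁻¹)) := fun z => by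
    have h1 : ∀ j, j ≠ k → (u + z • phaseBasis (.inl k)).1 j = u.1 j := fun j hj => by
      simp [phaseBasis, hj]
    have h2 : (u + z • phaseBasis (.inl k)).1 k = u.1 k + z := by simp [phaseBasis]
    have h3 : (u + z • phaseBasis (.inl k)).2 i = u.2 i := by simp [phaseBasis]
    rw [sigmaFun, ← Finset.mul_prod_erase _ _ hmem, h3, h2, h1 i (Ne.symm hki), hR,
      Finset.prod_congr rfl fun j hj => by rw [h1 j (Finset.ne_of_mem_erase hj)]]
    ring
  have hk := hu.1 k
  have hne1 := phase_ne hu hki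
  have hne2 := phase_ne_mul hq1 hu k i
  have hne3 := one_sub_mul_ne hq1 hu i k
  have hd1 : HasDerivAt (fun z : ℂ => u + z • phaseBasis (.inl k)) (phaseBasis (.inl k)) 0 := by
    simpa using ((hasDerivAt_id (0 : ℂ)).smul_const (phaseBasis (.inl k))).const_add u
  have hd2 : HasFDerivAt (sigmaFun q i) (fderiv ℂ (sigmaFun q i) u)
      (u + (0 : ℂ) • phaseBasis (.inl k)) := by
    simpa using (analyticAt_sigmaFun hq1 hu i).differentiableAt.hasFDerivAt
  have hd3 := hd2.comp_hasDerivAt (0 : ℂ) hd1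
  have hinv : HasDerivAt (fun z : ℂ => (u.1 k + z)⁻¹) (-1 / u.1 k ^ 2) 0 := by
    have h1 : HasDerivAt (fun z : ℂ => u.1 k + z) 1 0 := (hasDerivAt_id (0 : ℂ)).const_add _
    simpa using h1.fun_inv (by simpa using hk)
  have hd4 := (((hinv.const_mul (u.1 i)).const_sub 1).div
    ((hinv.const_mul (q * u.1 i)).const_sub 1) (by simpa using hne3)).const_mul R
  have hd5 : HasDerivAt (sigmaFun q i ∘ fun z : ℂ => u + z • phaseBasis (.inl k)) _ 0 :=
    hd4.congr_of_eventuallyEq (Filter.Eventually.of_forall hline)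
  have h0 := hline 0
  rw [zero_smul, add_zero] at h0
  rw [logDeriv, phaseDeriv_eq, hd3.unique hd5, h0]
  simp only [coordFun, xFun, add_zero]
  have e1 : 1 - u.1 i * (u.1 k)⁻¹ = (u.1 k - u.1 i) / u.1 k := by field_simp
  have e2 : 1 - q * u.1 i * (u.1 k)⁻¹ = (u.1 k - q * u.1 i) / u.1 k := by field_simp
  rw [e1, e2, mul_comm]
  exact moebius_deriv_identity hk hne2 hne1 rfl rfl

theorem phaseBracket_x_sigmaFun (hq1 : q ≠ 1) {u : Phase n} (hu : u ∈ phaseDom n q)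
    (i j : Fin n) : phaseBracket q (xFun i) (sigmaFun q j) u =
      if i = j then u.1 i * sigmaFun q j u else 0 := by
  have h : ∀ a, logDeriv a (xFun i) u = if a = .inl i then u.1 i else 0 := fun a => by
    change coordFun a u * phaseDeriv (coordFun (.inl i)) u a = _
    rw [phaseDeriv_coordFun]
    by_cases ha : a = .inl i
    · subst ha
      simp [coordFun, xFun]
    · simp [ha]
  rw [phaseBracket_apply, Finset.sum_eq_single (.inl i)]
  · rw [Fintype.sum_sum_type]
    simp [h, logTensor, logDeriv_nu_sigmaFun hq1 hu, eq_comm]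
  · intro a _ ha
    simp [h, ha]
  · simp

theorem phaseBracket_sigmaFun (hq1 : q ≠ 1) {u : Phase n} (hu : u ∈ phaseDom n q)
    (i j : Fin n) : phaseBracket q (sigmaFun q i) (sigmaFun q j) u = 0 := by
  by_cases hij : i = j
  · subst hij
    exact self_eq_neg.1 (phaseBracket_antisymm _ _ _)
  · have h1 := phase_ne hu hij
    have h2 := phase_ne_mul hq1 hu i j
    have h3 := phase_ne_mul hq1 hu j i
    have h4 : u.1 j - u.1 i ≠ 0 := phase_ne hu (Ne.symm hij)
    -- The bracket pairs each x_k only with ν_k, and the ν-derivative of σ_j singles out k = j. So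
    -- one derivative of each σ survives, plus the (ν_i, ν_j) term.
    have hsum : phaseBracket q (sigmaFun q i) (sigmaFun q j) u =
        logDeriv (.inl j) (sigmaFun q i) u * sigmaFun q j u -
          sigmaFun q i u * logDeriv (.inl i) (sigmaFun q j) u +
          sigmaFun q i u * sigmaFun q j u * nuCoeff q i j u := by
      rw [phaseBracket_apply]
      simp only [Fintype.sum_sum_type, logTensor, logDeriv_nu_sigmaFun hq1 hu]
      simp [Finset.sum_add_distrib]
      ring
    rw [hsum, logDeriv_x_sigmaFun hq1 hu (Ne.symm hij), logDeriv_x_sigmaFun hq1 hu hij, nuCoeff,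
      if_neg hij, ← sigma_bracket_identity (sigmaFun q i u) (sigmaFun q j u) h1 h2 h3]
    ring

/-- The change of variables `(x, ν) ↦ (x, σ)` is biholomorphic. -/
theorem exists_inverse_sigmaMap (hq1 : q ≠ 1) : ∃ τ : Phase n → Phase n,
    AnalyticOnNhd ℂ (sigmaMap q) (phaseDom n q) ∧ AnalyticOnNhd ℂ τ (phaseDom n q) ∧
    Set.MapsTo (sigmaMap q) (phaseDom n q) (phaseDom n q) ∧
    Set.MapsTo τ (phaseDom n q) (phaseDom n q) ∧
    Set.InvOn τ (sigmaMap q) (phaseDom n q) (phaseDom n q) := by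
  -- The variable x is unchanged and σ_i / ν_i is a nonvanishing function of x, so the inverse
  -- divides by it.
  refine ⟨fun u => (u.1, fun i => u.2 i / sigmaFactor q i u.1), fun u hu => ?_, fun u hu => ?_,
    fun u hu => ⟨hu.1, hu.2.1, fun i => ?_⟩, fun u hu => ⟨hu.1, hu.2.1, fun i => ?_⟩,
    fun u hu => ?_, fun u hu => ?_⟩
  · exact analyticAt_fst.prod (analyticAt_pi_iff.2 fun i => analyticAt_sigmaFun hq1 hu i)
  · exact analyticAt_fst.prod (analyticAt_pi_iff.2 fun i =>
      (analyticAt_phase_snd i u).div (analyticAt_sigmaFactor hq1 hu i)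
        (sigmaFactor_ne_zero hq1 hu i))
  · exact mul_ne_zero (hu.2.2 i) (sigmaFactor_ne_zero hq1 hu i)
  · exact div_ne_zero (hu.2.2 i) (sigmaFactor_ne_zero hq1 hu i)
  · refine Prod.ext rfl (funext fun i => ?_)
    exact mul_div_cancel_right₀ _ (sigmaFactor_ne_zero hq1 hu i)
  · refine Prod.ext rfl (funext fun i => ?_)
    exact div_mul_cancel₀ _ (sigmaFactor_ne_zero hq1 hu i)

end Coordinates
end Tadpole
end

theorem proposition3p4 (n : ℕ) (q : ℂ) (hq0 : q ≠ 0) (hq : ∀ k : ℕ, 0 < k → q ^ k ≠ 1) :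
    -- The class of `ξ(x, ν)` is determined by `X = diag(x)` and `Z`.
    (∀ (u : Tadpole.phaseDom n q) (p : Tadpole.momentLevel n q),
      Tadpole.toCM p = Tadpole.xi hq0 hq u ↔
        ∃ g : GL (Fin n) ℂ,
          g.val * Tadpole.matX p.1 * g⁻¹.val = Matrix.diagonal u.1.1 ∧
          g.val * (Tadpole.matY p.1 + (Tadpole.matX p.1)⁻¹) * g⁻¹.val = Tadpole.zMat q u.1) ∧
    -- `ξ` descends to an injective map on the quotient by the symmetric group.
    (∀ u u' : Tadpole.phaseDom n q,
      Tadpole.xi hq0 hq u = Tadpole.xi hq0 hq u' ↔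
        ∃ s : Equiv.Perm (Fin n), u'.1 = Tadpole.permute s u.1) ∧
    -- `ξ` is a local diffeomorphism.
    Tadpole.IsLocalBiholomorphism (Tadpole.xi (n := n) hq0 hq) ∧
    -- The bracket on `h_reg × h^×` is Poisson, has the stated values, and is `S_n`-invariant.
    Tadpole.IsPoissonBracketOn (Tadpole.phaseDom n q) (Tadpole.phaseBracket q) ∧
    (∀ u ∈ Tadpole.phaseDom n q, ∀ i j : Fin n,
      Tadpole.phaseBracket q (Tadpole.xFun i) (Tadpole.xFun j) u = 0 ∧
      Tadpole.phaseBracket q (Tadpole.xFun i) (Tadpole.nuFun j) u =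
        (if i = j then u.1 i * u.2 j else 0) ∧
      Tadpole.phaseBracket q (Tadpole.nuFun i) (Tadpole.nuFun j) u =
        (if i = j then 0 else
          (1 - q) ^ 2 * (u.1 i + u.1 j) * u.1 i * u.1 j * u.2 i * u.2 j /
            ((u.1 i - u.1 j) * (u.1 i - q * u.1 j) * (u.1 j - q * u.1 i)))) ∧
    (∀ (s : Equiv.Perm (Fin n)) (f g : Tadpole.Phase n → ℂ),
      AnalyticOnNhd ℂ f (Tadpole.phaseDom n q) → AnalyticOnNhd ℂ g (Tadpole.phaseDom n q) →
      ∀ u ∈ Tadpole.phaseDom n q,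
        Tadpole.phaseBracket q (f ∘ Tadpole.permute s) (g ∘ Tadpole.permute s) u =
          Tadpole.phaseBracket q f g (Tadpole.permute s u)) ∧
    -- `ξ` is a Poisson map: `{f, g} ∘ ξ = {f ∘ ξ, g ∘ ξ}'`, where `{f, g}` is computed from
    -- arbitrary holomorphic extensions `F`, `G` of `f`, `g` at any point of the orbit.
    (∀ (f g : Tadpole.CMSpace n q → ℂ) (u : Tadpole.phaseDom n q) (p : Tadpole.momentLevel n q)
      (F G : Tadpole.RepSpace n → ℂ),
      Tadpole.toCM p = Tadpole.xi hq0 hq u → Tadpole.IsLiftAt f p F → Tadpole.IsLiftAt g p G →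
        Tadpole.quasiBracket F G p.1 =
          Tadpole.phaseBracket q (Tadpole.xiPull hq0 hq f) (Tadpole.xiPull hq0 hq g) u.1) ∧
    -- The functions `σ_i` together with the `x_i` are log-canonical coordinates.
    (∀ u ∈ Tadpole.phaseDom n q, ∀ i j : Fin n,
      Tadpole.phaseBracket q (Tadpole.xFun i) (Tadpole.xFun j) u = 0 ∧
      Tadpole.phaseBracket q (Tadpole.xFun i) (Tadpole.sigmaFun q j) u =
        (if i = j then u.1 i * Tadpole.sigmaFun q j u else 0) ∧
      Tadpole.phaseBracket q (Tadpole.sigmaFun q i) (Tadpole.sigmaFun q j) u = 0) ∧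
    (∃ τ : Tadpole.Phase n → Tadpole.Phase n,
      AnalyticOnNhd ℂ (Tadpole.sigmaMap q) (Tadpole.phaseDom n q) ∧
      AnalyticOnNhd ℂ τ (Tadpole.phaseDom n q) ∧
      Set.MapsTo (Tadpole.sigmaMap q) (Tadpole.phaseDom n q) (Tadpole.phaseDom n q) ∧
      Set.MapsTo τ (Tadpole.phaseDom n q) (Tadpole.phaseDom n q) ∧
      Set.InvOn τ (Tadpole.sigmaMap q) (Tadpole.phaseDom n q) (Tadpole.phaseDom n q)) := by
  have hq1 : q ≠ 1 := by simpa using hq 1 one_pos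
  exact ⟨fun u p => Tadpole.toCM_eq_xi_iff hq0 hq u p,
    fun u u' => Tadpole.xi_eq_xi_iff hq0 hq u u',
    Tadpole.isLocalBiholomorphism_xi hq0 hq,
    Tadpole.isPoissonBracketOn_phaseBracket hq1,
    fun u _ i j => Tadpole.phaseBracket_values u i j,
    fun s f g hf hg u hu => Tadpole.phaseBracket_comp_permute s
      (hf _ (Tadpole.permute_mem s hu)).differentiableAt
      (hg _ (Tadpole.permute_mem s hu)).differentiableAt,
    fun f g u p F G hp hF hG => Tadpole.quasiBracket_eq_phaseBracket hq0 hq f g u p F G hp hF hG,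
    fun u hu i j => ⟨(Tadpole.phaseBracket_values u i j).1,
      Tadpole.phaseBracket_x_sigmaFun hq1 hu i j, Tadpole.phaseBracket_sigmaFun hq1 hu i j⟩,
    Tadpole.exists_inverse_sigmaMap hq1⟩
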